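/- **Setting.** Fix infinite sets of individuals $\mathbf I$ and variables, and sets of atomic concepts $A$ and atomic roles $P$. Roles $R$ are $P$ or $P^-$ (with $(P^-)^-=P$); concepts are $A$ or $\exists R$. A $\textit{DL-Lite}_{core}$ TBox $\mathcal T$ is a finite set of inclusions $C_1\sqsubseteq C_2$ and disjointness axioms $\mathsf{Disj}(C_1,C_2)$ between concepts; $\mathcal T\models C_0\sqsubseteq C$ denotes entailment under the usual set semantics. A bag ABox $\mathcal A$ gives a multiplicity in $\mathbb N$ to each assertion $A(a)$, $P(a,b)$, non-zero for finitely many. A bag interpretation has a non-empty domain, interprets individuals injectively, and interprets atomic concepts (roles) as functions from elements (pairs of elements) to $\mathbb N\cup\{\infty\}$, where $(P^-)(u,v)=P(v,u)$ and $(\exists R)(u)=\sum_v R(u,v)$. *Canonical model* $\mathcal C_{\langle\mathcal T,\mathcal A\rangle}$: the union (pointwise supremum) of stages $\mathcal C_0,\mathcal C_1,\dots$. Stage $\mathcal C_0$ has domain $\mathbf I$ and the multiplicities of $\mathcal A$. For $u$ in the domain of $\mathcal C_i$ let $\mathrm{cl}_i(u,C)=\max\{C_0^{\mathcal C_i}(u):\mathcal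 T\models C_0\sqsubseteq C\}$. Stage $\mathcal C_{i+1}$ adds, for each such $u$ and each role $R$, fresh "anonymous" elements $w^1_{u,R},\dots,w^\delta_{u,R}$ with $\delta=\mathrm{cl}_i(u,\exists R)-(\exists R)^{\mathcal C_i}(u)$; it puts $A(u)=\mathrm{cl}_i(u,A)$ for old $u$ and $A(u)=0$ for new $u$; it keeps role multiplicities between old elements, puts $P(u,w^j_{u,P})=1$ and $P(w^j_{u,P^-},u)=1$ for the new elements, and $0$ for all other pairs. *Queries.* A CQ $q(\mathbf x)=\exists\mathbf y.\,\phi(\mathbf x,\mathbf y)$ has a body $\phi$ that is a non-empty finite conjunction (repetitions count) of atoms $A(t)$, $P(t_1,t_2)$, $v=t$, with $v\in\mathbf x\cup\mathbf y$ and all terms in $\mathbf x\cup\mathbf y\cup\mathbf I$. Equalities (read symmetrically) generate an equivalence relation on terms; the Gaifman graph has the classes of the terms of $\phi$ as nodes and joins the classes of two terms that share an atom. CQs are safe: the class of each variable in $\mathbf x\cup\mathbf y$ contains a term of a non-equality atom. $q$ is rooted if each connected component of the Gaifman graph has a node containing a term of $\mathbf x\cup\mathbf I$. The bag answers $q^{\mathcal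 I}$ give to a tuple $\mathbf a$ of individuals the sum, over all valuations $\lambda$ of $\mathbf x\cup\mathbf y$ with $\lambda(\mathbf x)=\mathbf a^{\mathcal I}$ that satisfy the equalities, of the product of the multiplicities of the non-equality atoms under $\lambda$. A $\mathrm{BALG}^1_\varepsilon$-query, with its set of answer variables, is built from atoms $A(t)$, $P(t_1,t_2)$ (answer variables: those occurring) by join $q_1\wedge q_2$ (union of the answer variables; multiplicities multiply), selection $q_0\wedge(v=t)$ with $v$ an answer variable of $q_0$ (the variable $t$, if any, is added), projection $\exists\mathbf y.\,q_0$ (sum over the values of $\mathbf y$), and, for queries with the same answer variables, max union $q_1\vee q_2$, arithmetic union $q_1\veebar q_2$ (sum) and truncated difference $q_1\setminus q_2$. **Rewriting $\bar q$ of a rooted CQ $q$ over $\mathcal T$.** Let $\mathbf z\subseteq\mathbf y$ be equality-consistent: no equality of $\phi$ relates a variable in $\mathbf z$ to a term not in $\mathbf z$. A non-empty $\mathbf z'\subseteq\mathbf z$ is ma-connected if it is a union of equivalence classes and these classes form a maximal connected subset, in the Gaifman graph, of the classes of $\mathbf z$. For such $\mathbf z'$ let $\phi_{\mathbf z'}$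 consist of the atoms of $\phi$ mentioning a variable of $\mathbf z'$, let $\alpha_{\mathbf z'}$ be any atom of $\phi_{\mathbf z'}$ of the form $P(t,z)$ or $P(z,t)$ with $z\in\mathbf z'$, $t\notin\mathbf z$, and let $\mathbf t_{\mathbf z'}$ be the set of all terms $t$ of such atoms. Let $a$ be an individual in $\mathbf t_{\mathbf z'}$ if there is one and a fresh individual otherwise, and let $b\ne a$ be fresh, where fresh means not occurring in $q$. Then $\mathbf z'$ is realisable by $\mathcal T$ if the query $\phi_{\mathbf z'}\wedge\bigwedge_{t\in\mathbf t_{\mathbf z'}}(t=a)\wedge\bigwedge_{z\in\mathbf z'}(z\neq a)$, with all variables existentially quantified, has multiplicity at least $1$ in $\mathcal C_{\langle\mathcal T,\mathcal A'\rangle}$, where $\mathcal A'$ consists of the single assertion $P(a,b)$ if $\alpha_{\mathbf z'}=P(t,z)$, and $P(b,a)$ if $\alpha_{\mathbf z'}=P(z,t)$. The set $\mathbf z\subseteq\mathbf y$ is realisable by $\mathcal T$ if it is equality-consistent and all its non-empty ma-connected subsets are realisable by $\mathcal T$. For realisable $\mathbf z$, obtain $\phi_{\mathbf z}$ from $\phi$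 by replacing, for each non-empty ma-connected $\mathbf z'\subseteq\mathbf z$, the conjunction $\phi_{\mathbf z'}$ by $\alpha_{\mathbf z'}\wedge\bigwedge(v=t)$ over all variables $v\in\mathbf t_{\mathbf z'}$ and terms $t\in\mathbf t_{\mathbf z'}$. Let $\mathbf y_{\mathbf z}$ be the variables of $\mathbf y\setminus\mathbf z$ occurring in $\phi_{\mathbf z}$. With $\zeta_A(t)=A(t)$, $\zeta_{\exists P}(t)=\exists w.P(t,w)$, $\zeta_{\exists P^-}(t)=\exists w.P(w,t)$ (where $w$ is a variable different from $t$), obtain $\psi_{\mathbf z}$ from $\phi_{\mathbf z}$ by replacing each $A(t)$ by $\bigvee_{\mathcal T\models C\sqsubseteq A}\zeta_C(t)$, each $P(t,z)$ with $z\in\mathbf z$ by $\big(\bigvee_{\mathcal T\models C\sqsubseteq\exists P}\zeta_C(t)\big)\setminus\zeta_{\exists P}(t)$, and each $P(z,t)$ with $z\in\mathbf z$ by $\big(\bigvee_{\mathcal T\models C\sqsubseteq\exists P^-}\zeta_C(t)\big)\setminus\zeta_{\exists P^-}(t)$. Finally, $\bar q$ is the arithmetic union of the queries $\exists\mathbf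 y_{\mathbf z}.\,\psi_{\mathbf z}$ over all $\mathbf z\subseteq\mathbf y$ that are realisable by $\mathcal T$. (These disjunctions are finite.) **Theorem.** Let $q(\mathbf x)$ be a rooted CQ and $\mathcal T$ a $\textit{DL-Lite}_{core}$ TBox. The choices in the construction can be made, and for every choice of the atoms $\alpha_{\mathbf z'}$, the individuals $a,b$ and the bound variables $w$: 1. $\bar q$ is a $\mathrm{BALG}^1_\varepsilon$-query with answer variables $\mathbf x$, up to equivalence over all bag interpretations (i.e. some $\mathrm{BALG}^1_\varepsilon$-query with answer variables $\mathbf x$ has the same multiplicities as $\bar q$ in every bag interpretation under every assignment); 2. for every bag ABox $\mathcal A$, $\;q^{\mathcal C_{\langle\mathcal T,\mathcal A\rangle}}=\bar q^{\,\mathcal C_{\langle\emptyset,\mathcal A\rangle}}$. -/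

import Mathlib

noncomputable section

open scoped Classical

namespace BagDL

/-! ### Vocabulary, TBoxes, bag ABoxes

`I`, `V`, `C`, `R` are the sets of individuals, variables, atomic concepts and atomic roles. -/

/-- Roles: an atomic role or its inverse. -/
inductive Role (R : Type) : Type
  | atom (P : R)
  | inv (P : R)

/-- Concepts: an atomic concept or an unqualified existential `∃ S` over a role `S`. -/
inductive Concept (C R : Type) : Type
  | atom (A : C)
  | ex (S : Role R)

/-- The inverse of a role; `(P⁻)⁻` is `P`. -/
def Role.inverse {R : Type} : Role R → Role R
  | .atom P => .inv P
  | .inv P => .atom P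

/-- Axioms of `DL-Lite_core`: inclusions and disjointness axioms between concepts. -/
inductive TBoxAxiom (C R : Type) : Type
  | incl (D E : Concept C R)
  | disj (D E : Concept C R)

/-- A `DL-Lite_core` TBox is a finite set of inclusions and disjointness axioms for concepts. -/
abbrev TBox (C R : Type) : Type := Finset (TBoxAxiom C R)

/-- Concept assertions `A(a)` and role assertions `P(a, b)`. -/
inductive Assertion (I C R : Type) : Type
  | concept (A : C) (a : I)
  | role (P : R) (a b : I)

/-- A bag ABox is a finite bag of assertions (finite support, finite multiplicities). -/
abbrev ABox (I C R : Type) : Type := Assertion I C R →₀ ℕ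

/-! ### Set semantics and entailment of inclusions -/

/-- Interpretations (set semantics, unique name assumption). -/
structure Interp (I C R : Type) where
  Dom : Type
  nonempty : Nonempty Dom
  ind : I → Dom
  ind_injective : Function.Injective ind
  concept : C → Set Dom
  role : R → Set (Dom × Dom)

/-- The extension of a role. -/
def Interp.roleExt {I C R : Type} (J : Interp I C R) : Role R → Set (J.Dom × J.Dom)
  | .atom P => J.role P
  | .inv P => {p | (p.2, p.1) ∈ J.role P}

/-- The extension of a concept. -/
def Interp.conceptExt {I C R : Type} (J : Interp I C R) : Concept C R → Set J.Dom
  | .atom A => J.concept A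
  | .ex S => {u | ∃ v, (u, v) ∈ J.roleExt S}

/-- Satisfaction of an axiom. -/
def Interp.SatAxiom {I C R : Type} (J : Interp I C R) : TBoxAxiom C R → Prop
  | .incl D E => J.conceptExt D ⊆ J.conceptExt E
  | .disj D E => J.conceptExt D ∩ J.conceptExt E = ∅

/-- `T ⊨ D ⊑ E`: the inclusion holds in every interpretation that satisfies `T`. -/
def Entails (I : Type) {C R : Type} (T : TBox C R) (D E : Concept C R) : Prop :=
  ∀ J : Interp I C R, (∀ α ∈ T, J.SatAxiom α) → J.conceptExt D ⊆ J.conceptExt E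

/-- The atomic role of a role. -/
def Role.base {R : Type} : Role R → R
  | .atom P => P
  | .inv P => P

/-- The atomic concept or atomic role that occurs in a concept. -/
def Concept.symb {C R : Type} : Concept C R → C ⊕ R
  | .atom A => .inl A
  | .ex S => .inr S.base

/-- The symbols that occur in an axiom. -/
def TBoxAxiom.symbs {C R : Type} : TBoxAxiom C R → Finset (C ⊕ R)
  | .incl D E => {D.symb, E.symb}
  | .disj D E => {D.symb, E.symb}

/-- The interpretation in which the predicate `s` is full and all others are empty. -/
def fullAt (I : Type) {C R : Type} (s : C ⊕ R) : Interp I C R where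
  Dom := Option I
  nonempty := ⟨none⟩
  ind := some
  ind_injective := Option.some_injective I
  concept A := {_u | s = .inl A}
  role P := {_p | s = .inr P}

theorem mem_fullAt_conceptExt {I C R : Type} (s : C ⊕ R) (D : Concept C R)
    (u : (fullAt I s).Dom) : u ∈ (fullAt I s).conceptExt D ↔ s = D.symb := by
  cases D with
  | atom A => exact Iff.rfl
  | ex S => cases S <;> exact ⟨fun ⟨_, h⟩ => h, fun h => ⟨u, h⟩⟩

/-- Only finitely many concepts are subsumed by a given concept with respect to a TBox. -/
theorem finite_entails (I : Type) {C R : Type} (T : TBox C R) (E : Concept C R) :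
    {D | Entails I T D E}.Finite := by
  have hfin : (((T.biUnion TBoxAxiom.symbs ∪ {E.symb} : Finset (C ⊕ R)) : Set (C ⊕ R))).Finite :=
    Finset.finite_toSet _
  have hpre : {D : Concept C R |
      D.symb ∈ ((T.biUnion TBoxAxiom.symbs ∪ {E.symb} : Finset (C ⊕ R)) : Set (C ⊕ R))}.Finite := by
    refine ((hfin.biUnion (t := fun s : C ⊕ R => match s with
      | .inl A => {Concept.atom A}
      | .inr P => {Concept.ex (.atom P), Concept.ex (.inv P)}) ?_)).subset ?_
    · rintro (A | P) _
      · exact Set.finite_singleton _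
      · exact Set.toFinite _
    · intro D hD
      refine Set.mem_biUnion hD ?_
      rcases D with A | (P | P) <;> simp [Concept.symb, Role.base]
  refine hpre.subset fun D hD => ?_
  by_contra hn
  simp only [Set.mem_ofPred_eq, Finset.coe_union, Finset.coe_biUnion, Finset.mem_coe,
    Finset.coe_singleton, Set.mem_union, Set.mem_iUnion, Set.mem_singleton_iff, not_or,
    not_exists] at hn
  have hsat : ∀ α ∈ T, (fullAt I D.symb).SatAxiom α := by
    intro α hα
    have h1 := hn.1 α hα
    cases α with
    | incl F G =>
      intro u hu
      rw [mem_fullAt_conceptExt] at hu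
      simp [TBoxAxiom.symbs, hu] at h1
    | disj F G =>
      ext u
      simp only [Set.mem_inter_iff, mem_fullAt_conceptExt, Set.mem_empty_iff_false, iff_false]
      rintro ⟨hu, -⟩
      simp [TBoxAxiom.symbs, hu] at h1
  have := hD _ hsat ((mem_fullAt_conceptExt (I := I) D.symb D none).2 rfl)
  exact hn.2 ((mem_fullAt_conceptExt _ _ _).1 this)

/-- The finite set of all concepts `D` with `T ⊨ D ⊑ E`. -/
def subsumees (I : Type) {C R : Type} (T : TBox C R) (E : Concept C R) :
    Finset (Concept C R) :=
  (finite_entails I T E).toFinset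

/-! ### Bag interpretations

Bags have values in `ℕ∞`. Every family in `ℕ∞` is summable, so `∑'` is the sum of the family. -/

/-- Bag interpretations (with the unique name assumption). -/
structure BagInterp (I C R : Type) where
  Dom : Type
  nonempty : Nonempty Dom
  ind : I → Dom
  ind_injective : Function.Injective ind
  concept : C → Dom → ℕ∞
  role : R → Dom → Dom → ℕ∞

/-! ### Terms, atoms, conjunctive queries -/

/-- Terms: variables and individuals. -/
inductive Term (I V : Type) : Type
  | var (v : V)
  | ind (a : I)

/-- The set of variables of a term. -/
def Term.vars {I V : Type} : Term I V → Finset V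
  | .var v => {v}
  | .ind _ => ∅

/-- The term is a variable from `s`. -/
def Term.VarIn {I V : Type} (t : Term I V) (s : Finset V) : Prop := ∃ v ∈ s, t = .var v

/-- Atoms `A(t)`, `P(t₁, t₂)` and equality atoms `v = t`. -/
inductive Atom (I V C R : Type) : Type
  | concept (A : C) (t : Term I V)
  | role (P : R) (t₁ t₂ : Term I V)
  | eq (v : V) (t : Term I V)

/-- The terms mentioned in an atom. -/
def Atom.terms {I V C R : Type} : Atom I V C R → Finset (Term I V)
  | .concept _ t => {t}
  | .role _ t₁ t₂ => {t₁, t₂}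
  | .eq v t => {.var v, t}

/-- The atom is an equality. -/
def Atom.IsEq {I V C R : Type} : Atom I V C R → Prop
  | .concept _ _ => False
  | .role _ _ _ => False
  | .eq _ _ => True

/-- The atom mentions a variable from `s`. -/
def Atom.Mentions {I V C R : Type} (α : Atom I V C R) (s : Finset V) : Prop :=
  ∃ t ∈ α.terms, t.VarIn s

/-- The equivalence relation on terms generated by the equality atoms of a conjunction. -/
def eqv {I V C R : Type} (φ : List (Atom I V C R)) : Setoid (Term I V) :=
  Relation.EqvGen.setoid fun s t => ∃ v, s = .var v ∧ Atom.eq v t ∈ φ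

/-- The Gaifman graph of a conjunction, on the equivalence classes of terms
(the classes without a term mentioned in `φ` are isolated nodes, which play no role). -/
def gaifman {I V C R : Type} (φ : List (Atom I V C R)) :
    SimpleGraph (Quotient (eqv φ)) :=
  SimpleGraph.fromRel fun m n => ∃ α ∈ φ, ∃ s ∈ α.terms, ∃ t ∈ α.terms,
    m = Quotient.mk _ s ∧ n = Quotient.mk _ t

/-- The set of equivalence classes of the variables in `s`. -/
def classes {I V C R : Type} (φ : List (Atom I V C R)) (s : Finset V) :
    Set (Quotient (eqv φ)) :=
  {n | ∃ v ∈ s, n = Quotient.mk _ (.var v)}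

/-- (Safe) conjunctive queries `∃ y. φ(x, y)`. The body is a non-empty list of atoms: repeated
atoms matter. The tuples `x` and `y` are repetition-free and are given by their sets of entries,
so that tuples of individuals of the same size as `x` are functions on `x`. -/
structure CQ (I V C R : Type) where
  x : Finset V
  y : Finset V
  disjoint : Disjoint x y
  body : List (Atom I V C R)
  body_ne : body ≠ []
  scope : ∀ α ∈ body, ∀ v, Term.var v ∈ α.terms → v ∈ x ∪ y
  safe : ∀ v ∈ x ∪ y, ∃ t, (eqv body).r (.var v) t ∧ ∃ α ∈ body, ¬ α.IsEq ∧ t ∈ α.terms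

/-- A CQ is rooted if each connected component of its Gaifman graph has a node that contains an
answer variable or an individual. -/
def CQ.Rooted {I V C R : Type} (q : CQ I V C R) : Prop :=
  ∀ α ∈ q.body, ∀ t ∈ α.terms, ∃ s : Term I V,
    (s.VarIn q.x ∨ ∃ a, s = .ind a) ∧
      (gaifman q.body).Reachable (Quotient.mk _ t) (Quotient.mk _ s)

/-! ### Evaluation of conjunctive queries over bag interpretations -/

/-- The assignment that is `μ` on `s` and `β` elsewhere. -/
def override {V D : Type} (s : Finset V) (μ : s → D) (β : V → D) : V → D :=
  fun v => if h : v ∈ s then μ ⟨v, h⟩ else β v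

/-- Extension of a map on `s` to all variables; the values outside `s` are irrelevant. -/
def BagInterp.extend {I V C R : Type} (J : BagInterp I C R) (s : Finset V) (μ : s → J.Dom) :
    V → J.Dom :=
  override s μ fun _ => Classical.choice J.nonempty

/-- The value of a term. -/
def BagInterp.val {I V C R : Type} (J : BagInterp I C R) (β : V → J.Dom) : Term I V → J.Dom
  | .var v => β v
  | .ind a => J.ind a

/-- The multiplicity of the image of an atom that is not an equality (equalities are conditions
on the valuations and contribute the factor `1`). -/
def BagInterp.mult {I V C R : Type} (J : BagInterp I C R) (β : V → J.Dom) :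
    Atom I V C R → ℕ∞
  | .concept A t => J.concept A (J.val β t)
  | .role P t₁ t₂ => J.role P (J.val β t₁) (J.val β t₂)
  | .eq _ _ => 1

/-- The sum, over all valuations of the variables in `s` that satisfy the equalities of `φ` and
the condition `cond`, of the product of the multiplicities of the atoms of `φ`. -/
def matchSum {I V C R : Type} (J : BagInterp I C R) (s : Finset V) (φ : List (Atom I V C R))
    (cond : (V → J.Dom) → Prop) : ℕ∞ :=
  ∑' μ : {μ : s → J.Dom // cond (J.extend s μ) ∧
      ∀ v t, Atom.eq v t ∈ φ → J.extend s μ v = J.val (J.extend s μ) t},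
    (φ.map (J.mult (J.extend s μ.1))).prod

/-- The bag answers of a CQ over a bag interpretation. -/
def CQ.answers {I V C R : Type} (q : CQ I V C R) (J : BagInterp I C R) (a : q.x → I) : ℕ∞ :=
  matchSum J (q.x ∪ q.y) q.body fun β => ∀ v : q.x, β v = J.ind (a v)

/-! ### The canonical bag model -/

/-- The possible elements of canonical models: individuals, and the anonymous elements
`w^j_{u,S}`. -/
inductive Elem (I R : Type) : Type
  | ind (a : I)
  | anon (j : ℕ) (u : Elem I R) (S : Role R)

/-- A bag interpretation on a set `dom` of elements. -/
structure Stage (I C R : Type) where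
  dom : Set (Elem I R)
  concept : C → Elem I R → ℕ∞
  role : R → Elem I R → Elem I R → ℕ∞

/-- The bag extension of a role. -/
def Stage.roleExt {I C R : Type} (J : Stage I C R) : Role R → Elem I R → Elem I R → ℕ∞
  | .atom P, u, v => J.role P u v
  | .inv P, u, v => J.role P v u

/-- The bag extension of a concept; `∃ S` is the bag projection of `S`. -/
def Stage.conceptExt {I C R : Type} (J : Stage I C R) : Concept C R → Elem I R → ℕ∞
  | .atom A, u => J.concept A u
  | .ex S, u => ∑' v : J.dom, J.roleExt S u v

/-- The concept closure of `u` over `T`: the maximal multiplicity of `u` in a concept subsumed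
by `E`. -/
def Stage.closure {I C R : Type} (J : Stage I C R) (T : TBox C R) (u : Elem I R)
    (E : Concept C R) : ℕ∞ :=
  ⨆ D : {D : Concept C R // Entails I T D E}, J.conceptExt D.1 u

/-- The initial stage, given by the ABox. -/
def Stage.zero {I C R : Type} (A : ABox I C R) : Stage I C R where
  dom := Set.range Elem.ind
  concept B u := match u with
    | .ind a => (A (.concept B a) : ℕ∞)
    | .anon _ _ _ => 0
  role P u v := match u, v with
    | .ind a, .ind b => (A (.role P a b) : ℕ∞)
    | _, _ => 0

/-- The domain of the next stage: for `δ = closure(u)(∃ S) - (∃ S)(u)`, the elements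
`w^1_{u,S}, …, w^δ_{u,S}` are added. -/
def Stage.nextDom {I C R : Type} (T : TBox C R) (J : Stage I C R) : Set (Elem I R) :=
  J.dom ∪ {w | ∃ u ∈ J.dom, ∃ (S : Role R) (j : ℕ), 1 ≤ j ∧
    (j : ℕ∞) ≤ J.closure T u (.ex S) - J.conceptExt (.ex S) u ∧ w = .anon j u S}

/-- One step of the construction of the canonical model. -/
def Stage.next {I C R : Type} (T : TBox C R) (J : Stage I C R) : Stage I C R where
  dom := J.nextDom T
  concept B u := if u ∈ J.dom then J.closure T u (.atom B) else 0
  role P u v :=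
    if u ∈ J.dom ∧ v ∈ J.dom then J.role P u v
    else if u ∈ J.nextDom T ∧ v ∈ J.nextDom T ∧
        ((∃ j, v = .anon j u (.atom P)) ∨ ∃ j, u = .anon j v (.inv P)) then 1
    else 0

/-- The stages of the canonical model of `⟨T, A⟩`. -/
def stage {I C R : Type} (T : TBox C R) (A : ABox I C R) : ℕ → Stage I C R
  | 0 => Stage.zero A
  | n + 1 => (stage T A n).next T

/-- The canonical bag model of `⟨T, A⟩`: the (max) union of all stages. -/
def canonical {I C R : Type} [Nonempty I] (T : TBox C R) (A : ABox I C R) :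
    BagInterp I C R where
  Dom := {u : Elem I R // ∃ n, u ∈ (stage T A n).dom}
  nonempty := ⟨⟨.ind (Classical.arbitrary I), 0, Set.mem_range_self _⟩⟩
  ind a := ⟨.ind a, 0, Set.mem_range_self a⟩
  ind_injective a b h := by simpa using h
  concept B u := ⨆ n, (stage T A n).concept B u.1
  role P u v := ⨆ n, (stage T A n).role P u.1 v.1

/-! ### `BALG¹_ε`-queries -/

/-- Query formulas. The side conditions on variables of `BALG¹_ε`-queries are imposed in
`Query.IsBALG`; the constants `top` and `bot` (empty conjunction, empty union) do not occur in
`BALG¹_ε`-queries. -/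
inductive Query (I V C R : Type) : Type
  | top
  | bot
  | concept (A : C) (t : Term I V)
  | role (P : R) (t₁ t₂ : Term I V)
  | and (f g : Query I V C R)
  | andEq (f : Query I V C R) (v : V) (t : Term I V)
  | ex (ys : Finset V) (f : Query I V C R)
  | max (f g : Query I V C R)
  | add (f g : Query I V C R)
  | diff (f g : Query I V C R)

/-- `f.IsBALG s`: `f` is a `BALG¹_ε`-query whose set of answer variables is `s`. -/
inductive Query.IsBALG {I V C R : Type} : Query I V C R → Finset V → Prop
  | concept (A : C) (t : Term I V) : IsBALG (.concept A t) t.vars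
  | role (P : R) (t₁ t₂ : Term I V) : IsBALG (.role P t₁ t₂) (t₁.vars ∪ t₂.vars)
  | and {f g : Query I V C R} {s₁ s₂ : Finset V} :
      IsBALG f s₁ → IsBALG g s₂ → IsBALG (.and f g) (s₁ ∪ s₂)
  | andEq {f : Query I V C R} {s : Finset V} {v : V} (t : Term I V) :
      IsBALG f s → v ∈ s → IsBALG (.andEq f v t) (s ∪ t.vars)
  | ex {f : Query I V C R} {s ys : Finset V} :
      IsBALG f (s ∪ ys) → Disjoint s ys → IsBALG (.ex ys f) s
  | max {f g : Query I V C R} {s : Finset V} : IsBALG f s → IsBALG g s → IsBALG (.max f g) s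
  | add {f g : Query I V C R} {s : Finset V} : IsBALG f s → IsBALG g s → IsBALG (.add f g) s
  | diff {f g : Query I V C R} {s : Finset V} :
      IsBALG f s → IsBALG g s → IsBALG (.diff f g) s

/-- The multiplicity of a query formula over a bag interpretation under an assignment. -/
def Query.eval {I V C R : Type} (J : BagInterp I C R) : Query I V C R → (V → J.Dom) → ℕ∞
  | .top, _ => 1
  | .bot, _ => 0
  | .concept A t, β => J.concept A (J.val β t)
  | .role P t₁ t₂, β => J.role P (J.val β t₁) (J.val β t₂)
  | .and f g, β => f.eval J β * g.eval J β
  | .andEq f v t, β => if β v = J.val β t then f.eval J β else 0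
  | .ex ys f, β => ∑' μ : ys → J.Dom, f.eval J (override ys μ β)
  | .max f g, β => Max.max (f.eval J β) (g.eval J β)
  | .add f g, β => f.eval J β + g.eval J β
  | .diff f g, β => f.eval J β - g.eval J β

/-- The bag answers of a query formula with set of answer variables `x`. -/
def Query.answers {I V C R : Type} (f : Query I V C R) (x : Finset V) (J : BagInterp I C R)
    (a : x → I) : ℕ∞ :=
  f.eval J (J.extend x fun v => J.ind (a v))

/-- Conjunction of a list. -/
def Query.andList {I V C R : Type} : List (Query I V C R) → Query I V C R
  | [] => .top
  | [f] => f
  | f :: g :: l => .and f (Query.andList (g :: l))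

/-- Max union of a list. -/
def Query.maxList {I V C R : Type} : List (Query I V C R) → Query I V C R
  | [] => .bot
  | [f] => f
  | f :: g :: l => .max f (Query.maxList (g :: l))

/-- Arithmetic union of a list. -/
def Query.addList {I V C R : Type} : List (Query I V C R) → Query I V C R
  | [] => .bot
  | [f] => f
  | f :: g :: l => .add f (Query.addList (g :: l))

/-! ### Step 1: realisable sets of variables -/

/-- `z` is equality-consistent: no equality of `q` (in either orientation) relates a variable
in `z` to a term not in `z`. -/
def CQ.EqConsistent {I V C R : Type} (q : CQ I V C R) (z : Finset V) : Prop :=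
  ∀ v t, Atom.eq v t ∈ q.body → (v ∈ z ↔ t.VarIn z)

/-- `z'` is a non-empty subset of `z` that is maximally connected in the anonymous part. -/
def CQ.MaConnected {I V C R : Type} (q : CQ I V C R) (z z' : Finset V) : Prop :=
  z'.Nonempty ∧ z' ⊆ z ∧
  (∀ v ∈ z', ∀ t : Term I V, (eqv q.body).r (.var v) t → t.VarIn z') ∧
  Maximal (fun N : Set (Quotient (eqv q.body)) =>
    N ⊆ classes q.body z ∧ ((gaifman q.body).induce N).Connected) (classes q.body z')

/-- `φ_{z'}`: all atoms that mention a variable of `z'`. -/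
def CQ.sub {I V C R : Type} (q : CQ I V C R) (z' : Finset V) : List (Atom I V C R) :=
  q.body.filter fun α => α.Mentions z'

/-- `α` is an atom of `φ_{z'}` of the form `P(t, v)` or `P(v, t)` with `v ∈ z'` and `t ∉ z`. -/
def CQ.IsLink {I V C R : Type} (q : CQ I V C R) (z z' : Finset V) (t : Term I V)
    (α : Atom I V C R) : Prop :=
  α ∈ q.sub z' ∧ ¬ t.VarIn z ∧
    ∃ P, ∃ v ∈ z', α = .role P t (.var v) ∨ α = .role P (.var v) t

/-- `t_{z'}`: all terms `t ∉ z` that occur in such an atom. -/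
def CQ.linkTerms {I V C R : Type} (q : CQ I V C R) (z z' : Finset V) : Finset (Term I V) :=
  ((q.sub z').toFinset.biUnion Atom.terms).filter fun t => ∃ α, q.IsLink z z' t α

/-- `x' = t_{z'} ∩ V`. -/
def CQ.linkVars {I V C R : Type} (q : CQ I V C R) (z z' : Finset V) : Finset V :=
  (q.linkTerms z z').biUnion Term.vars

/-- The individual does not occur in the query. -/
def CQ.FreshInd {I V C R : Type} (q : CQ I V C R) (c : I) : Prop :=
  ∀ α ∈ q.body, Term.ind c ∉ α.terms

/-- The choices on which the construction of the rewriting depends: the linking atoms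
`α_{z'}`, the individuals `a` and `b` used to test realisability (`a` is in `t_{z'}` if possible,
and is fresh otherwise; `b` is fresh), and the bound variable used for `∃ S` at a term. -/
structure CQ.Choice {I V C R : Type} (q : CQ I V C R) where
  link : Finset V → Finset V → Atom I V C R
  link_spec : ∀ z z', (∃ t α, q.IsLink z z' t α) → ∃ t, q.IsLink z z' t (link z z')
  a : Finset V → Finset V → I
  a_mem : ∀ z z', (∃ c : I, Term.ind c ∈ q.linkTerms z z') →
    Term.ind (a z z') ∈ q.linkTerms z z'
  a_fresh : ∀ z z', (¬ ∃ c : I, Term.ind c ∈ q.linkTerms z z') → q.FreshInd (a z z')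
  b : Finset V → Finset V → I
  b_fresh : ∀ z z', q.FreshInd (b z z')
  b_ne : ∀ z z', b z z' ≠ a z z'
  bound : Term I V → V
  bound_ne : ∀ v, bound (.var v) ≠ v

/-- The ABox `A'` for testing realisability of `z'`: it consists of `P(a, b)`
if `α_{z'} = P(t, v)` with `v ∈ z'`, and of `P(b, a)` if `α_{z'} = P(v, t)`. -/
def CQ.testABox {I V C R : Type} (q : CQ I V C R) (ch : q.Choice) (z z' : Finset V) :
    ABox I C R :=
  match ch.link z z' with
  | .role P _ t₂ =>
      if t₂.VarIn z' then Finsupp.single (.role P (ch.a z z') (ch.b z z')) 1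
      else Finsupp.single (.role P (ch.b z z') (ch.a z z')) 1
  | _ => 0

/-- The ma-connected `z' ⊆ z` is realisable by `T`: the Boolean query
`∃ x' z'. φ_{z'} ∧ ⋀_{t ∈ t_{z'}} (t = a) ∧ ⋀_{v ∈ z'} (v ≠ a)` has a match in the canonical
model of `⟨T, A'⟩`. -/
def CQ.RealisableMa {I V C R : Type} [Nonempty I] (q : CQ I V C R) (T : TBox C R)
    (ch : q.Choice) (z z' : Finset V) : Prop :=
  1 ≤ matchSum (canonical T (q.testABox ch z z')) (q.linkVars z z' ∪ z') (q.sub z') fun β =>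
    (∀ t ∈ q.linkTerms z z', (canonical T (q.testABox ch z z')).val β t =
      (canonical T (q.testABox ch z z')).ind (ch.a z z')) ∧
    ∀ v ∈ z', β v ≠ (canonical T (q.testABox ch z z')).ind (ch.a z z')

/-- The set `z` of variables is realisable by `T`. -/
def CQ.Realisable {I V C R : Type} [Nonempty I] (q : CQ I V C R) (T : TBox C R)
    (ch : q.Choice) (z : Finset V) : Prop :=
  q.EqConsistent z ∧ ∀ z', q.MaConnected z z' → q.RealisableMa T ch z z'

/-! ### Step 2: the queries `q_z` -/

/-- The non-empty ma-connected subsets of `z`. -/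
def CQ.maSets {I V C R : Type} (q : CQ I V C R) (z : Finset V) : Finset (Finset V) :=
  z.powerset.filter fun z' => q.MaConnected z z'

/-- The equalities `v = t`, for `v ∈ t_{z'} ∩ V` and `t ∈ t_{z'}`. -/
def CQ.linkEqs {I V C R : Type} (q : CQ I V C R) (z z' : Finset V) : List (Atom I V C R) :=
  (q.linkVars z z').toList.flatMap fun v => (q.linkTerms z z').toList.map (Atom.eq v)

/-- The body `φ_z` of `q_z`: for each ma-connected `z' ⊆ z`, the conjunction `φ_{z'}` is replaced
by `α_{z'} ∧ ⋀ (v = t)`. -/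
def CQ.bodyZ {I V C R : Type} (q : CQ I V C R) (ch : q.Choice) (z : Finset V) :
    List (Atom I V C R) :=
  (q.body.filter fun α => ∀ z' ∈ q.maSets z, ¬ α.Mentions z') ++
    (q.maSets z).toList.flatMap fun z' => ch.link z z' :: q.linkEqs z z'

/-- `y_z`: the variables of `y` that remain in `φ_z` and are not in `z`. -/
def CQ.yZ {I V C R : Type} (q : CQ I V C R) (ch : q.Choice) (z : Finset V) : Finset V :=
  (q.y \ z).filter fun v => ∃ α ∈ q.bodyZ ch z, Term.var v ∈ α.terms

/-! ### Step 3: the rewriting -/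

/-- `ζ_D(t)`: `A(t)`, `∃ w. P(t, w)` or `∃ w. P(w, t)`. -/
def CQ.zeta {I V C R : Type} {q : CQ I V C R} (ch : q.Choice) (D : Concept C R)
    (t : Term I V) : Query I V C R :=
  match D with
  | .atom A => .concept A t
  | .ex (.atom P) => .ex {ch.bound t} (.role P t (.var (ch.bound t)))
  | .ex (.inv P) => .ex {ch.bound t} (.role P (.var (ch.bound t)) t)

/-- The max union of all `ζ_D(t)` with `T ⊨ D ⊑ E`. -/
def CQ.eta {I V C R : Type} {q : CQ I V C R} (T : TBox C R) (ch : q.Choice)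
    (E : Concept C R) (t : Term I V) : Query I V C R :=
  Query.maxList ((subsumees I T E).toList.map fun D => CQ.zeta ch D t)

/-- The replacement of an atom that is not an equality: `A(t)` is replaced by the max union of
all `ζ_D(t)` with `T ⊨ D ⊑ A`; `P(t, v)` and `P(v, t)`, where `v ∈ z`, are replaced by the
difference of the max union for `∃ P` (or `∃ P⁻`) and `ζ_{∃ P}(t)` (or `ζ_{∃ P⁻}(t)`); other
role atoms stay. Equalities are treated separately. -/
def CQ.replace {I V C R : Type} {q : CQ I V C R} (T : TBox C R) (ch : q.Choice)
    (z : Finset V) : Atom I V C R → Option (Query I V C R)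
  | .concept A t => some (CQ.eta T ch (.atom A) t)
  | .role P t₁ t₂ =>
      if t₂.VarIn z then
        some (.diff (CQ.eta T ch (.ex (.atom P)) t₁) (CQ.zeta ch (.ex (.atom P)) t₁))
      else if t₁.VarIn z then
        some (.diff (CQ.eta T ch (.ex (.inv P)) t₂) (CQ.zeta ch (.ex (.inv P)) t₂))
      else some (.role P t₁ t₂)
  | .eq _ _ => none

/-- Conjunction of a formula with the equalities in a list of atoms. -/
def Query.addEqs {I V C R : Type} (f : Query I V C R) : List (Atom I V C R) → Query I V C R
  | [] => f
  | .eq v t :: l => .andEq (f.addEqs l) v t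
  | .concept _ _ :: l => f.addEqs l
  | .role _ _ _ :: l => f.addEqs l

/-- `ψ_z`: the conjunction of the replaced atoms of `φ_z` and of the equalities of `φ_z`. -/
def CQ.psi {I V C R : Type} (q : CQ I V C R) (T : TBox C R) (ch : q.Choice) (z : Finset V) :
    Query I V C R :=
  (Query.andList ((q.bodyZ ch z).filterMap (CQ.replace T ch z))).addEqs (q.bodyZ ch z)

/-- The rewriting of `q` over `T`: the arithmetic union, over all realisable `z ⊆ y`, of
`∃ y_z. ψ_z`. -/
def CQ.rewriting {I V C R : Type} [Nonempty I] (q : CQ I V C R) (T : TBox C R)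
    (ch : q.Choice) : Query I V C R :=
  Query.addList ((q.y.powerset.filter fun z => q.Realisable T ch z).toList.map fun z =>
    .ex (q.yZ ch z) (q.psi T ch z))

end BagDL

end

noncomputable section

open scoped Classical

namespace BagDL

/-! ### Sums in `ℕ∞` -/

/-! The canonical model consists of the individuals with their ABox multiplicities and, below each
individual, trees of anonymous elements. It has a closed form: the multiplicity of `u` in a concept
is `cl`, the largest multiplicity `base` that `u` had at its creation in a subsumed concept; `u` has
`delta = cl - base` children for each role; and every role edge that touches an anonymous element
joins a parent and a child, with multiplicity 1 (`canonical_concept`, `canonical_role`,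
`exists_mem_stage_iff`). Over the empty TBox there are no trees, and the difference formulas of the
rewriting evaluate exactly to `delta` (`replMult_canonical_ofRole`).

For the equality of the answers, the valuations of `q` are sorted by the set `z` of existential
variables that they send to anonymous elements, and then by the values of the other variables, which
are individuals. Anonymous elements have multiplicities at most 1, so one such class contributes the
product of the atoms that avoid `z`, times the number of ways to place `z`. This number factorises
over the ma-connected subsets `z'` of `z`. Since `q` is rooted, `z'` is linked by a role atom to a
term outside `z` (`CQ.exists_isLink`). Edges between anonymous elements never leave a tree, so `z'`
lands below a single child of an individual `c`, all link terms denote `c`, and the child belongs to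
the role `S` of the chosen link (`CQ.LinkAt.branch`). An anonymous element has at most one neighbour
in each role (`eq_of_fullRole`), so this child determines the whole placement
(`CQ.LinkAt.match_unique`). Whether a placement exists depends neither on the ABox nor on the child:
the tree below an `S`-child of `c`, seen together with `c`, is a copy of the part generated from
`b`, seen together with `a`, in the model of the single assertion `S(a, b)`, and this is what
realisability tests. The copy is made by `graft`. Hence a realisable `z'` contributes the factor
`delta` of `c` and `S` (`CQ.card_solution`), and the sum over all realisable `z` is the rewriting.

The rewriting is not literally a `BALG¹_ε`-query, because a selection must start from a variable
that is already an answer variable. `exists_balg_body` repairs this: individuals are replaced by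
fresh variables, every missing variable is introduced by an equality that holds anyway, and the
fresh variables are projected out. Safety of `q` ensures that every variable is equated with a term
that survives in the rewritten body. -/

theorem enat_hasSum {ι : Type*} (f : ι → ℕ∞) : HasSum f (⨆ s : Finset ι, ∑ i ∈ s, f i) :=
  tendsto_atTop_iSup fun _ _ => Finset.sum_le_sum_of_subset

theorem enat_summable {ι : Type*} (f : ι → ℕ∞) : Summable f := ⟨_, enat_hasSum f⟩

theorem enat_tsum_mul_left {ι : Type*} (a : ℕ∞) (f : ι → ℕ∞) :
    ∑' i, a * f i = a * ∑' i, f i :=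
  (enat_summable f).tsum_mul_left a

theorem enat_tsum_fiberwise {ι κ : Type*} (f : ι → ℕ∞) (g : ι → κ) :
    ∑' i, f i = ∑' k, ∑' i : {i // g i = k}, f i := by
  rw [← (Equiv.sigmaFiberEquiv g).tsum_eq f,
    (enat_summable _).tsum_sigma' fun _ => enat_summable _]
  rfl

theorem enat_tsum_ite {ι : Type*} (p : ι → Prop) [DecidablePred p] (f : ι → ℕ∞) :
    ∑' i, (if p i then f i else 0) = ∑' i : {i // p i}, f i := by
  rw [show (∑' i : {i // p i}, f i) = ∑' i : ({i | p i} : Set ι), f i from rfl, tsum_subtype]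
  refine tsum_congr fun i => ?_
  by_cases h : p i <;> simp [h]

theorem enat_tsum_one (ι : Type*) : ∑' _ : ι, (1 : ℕ∞) = ENat.card ι := by
  rcases finite_or_infinite ι with h | h
  · have := Fintype.ofFinite ι
    rw [tsum_fintype]
    simp
  · rw [ENat.card_eq_top_of_infinite, ENat.eq_top_iff_forall_ge]
    intro n
    obtain ⟨s, hs⟩ := Infinite.exists_subset_card_eq ι n
    refine le_trans ?_ ((enat_summable (fun _ : ι => (1 : ℕ∞))).sum_le_tsum s fun _ _ => zero_le)
    simp [hs]

/-- Turns the number of anonymous successors into a cardinality of indices, also when it is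
infinite. -/
theorem enat_card_Icc (δ : ℕ∞) : ENat.card {j : ℕ // 1 ≤ j ∧ (j : ℕ∞) ≤ δ} = δ := by
  induction δ with
  | top =>
    have : Infinite {j : ℕ // 1 ≤ j ∧ (j : ℕ∞) ≤ ⊤} :=
      Infinite.of_injective (fun n : ℕ => ⟨n + 1, by simp⟩) fun m n h => by simpa using h
    simp
  | coe n =>
    have e : {j : ℕ // 1 ≤ j ∧ (j : ℕ∞) ≤ n} ≃ Finset.Icc 1 n :=
      Equiv.subtypeEquivRight fun j => by simp
    rw [ENat.card_congr e, ENat.card_eq_coe_fintype_card, Fintype.card_coe, Nat.card_Icc]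
    simp

theorem enat_tsum_add_compl {ι : Type*} (p : ι → Prop) (f : ι → ℕ∞) :
    ∑' i, f i = ∑' i : {i // p i}, f i + ∑' i : {i // ¬ p i}, f i := by
  rw [← enat_tsum_ite p f, ← enat_tsum_ite (fun i => ¬ p i) f,
    ← (enat_summable _).tsum_add (enat_summable _)]
  refine tsum_congr fun i => ?_
  by_cases h : p i <;> simp [h]

/-! ### Entailment -/

variable {I V C R : Type}

theorem Entails.refl (T : TBox C R) (D : Concept C R) : Entails I T D D := fun _ _ => le_rfl

theorem Entails.trans {T : TBox C R} {D E F : Concept C R} (h : Entails I T D E)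
    (h' : Entails I T E F) : Entails I T D F := fun J hJ => (h J hJ).trans (h' J hJ)

theorem Role.inverse_inverse (S : Role R) : S.inverse.inverse = S := by cases S <;> rfl

theorem Role.inverse_eq_iff {S S' : Role R} : S.inverse = S' ↔ S = S'.inverse := by
  constructor
  · rintro rfl
    exact S.inverse_inverse.symm
  · rintro rfl
    exact S'.inverse_inverse

/-- An interpretation in which a single tuple, with the two different components `true` and
`false`, realises a concept at `true`. -/
def pointInterp (I : Type) (D : Concept C R) : Interp I C R where
  Dom := I ⊕ Bool
  nonempty := ⟨.inr true⟩
  ind := .inl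
  ind_injective := Sum.inl_injective
  concept B := {u | D = .atom B ∧ u = .inr true}
  role P := {p | (D = .ex (.atom P) ∧ p = (.inr true, .inr false)) ∨
    (D = .ex (.inv P) ∧ p = (.inr false, .inr true))}

theorem mem_pointInterp (D E : Concept C R) :
    (.inr true : I ⊕ Bool) ∈ (pointInterp I D).conceptExt E ↔ D = E := by
  rcases E with B | (P | P)
  · exact ⟨fun h => h.1, fun h => ⟨h, rfl⟩⟩
  · refine ⟨?_, fun h => ⟨.inr false, .inl ⟨h, rfl⟩⟩⟩
    rintro ⟨v, h | h⟩
    · exact h.1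
    · exact absurd (Sum.inr_injective (congrArg Prod.fst h.2)) (by simp)
  · refine ⟨?_, fun h => ⟨.inr false, .inr ⟨h, rfl⟩⟩⟩
    rintro ⟨v, h | h⟩
    · exact absurd (Sum.inr_injective (congrArg Prod.snd h.2)) (by simp)
    · exact h.1

/-- The concept `D` is the only one realised at the distinguished point of `pointInterp`. As a
consequence `cl` over the empty TBox is `base`, and the canonical model of `⟨∅, A⟩` is the ABox
itself. -/
theorem entails_empty {D E : Concept C R} : Entails I (∅ : TBox C R) D E ↔ D = E := by
  refine ⟨fun h => ?_, fun h => h ▸ Entails.refl _ _⟩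
  exact (mem_pointInterp (I := I) D E).1
    (h (pointInterp I D) (by simp) ((mem_pointInterp D D).2 rfl))

/-! ### Explicit description of the canonical model -/

/-- The multiplicity in an ABox of a pair of individuals in a role. -/
def ABox.roleMult (A : ABox I C R) : Role R → I → I → ℕ∞
  | .atom P, a, b => (A (.role P a b) : ℕ∞)
  | .inv P, a, b => (A (.role P b a) : ℕ∞)

/-- The multiplicity of an element in a concept when the element is created. -/
def base (A : ABox I C R) : Elem I R → Concept C R → ℕ∞
  | .ind a, .atom B => (A (.concept B a) : ℕ∞)
  | .ind a, .ex S => ∑' b, A.roleMult S a b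
  -- A new `S`-successor has a single edge, the one back to its parent, and belongs to no atomic
  -- concept.
  | .anon _ _ S, D => if D = .ex S.inverse then 1 else 0

/-- The multiplicity of an element in a concept of the canonical model. -/
def cl (T : TBox C R) (A : ABox I C R) (u : Elem I R) (E : Concept C R) : ℕ∞ :=
  ⨆ D : {D : Concept C R // Entails I T D E}, base A u D.1

/-- The number of anonymous successors of an element. -/
def delta (T : TBox C R) (A : ABox I C R) (u : Elem I R) (S : Role R) : ℕ∞ :=
  cl T A u (.ex S) - base A u (.ex S)

/-- The elements of the canonical model. -/
def Good (T : TBox C R) (A : ABox I C R) : Elem I R → Prop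
  | .ind _ => True
  | .anon j u S => Good T A u ∧ 1 ≤ j ∧ (j : ℕ∞) ≤ delta T A u S

/-- The multiplicity of a pair of elements in a role of the canonical model. -/
def fullRole (A : ABox I C R) (S : Role R) : Elem I R → Elem I R → ℕ∞
  | .ind a, .ind b => A.roleMult S a b
  | u, v => if (∃ j, v = .anon j u S) ∨ ∃ j, u = .anon j v S.inverse then 1 else 0

/-- The number of steps in which an element is generated. -/
def Elem.depth : Elem I R → ℕ
  | .ind _ => 0
  | .anon _ u _ => u.depth + 1

theorem base_le_cl {T : TBox C R} {A : ABox I C R} {u : Elem I R} {D E : Concept C R}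
    (h : Entails I T D E) : base A u D ≤ cl T A u E :=
  le_iSup (fun D : {D : Concept C R // Entails I T D E} => base A u D.1) ⟨D, h⟩

theorem cl_le {T : TBox C R} {A : ABox I C R} {u : Elem I R} {E : Concept C R} {n : ℕ∞}
    (h : ∀ D, Entails I T D E → base A u D ≤ n) : cl T A u E ≤ n :=
  iSup_le fun D => h D.1 D.2

/-- Closing twice adds nothing, by transitivity of entailment. Once an element has been closed at
one stage, later stages leave it unchanged. -/
theorem iSup_cl (T : TBox C R) (A : ABox I C R) (u : Elem I R) (E : Concept C R) :
    ⨆ D : {D : Concept C R // Entails I T D E}, cl T A u D.1 = cl T A u E :=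
  le_antisymm (iSup_le fun D => cl_le fun _ h => base_le_cl (h.trans D.2))
    (le_iSup (fun D : {D : Concept C R // Entails I T D E} => cl T A u D.1) ⟨E, .refl _ _⟩)

theorem cl_empty (A : ABox I C R) (u : Elem I R) (E : Concept C R) :
    cl ∅ A u E = base A u E :=
  le_antisymm (cl_le fun D h => by rw [entails_empty.1 h]) (base_le_cl (.refl _ _))

theorem base_add_delta (T : TBox C R) (A : ABox I C R) (u : Elem I R) (S : Role R) :
    base A u (.ex S) + delta T A u S = cl T A u (.ex S) :=
  add_tsub_cancel_of_le (base_le_cl (.refl _ _))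

theorem base_anon_le (A : ABox I C R) (j : ℕ) (u : Elem I R) (S : Role R) (D : Concept C R) :
    base A (.anon j u S) D ≤ 1 := by
  change (if D = .ex S.inverse then (1 : ℕ∞) else 0) ≤ 1
  split_ifs <;> simp

theorem cl_anon_le (T : TBox C R) (A : ABox I C R) (j : ℕ) (u : Elem I R) (S : Role R)
    (D : Concept C R) : cl T A (.anon j u S) D ≤ 1 :=
  cl_le fun _ _ => base_anon_le ..

theorem delta_anon_le (T : TBox C R) (A : ABox I C R) (j : ℕ) (u : Elem I R) (S S' : Role R) :
    delta T A (.anon j u S) S' ≤ 1 :=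
  tsub_le_self.trans (cl_anon_le ..)

/-- The edge to the parent already gives `∃ S⁻` the multiplicity 1, which is the maximum at an
anonymous element. So no second `S⁻`-neighbour is ever created. -/
theorem delta_anon_inverse (T : TBox C R) (A : ABox I C R) (j : ℕ) (u : Elem I R) (S : Role R) :
    delta T A (.anon j u S) S.inverse = 0 :=
  tsub_eq_zero_of_le ((cl_anon_le ..).trans (by simp [base]))

theorem fullRole_ind (A : ABox I C R) (S : Role R) (a b : I) :
    fullRole A S (.ind a) (.ind b) = A.roleMult S a b := rfl

theorem fullRole_of_not_ind {A : ABox I C R} {S : Role R} {u v : Elem I R}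
    (h : 0 < u.depth ∨ 0 < v.depth) :
    fullRole A S u v =
      if (∃ j, v = .anon j u S) ∨ ∃ j, u = .anon j v S.inverse then 1 else 0 := by
  cases u <;> cases v <;> first | rfl | simp [Elem.depth] at h

theorem fullRole_child (A : ABox I C R) (S : Role R) (u : Elem I R) (j : ℕ) :
    fullRole A S u (.anon j u S) = 1 := by
  rw [fullRole_of_not_ind (by simp [Elem.depth]), if_pos (.inl ⟨j, rfl⟩)]

theorem fullRole_swap (A : ABox I C R) (S : Role R) (u v : Elem I R) :
    fullRole A S.inverse u v = fullRole A S v u := by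
  rcases Nat.eq_zero_or_pos u.depth with hu | hu
  · rcases Nat.eq_zero_or_pos v.depth with hv | hv
    · cases u <;> cases v <;> simp [Elem.depth] at hu hv
      cases S <;> rfl
    · rw [fullRole_of_not_ind (.inr hv), fullRole_of_not_ind (.inl hv), S.inverse_inverse]
      simp only [or_comm]
  · rw [fullRole_of_not_ind (.inl hu), fullRole_of_not_ind (.inr hu), S.inverse_inverse]
    simp only [or_comm]

theorem fullRole_le_one {A : ABox I C R} {S : Role R} {u v : Elem I R}
    (h : 0 < u.depth ∨ 0 < v.depth) : fullRole A S u v ≤ 1 := by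
  rw [fullRole_of_not_ind h]
  split_ifs <;> simp


/-! ### Counting the neighbours of an element -/

theorem tsum_children (u : Elem I R) (S : Role R) (δ : ℕ∞) (p : Elem I R → Prop)
    (f : Elem I R → ℕ∞) (hf : ∀ j, f (.anon j u S) = 1)
    (h : ∀ v, p v ↔ ∃ j : ℕ, (1 ≤ j ∧ (j : ℕ∞) ≤ δ) ∧ v = .anon j u S) :
    ∑' v : {v // p v}, f v = δ := by
  rw [← enat_card_Icc δ, ← enat_tsum_one]
  let e : {j : ℕ // 1 ≤ j ∧ (j : ℕ∞) ≤ δ} → {v // p v} :=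
    fun j => ⟨.anon j.1 u S, (h _).2 ⟨j.1, j.2, rfl⟩⟩
  have he : Function.Bijective e := by
    constructor
    · intro j k hjk
      simpa [e, Subtype.ext_iff] using hjk
    · rintro ⟨v, hv⟩
      obtain ⟨j, hj, rfl⟩ := (h v).1 hv
      exact ⟨⟨j, hj⟩, rfl⟩
  rw [← (Equiv.ofBijective e he).tsum_eq fun v => f v]
  exact tsum_congr fun j => hf j

theorem tsum_range_ind (f : Elem I R → ℕ∞) :
    ∑' v : {v : Elem I R // ∃ a, v = .ind a}, f v = ∑' a, f (.ind a) := by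
  let e : I → {v : Elem I R // ∃ a, v = .ind a} := fun a => ⟨.ind a, a, rfl⟩
  have he : Function.Bijective e := by
    constructor
    · intro j k hjk
      simpa [e, Subtype.ext_iff] using hjk
    · rintro ⟨v, a, rfl⟩
      exact ⟨a, rfl⟩
  rw [← (Equiv.ofBijective e he).tsum_eq fun v => f v]
  rfl

/-- The neighbours of an element that exist when the element is created. -/
def Elem.IsOld : Elem I R → Elem I R → Prop
  | .ind _, v => ∃ a, v = .ind a
  | .anon _ p _, v => v = p

/-- For an individual the old neighbours are the individuals; for an anonymous element there is only
the parent, joined by a single edge in a single role. -/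
theorem tsum_isOld (A : ABox I C R) (S : Role R) (u : Elem I R) :
    ∑' v : {v // u.IsOld v}, fullRole A S u v = base A u (.ex S) := by
  cases u with
  | ind a => exact tsum_range_ind _
  | anon j p S' =>
    have : Unique {v // (Elem.anon j p S').IsOld v} := ⟨⟨⟨p, rfl⟩⟩, fun v => Subtype.ext v.2⟩
    rw [tsum_eq_single ⟨p, rfl⟩ fun v hv => absurd (Subsingleton.elim _ _) hv,
      fullRole_of_not_ind (.inl (by simp [Elem.depth]))]
    -- No element is a child of its own child, by comparison of depths.
    have h1 : ∀ k, p ≠ .anon k (.anon j p S') S := fun k h => by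
      have := congrArg Elem.depth h
      simp [Elem.depth] at this
      omega
    simp only [h1, exists_false, false_or, base, Elem.anon.injEq, true_and, Concept.ex.injEq]
    refine if_congr ?_ rfl rfl
    rw [eq_comm, Role.inverse_eq_iff]
    simp

theorem fullRole_eq_zero {A : ABox I C R} {S : Role R} {u v : Elem I R} (h : ¬ u.IsOld v)
    (h' : ∀ j, v ≠ .anon j u S) : fullRole A S u v = 0 := by
  have hp : 0 < u.depth ∨ 0 < v.depth := by
    cases u with
    | anon => left; simp [Elem.depth]
    | ind a =>
      cases v with
      | ind b => exact absurd ⟨b, rfl⟩ h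
      | anon => right; simp [Elem.depth]
  rw [fullRole_of_not_ind hp, if_neg]
  rintro (⟨j, hj⟩ | ⟨j, rfl⟩)
  · exact h' j hj
  · exact h rfl

theorem not_isOld_anon (u : Elem I R) (j : ℕ) (S : Role R) : ¬ u.IsOld (.anon j u S) := by
  cases u with
  | ind a => rintro ⟨b, h⟩; cases h
  | anon k p S' =>
    intro h
    have := congrArg Elem.depth (show Elem.anon j (.anon k p S') S = p from h)
    simp [Elem.depth] at this
    omega

theorem Elem.IsOld.depth_le {u v : Elem I R} (h : u.IsOld v) : v.depth ≤ u.depth := by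
  cases u with
  | ind a => obtain ⟨b, rfl⟩ := h; exact le_rfl
  | anon k p S' => obtain rfl : v = p := h; simp [Elem.depth]

theorem Elem.IsOld.good {T : TBox C R} {A : ABox I C R} {u v : Elem I R} (h : u.IsOld v)
    (hu : Good T A u) : Good T A v := by
  cases u with
  | ind a => obtain ⟨b, rfl⟩ := h; trivial
  | anon k p S' => obtain rfl : v = p := h; exact hu.1

/-- A neighbour of `u` either existed when `u` was created, contributing `base`, or is one of the
`delta` children of `u`. The children have depth `u.depth + 1`, so the cut-off at `n` keeps all of
them if `u.depth < n` and none otherwise. -/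
theorem tsum_dom {T : TBox C R} {A : ABox I C R} (n : ℕ) {u : Elem I R} (S : Role R)
    (hu : Good T A u) (hn : u.depth ≤ n) :
    ∑' v : ({v | Good T A v ∧ v.depth ≤ n} : Set (Elem I R)), fullRole A S u v =
      if u.depth < n then cl T A u (.ex S) else base A u (.ex S) := by
  have h1 : ∑' v : ({v | Good T A v ∧ v.depth ≤ n} : Set (Elem I R)), fullRole A S u v =
      ∑' v, (if Good T A v ∧ v.depth ≤ n then fullRole A S u v else 0) :=
    (enat_tsum_ite (fun v => Good T A v ∧ v.depth ≤ n) (fullRole A S u)).symm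
  rw [h1, enat_tsum_add_compl u.IsOld]
  have h2 : ∑' v : {v // u.IsOld v}, (if Good T A v.1 ∧ v.1.depth ≤ n then fullRole A S u v else 0)
      = base A u (.ex S) := by
    rw [← tsum_isOld]
    exact tsum_congr fun v => if_pos ⟨v.2.good hu, v.2.depth_le.trans hn⟩
  have h3 : ∑' v : {v // ¬ u.IsOld v},
      (if Good T A v.1 ∧ v.1.depth ≤ n then fullRole A S u v else 0) =
      if u.depth < n then delta T A u S else 0 := by
    split_ifs with hlt
    · rw [← enat_tsum_ite (fun v => ¬ u.IsOld v)
        (fun v => if Good T A v ∧ v.depth ≤ n then fullRole A S u v else 0), ← tsum_children u S (delta T A u S)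
        (fun v => ∃ j : ℕ, (1 ≤ j ∧ (j : ℕ∞) ≤ delta T A u S) ∧ v = .anon j u S)
        (fullRole A S u) (fullRole_child A S u) fun _ => Iff.rfl, ← enat_tsum_ite]
      refine tsum_congr fun v => ?_
      by_cases hc : ∃ j, v = .anon j u S
      · obtain ⟨j, rfl⟩ := hc
        have : (Elem.anon j u S).depth ≤ n := hlt
        simp [not_isOld_anon, Good, hu, this]
      · push Not at hc
        by_cases ho : u.IsOld v
        · have : ¬ ∃ j : ℕ, (1 ≤ j ∧ (j : ℕ∞) ≤ delta T A u S) ∧ v = .anon j u S :=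
            fun ⟨j, _, h⟩ => hc j h
          simp [ho, this]
        · simp [fullRole_eq_zero ho hc]
    · refine (tsum_congr fun v => ?_).trans tsum_zero
      obtain ⟨v, hv⟩ := v
      split_ifs with h
      · refine fullRole_eq_zero hv fun j hj => ?_
        subst hj
        exact hlt h.2
      · rfl
  rw [h2, h3]
  split_ifs
  · exact base_add_delta ..
  · exact add_zero _

/-- The stages agree with the explicit description of the canonical model. -/
structure IsStage (T : TBox C R) (A : ABox I C R) (n : ℕ) (J : Stage I C R) : Prop where
  dom : J.dom = {u | Good T A u ∧ u.depth ≤ n}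
  role : ∀ u ∈ J.dom, ∀ v ∈ J.dom, ∀ P, J.role P u v = fullRole A (.atom P) u v
  role_zero : ∀ u v, ¬ (u ∈ J.dom ∧ v ∈ J.dom) → ∀ P, J.role P u v = 0
  concept : ∀ u ∈ J.dom, u.depth < n → ∀ B, J.concept B u = cl T A u (.atom B)
  concept_new : ∀ u ∈ J.dom, u.depth = n → ∀ B, J.concept B u = base A u (.atom B)
  concept_zero : ∀ u, u ∉ J.dom → ∀ B, J.concept B u = 0

theorem IsStage.roleExt {T : TBox C R} {A : ABox I C R} {n : ℕ} {J : Stage I C R}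
    (h : IsStage T A n J) {u v : Elem I R} (hu : u ∈ J.dom) (hv : v ∈ J.dom) (S : Role R) :
    J.roleExt S u v = fullRole A S u v := by
  cases S with
  | atom P => exact h.role u hu v hv P
  | inv P => exact (h.role v hv u hu P).trans (fullRole_swap A (.atom P) u v).symm

theorem IsStage.conceptExt {T : TBox C R} {A : ABox I C R} {n : ℕ} {J : Stage I C R}
    (h : IsStage T A n J) {u : Elem I R} (hu : u ∈ J.dom) (D : Concept C R) :
    J.conceptExt D u = if u.depth < n then cl T A u D else base A u D := by
  have hu' := hu
  rw [h.dom] at hu'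
  cases D with
  | atom B =>
    split_ifs with hn
    · exact h.concept u hu hn B
    · exact h.concept_new u hu (le_antisymm hu'.2 (not_lt.1 hn)) B
  | ex S =>
    rw [← tsum_dom n S hu'.1 hu'.2]
    change ∑' v : J.dom, J.roleExt S u v = _
    rw [tsum_congr fun v : J.dom => h.roleExt hu v.2 S, h.dom]

/-- The current extensions of `u` are either the initial ones, whose closure is `cl` by definition,
or are already `cl`, which is idempotent. -/
theorem IsStage.closure {T : TBox C R} {A : ABox I C R} {n : ℕ} {J : Stage I C R}
    (h : IsStage T A n J) {u : Elem I R} (hu : u ∈ J.dom) (E : Concept C R) :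
    J.closure T u E = cl T A u E := by
  unfold Stage.closure
  simp only [h.conceptExt hu]
  split_ifs
  · exact iSup_cl T A u E
  · rfl

/-- Elements of depth less than `n` are saturated, so their deficit is `cl - cl = 0`; only those of
depth exactly `n` receive children. -/
theorem IsStage.nextDom {T : TBox C R} {A : ABox I C R} {n : ℕ} {J : Stage I C R}
    (h : IsStage T A n J) : J.nextDom T = {u | Good T A u ∧ u.depth ≤ n + 1} := by
  ext w
  simp only [Stage.nextDom, Set.mem_union, Set.mem_ofPred_eq]
  constructor
  · rintro (hw | ⟨u, hu, S, j, hj, hle, rfl⟩)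
    · rw [h.dom] at hw
      exact ⟨hw.1, hw.2.trans n.le_succ⟩
    · rw [h.closure hu, h.conceptExt hu] at hle
      have hu' := hu
      rw [h.dom] at hu'
      refine ⟨⟨hu'.1, hj, ?_⟩, Nat.succ_le_succ hu'.2⟩
      split_ifs at hle
      · rw [tsub_self] at hle
        exact absurd (Nat.cast_eq_zero.1 (le_zero_iff.1 hle)) (by omega)
      · exact hle
  · rintro ⟨hw, hd⟩
    rcases hd.lt_or_eq with hd | hd
    · left
      rw [h.dom]
      exact ⟨hw, Nat.lt_succ_iff.1 hd⟩
    · right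
      cases w with
      | ind a => simp [Elem.depth] at hd
      | anon j u S =>
        have hun : u.depth = n := Nat.succ_injective hd
        have hu : u ∈ J.dom := by
          rw [h.dom]
          exact ⟨hw.1, hun.le⟩
        refine ⟨u, hu, S, j, hw.2.1, ?_, rfl⟩
        rw [h.closure hu, h.conceptExt hu, if_neg hun.not_lt]
        exact hw.2.2

theorem isStage_zero (T : TBox C R) (A : ABox I C R) : IsStage T A 0 (Stage.zero A) where
  dom := by
    ext u
    cases u with
    | ind a => exact ⟨fun _ => ⟨trivial, le_rfl⟩, fun _ => ⟨a, rfl⟩⟩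
    | anon j u S => exact ⟨fun ⟨_, h⟩ => (by cases h), fun h => absurd h.2 (Nat.not_succ_le_zero _)⟩
  role := by
    rintro _ ⟨a, rfl⟩ _ ⟨b, rfl⟩ P
    rfl
  role_zero := by
    rintro (a | ⟨j, u, S⟩) (b | ⟨k, v, S'⟩) h P
    · exact absurd ⟨⟨a, rfl⟩, ⟨b, rfl⟩⟩ h
    all_goals rfl
  concept _ _ h := absurd h (Nat.not_lt_zero _)
  concept_new := by
    rintro _ ⟨a, rfl⟩ _ B
    rfl
  concept_zero := by
    rintro (a | ⟨j, u, S⟩) h P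
    · exact absurd ⟨a, rfl⟩ h
    · rfl

theorem IsStage.next {T : TBox C R} {A : ABox I C R} {n : ℕ} {J : Stage I C R}
    (h : IsStage T A n J) : IsStage T A (n + 1) (J.next T) where
  dom := h.nextDom
  role u hu v hv P := by
    change (if u ∈ J.dom ∧ v ∈ J.dom then J.role P u v else _) = _
    split_ifs with h1 h2
    · exact h.role u h1.1 v h1.2 P
    all_goals
      have hd : 0 < u.depth ∨ 0 < v.depth := by
        by_contra hd
        push Not at hd
        have hu' : u ∈ J.nextDom T := hu
        have hv' : v ∈ J.nextDom T := hv
        rw [h.nextDom] at hu' hv'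
        rw [h.dom] at h1
        exact h1 ⟨⟨hu'.1, hd.1.trans n.zero_le⟩, hv'.1, hd.2.trans n.zero_le⟩
      rw [fullRole_of_not_ind hd]
    · exact (if_pos h2.2.2).symm
    · exact (if_neg fun h3 => h2 ⟨hu, hv, h3⟩).symm
  role_zero u v hn P := by
    change (if u ∈ J.dom ∧ v ∈ J.dom then J.role P u v else _) = _
    have hn' : ¬ (u ∈ J.nextDom T ∧ v ∈ J.nextDom T) := hn
    rw [if_neg fun h1 => hn ⟨.inl h1.1, .inl h1.2⟩, if_neg fun h1 => hn' ⟨h1.1, h1.2.1⟩]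
  concept u hu hd B := by
    have hu' : u ∈ J.nextDom T := hu
    rw [h.nextDom] at hu'
    have hu1 : u ∈ J.dom := by
      rw [h.dom]
      exact ⟨hu'.1, Nat.lt_succ_iff.1 hd⟩
    change (if u ∈ J.dom then J.closure T u (.atom B) else 0) = _
    rw [if_pos hu1, h.closure hu1]
  concept_new u hu hd B := by
    have hu1 : u ∉ J.dom := by
      rw [h.dom]
      exact fun h => absurd h.2 (by omega)
    change (if u ∈ J.dom then J.closure T u (.atom B) else 0) = _
    rw [if_neg hu1]
    cases u with
    | ind a => simp [Elem.depth] at hd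
    | anon j u S => simp [base]
  concept_zero u hu B := by
    change (if u ∈ J.dom then J.closure T u (.atom B) else 0) = _
    rw [if_neg fun h1 => hu (.inl h1)]

theorem isStage_stage (T : TBox C R) (A : ABox I C R) (n : ℕ) : IsStage T A n (stage T A n) := by
  induction n with
  | zero => exact isStage_zero T A
  | succ n ih => exact ih.next

theorem exists_mem_stage_iff (T : TBox C R) (A : ABox I C R) (u : Elem I R) :
    (∃ n, u ∈ (stage T A n).dom) ↔ Good T A u := by
  constructor
  · rintro ⟨n, h⟩
    rw [(isStage_stage T A n).dom] at h
    exact h.1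
  · intro h
    refine ⟨u.depth, ?_⟩
    rw [(isStage_stage T A _).dom]
    exact ⟨h, le_rfl⟩

theorem base_atom_le_cl (T : TBox C R) (A : ABox I C R) (u : Elem I R) (B : C) :
    base A u (.atom B) ≤ cl T A u (.atom B) := base_le_cl (.refl _ _)

theorem canonical_concept [Nonempty I] (T : TBox C R) (A : ABox I C R) (B : C) (u : (canonical T A).Dom) :
    (canonical T A).concept B u = cl T A u.1 (.atom B) := by
  have hu := (exists_mem_stage_iff T A u.1).1 u.2
  -- At stage `depth` the element only has its initial multiplicities; the closed ones appear one
  -- stage later.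
  refine le_antisymm (iSup_le fun n => ?_) (le_iSup_of_le (u.1.depth + 1) ?_)
  · have hs := isStage_stage T A n
    by_cases hd : u.1 ∈ (stage T A n).dom
    · have := hs.conceptExt hd (.atom B)
      change (stage T A n).concept B u.1 = _ at this
      rw [this]
      split_ifs
      · exact le_rfl
      · exact base_atom_le_cl ..
    · rw [hs.concept_zero _ hd]
      exact zero_le
  · rw [(isStage_stage T A _).concept _ _ (Nat.lt_succ_self _)]
    rw [(isStage_stage T A _).dom]
    exact ⟨hu, Nat.le_succ _⟩

theorem canonical_role [Nonempty I] (T : TBox C R) (A : ABox I C R) (P : R) (u v : (canonical T A).Dom) :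
    (canonical T A).role P u v = fullRole A (.atom P) u.1 v.1 := by
  have hu := (exists_mem_stage_iff T A u.1).1 u.2
  have hv := (exists_mem_stage_iff T A v.1).1 v.2
  refine le_antisymm (iSup_le fun n => ?_) (le_iSup_of_le (max u.1.depth v.1.depth) ?_)
  · have hs := isStage_stage T A n
    by_cases hd : u.1 ∈ (stage T A n).dom ∧ v.1 ∈ (stage T A n).dom
    · exact (hs.role _ hd.1 _ hd.2 P).le
    · rw [hs.role_zero _ _ hd]
      exact zero_le
  · have hs := isStage_stage T A (max u.1.depth v.1.depth)
    rw [hs.role]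
    · rw [hs.dom]
      exact ⟨hu, le_max_left _ _⟩
    · rw [hs.dom]
      exact ⟨hv, le_max_right _ _⟩

/-- Without axioms `cl` and `base` coincide, so no deficit ever calls for an anonymous element. -/
theorem good_empty {A : ABox I C R} {u : Elem I R} (h : Good ∅ A u) : ∃ a, u = .ind a := by
  cases u with
  | ind a => exact ⟨a, rfl⟩
  | anon j u S =>
    have h1 := h.2.2
    rw [delta, cl_empty, tsub_self] at h1
    exact absurd (Nat.cast_eq_zero.1 (le_zero_iff.1 h1)) (by have := h.2.1; omega)

/-! ### Evaluation of the components of the rewriting -/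

/-- The bag extension of a role in a bag interpretation. -/
def BagInterp.roleExt (J : BagInterp I C R) : Role R → J.Dom → J.Dom → ℕ∞
  | .atom P, u, v => J.role P u v
  | .inv P, u, v => J.role P v u

/-- The bag extension of a concept in a bag interpretation. -/
def BagInterp.ext (J : BagInterp I C R) : Concept C R → J.Dom → ℕ∞
  | .atom A, u => J.concept A u
  | .ex S, u => ∑' v, J.roleExt S u v

/-- The maximal multiplicity in a concept subsumed by `E`. -/
def BagInterp.maxExt (J : BagInterp I C R) (T : TBox C R) (E : Concept C R) (u : J.Dom) : ℕ∞ :=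
  ⨆ D : {D : Concept C R // Entails I T D E}, J.ext D.1 u

/-- The equalities in a list of atoms hold under an assignment. -/
def SatEqs (J : BagInterp I C R) (l : List (Atom I V C R)) (β : V → J.Dom) : Prop :=
  ∀ v t, Atom.eq v t ∈ l → β v = J.val β t

/-- The multiplicity of the replacement of an atom. -/
def replMult (J : BagInterp I C R) (T : TBox C R) (z : Finset V) (β : V → J.Dom) :
    Atom I V C R → ℕ∞
  | .concept A t => J.maxExt T (.atom A) (J.val β t)
  | .role P t₁ t₂ =>
      if t₂.VarIn z then
        J.maxExt T (.ex (.atom P)) (J.val β t₁) - J.ext (.ex (.atom P)) (J.val β t₁)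
      else if t₁.VarIn z then
        J.maxExt T (.ex (.inv P)) (J.val β t₂) - J.ext (.ex (.inv P)) (J.val β t₂)
      else J.role P (J.val β t₁) (J.val β t₂)
  | .eq _ _ => 1

theorem override_of_mem {D : Type} {s : Finset V} {μ : s → D} {β : V → D} {v : V} (h : v ∈ s) :
    override s μ β v = μ ⟨v, h⟩ := dif_pos h

theorem override_of_notMem {D : Type} {s : Finset V} {μ : s → D} {β : V → D} {v : V}
    (h : v ∉ s) : override s μ β v = β v := dif_neg h

theorem tsum_singleton_assignment {D : Type} (w : V) (g : D → ℕ∞) :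
    ∑' μ : ({w} : Finset V) → D, g (μ ⟨w, Finset.mem_singleton_self w⟩) = ∑' d, g d := by
  have e : Function.Bijective
      fun μ : ({w} : Finset V) → D => μ ⟨w, Finset.mem_singleton_self w⟩ := by
    constructor
    · intro μ ν h
      funext ⟨v, hv⟩
      obtain rfl := Finset.mem_singleton.1 hv
      exact h
    · exact fun d => ⟨fun _ => d, rfl⟩
  exact (Equiv.ofBijective _ e).tsum_eq g

theorem eval_zeta {q : CQ I V C R} (ch : q.Choice) (J : BagInterp I C R) (D : Concept C R)
    (t : Term I V) (β : V → J.Dom) :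
    (CQ.zeta ch D t).eval J β = J.ext D (J.val β t) := by
  have hv : ∀ μ : ({ch.bound t} : Finset V) → J.Dom,
      J.val (override {ch.bound t} μ β) t = J.val β t := by
    intro μ
    cases t with
    | ind a => rfl
    | var v =>
      refine override_of_notMem fun h => ?_
      exact ch.bound_ne v (Finset.mem_singleton.1 h).symm
  have hw : ∀ μ : ({ch.bound t} : Finset V) → J.Dom,
      override {ch.bound t} μ β (ch.bound t) = μ ⟨ch.bound t, Finset.mem_singleton_self _⟩ :=
    fun μ => override_of_mem _
  rcases D with A | (P | P)
  · rfl
  · change ∑' μ : ({ch.bound t} : Finset V) → J.Dom,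
      J.role P (J.val (override {ch.bound t} μ β) t)
        (override {ch.bound t} μ β (ch.bound t)) = ∑' v, J.role P (J.val β t) v
    simp only [hv, hw]
    exact tsum_singleton_assignment _ fun d => J.role P (J.val β t) d
  · change ∑' μ : ({ch.bound t} : Finset V) → J.Dom,
      J.role P (override {ch.bound t} μ β (ch.bound t))
        (J.val (override {ch.bound t} μ β) t) = ∑' v, J.role P v (J.val β t)
    simp only [hv, hw]
    exact tsum_singleton_assignment _ fun d => J.role P d (J.val β t)

theorem eval_maxList_le {J : BagInterp I C R} {l : List (Query I V C R)} {β : V → J.Dom}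
    {n : ℕ∞} : (Query.maxList l).eval J β ≤ n ↔ ∀ f ∈ l, f.eval J β ≤ n := by
  induction l with
  | nil => simp [Query.maxList, Query.eval]
  | cons f l ih =>
    cases l with
    | nil => simp [Query.maxList]
    | cons g l =>
      rw [Query.maxList, Query.eval, max_le_iff, ih]
      simp only [List.forall_mem_cons]

theorem eval_eta {q : CQ I V C R} (T : TBox C R) (ch : q.Choice) (J : BagInterp I C R)
    (E : Concept C R) (t : Term I V) (β : V → J.Dom) :
    (CQ.eta T ch E t).eval J β = J.maxExt T E (J.val β t) := by
  refine eq_of_forall_ge_iff fun n => ?_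
  rw [CQ.eta, eval_maxList_le, BagInterp.maxExt, iSup_le_iff]
  simp [subsumees, eval_zeta]

theorem eval_andList (J : BagInterp I C R) (l : List (Query I V C R)) (β : V → J.Dom) :
    (Query.andList l).eval J β = (l.map fun f => f.eval J β).prod := by
  induction l with
  | nil => rfl
  | cons f l ih =>
    cases l with
    | nil => simp [Query.andList]
    | cons g l => rw [Query.andList, Query.eval, ih, List.map_cons (l := g :: l), List.prod_cons]

theorem eval_addList (J : BagInterp I C R) (l : List (Query I V C R)) (β : V → J.Dom) :
    (Query.addList l).eval J β = (l.map fun f => f.eval J β).sum := by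
  induction l with
  | nil => rfl
  | cons f l ih =>
    cases l with
    | nil => simp [Query.addList]
    | cons g l => rw [Query.addList, Query.eval, ih, List.map_cons (l := g :: l), List.sum_cons]

theorem satEqs_cons_eq {J : BagInterp I C R} {v : V} {t : Term I V} {l : List (Atom I V C R)}
    {β : V → J.Dom} : SatEqs J (.eq v t :: l) β ↔ β v = J.val β t ∧ SatEqs J l β := by
  constructor
  · exact fun h => ⟨h v t List.mem_cons_self, fun u s hs => h u s (List.mem_cons_of_mem _ hs)⟩
  · rintro ⟨h1, h2⟩ u s hs
    rcases List.mem_cons.1 hs with hs | hs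
    · cases hs
      exact h1
    · exact h2 u s hs

theorem satEqs_cons_of_not_isEq {J : BagInterp I C R} {α : Atom I V C R} (hα : ¬ α.IsEq)
    {l : List (Atom I V C R)} {β : V → J.Dom} : SatEqs J (α :: l) β ↔ SatEqs J l β := by
  constructor
  · exact fun h u s hs => h u s (List.mem_cons_of_mem _ hs)
  · intro h u s hs
    rcases List.mem_cons.1 hs with hs | hs
    · subst hs
      exact absurd trivial hα
    · exact h u s hs

theorem eval_addEqs (J : BagInterp I C R) (f : Query I V C R) (l : List (Atom I V C R))
    (β : V → J.Dom) :
    (f.addEqs l).eval J β = if SatEqs J l β then f.eval J β else 0 := by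
  induction l with
  | nil => exact (if_pos fun _ _ h => absurd h List.not_mem_nil).symm
  | cons α l ih =>
    cases α with
    | concept A t =>
      rw [Query.addEqs, ih, satEqs_cons_of_not_isEq (α := .concept A t) id]
    | role P t₁ t₂ =>
      rw [Query.addEqs, ih, satEqs_cons_of_not_isEq (α := .role P t₁ t₂) id]
    | eq v t =>
      rw [Query.addEqs, Query.eval, ih, satEqs_cons_eq]
      by_cases h : β v = J.val β t <;> simp [h]

theorem eval_of_replace {q : CQ I V C R} {T : TBox C R} {ch : q.Choice} {z : Finset V}
    {α : Atom I V C R} {f : Query I V C R} (h : CQ.replace T ch z α = some f)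
    (J : BagInterp I C R) (β : V → J.Dom) : f.eval J β = replMult J T z β α := by
  cases α with
  | concept A t =>
    obtain rfl := Option.some_injective _ h
    exact eval_eta ..
  | role P t₁ t₂ =>
    rw [CQ.replace] at h
    rw [replMult]
    split_ifs at h ⊢
    all_goals
      obtain rfl := Option.some_injective _ h
      simp only [Query.eval, eval_eta, eval_zeta]
  | eq v t => cases h

theorem eval_filterMap_replace {q : CQ I V C R} (T : TBox C R) (ch : q.Choice) (z : Finset V)
    (l : List (Atom I V C R)) (J : BagInterp I C R) (β : V → J.Dom) :
    (Query.andList (l.filterMap (CQ.replace T ch z))).eval J β =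
      (l.map (replMult J T z β)).prod := by
  rw [eval_andList]
  induction l with
  | nil => rfl
  | cons α l ih =>
    rw [List.filterMap_cons, List.map_cons, List.prod_cons, ← ih]
    cases h : CQ.replace T ch z α with
    | some f => simp [eval_of_replace h]
    | none =>
      cases α with
      | concept A t => cases h
      | role P t₁ t₂ =>
        rw [CQ.replace] at h
        split_ifs at h
      | eq v t => simp [replMult]

/-- The multiplicity of `ψ_z`. -/
theorem eval_psi (q : CQ I V C R) (T : TBox C R) (ch : q.Choice) (z : Finset V)
    (J : BagInterp I C R) (β : V → J.Dom) :
    (q.psi T ch z).eval J β = if SatEqs J (q.bodyZ ch z) β then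
      ((q.bodyZ ch z).map (replMult J T z β)).prod else 0 := by
  rw [CQ.psi, eval_addEqs, eval_filterMap_replace]

theorem eval_rewriting [Nonempty I] (q : CQ I V C R) (T : TBox C R) (ch : q.Choice)
    (J : BagInterp I C R) (β : V → J.Dom) :
    (q.rewriting T ch).eval J β = ∑ z ∈ q.y.powerset with q.Realisable T ch z,
      ∑' μ : q.yZ ch z → J.Dom, (q.psi T ch z).eval J (override (q.yZ ch z) μ β) := by
  rw [CQ.rewriting, eval_addList, List.map_map, Finset.sum_map_toList]
  rfl

/-! ### The rewriting as a `BALG¹_ε`-query -/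

/-- The terms of an atom that remain in its replacement. -/
def keptTerms (z : Finset V) : Atom I V C R → Finset (Term I V)
  | .concept _ t => {t}
  | .role _ t₁ t₂ => if t₂.VarIn z then {t₁} else if t₁.VarIn z then {t₂} else {t₁, t₂}
  | .eq _ _ => ∅

theorem Term.mem_vars {t : Term I V} {v : V} : v ∈ t.vars ↔ t = .var v := by
  cases t with
  | var u => simp [Term.vars, eq_comm]
  | ind a => simp [Term.vars]

theorem IsBALG.zeta {q : CQ I V C R} (ch : q.Choice) (D : Concept C R) (t : Term I V) :
    (CQ.zeta ch D t).IsBALG t.vars := by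
  have hd : Disjoint t.vars {ch.bound t} := by
    rw [Finset.disjoint_singleton_right, Term.mem_vars]
    intro h
    exact ch.bound_ne (ch.bound t) (by rw [← h])
  rcases D with A | (P | P)
  · exact .concept A t
  · exact .ex (.role P t _) hd
  · refine .ex ?_ hd
    rw [Finset.union_comm]
    exact .role P _ t

theorem IsBALG.maxList {l : List (Query I V C R)} {s : Finset V} (hl : l ≠ [])
    (h : ∀ f ∈ l, f.IsBALG s) : (Query.maxList l).IsBALG s := by
  induction l with
  | nil => exact absurd rfl hl
  | cons f l ih =>
    cases l with
    | nil => exact h f List.mem_cons_self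
    | cons g l =>
      exact .max (h f List.mem_cons_self)
        (ih (by simp) fun k hk => h k (List.mem_cons_of_mem _ hk))

theorem IsBALG.addList {l : List (Query I V C R)} {s : Finset V} (hl : l ≠ [])
    (h : ∀ f ∈ l, f.IsBALG s) : (Query.addList l).IsBALG s := by
  induction l with
  | nil => exact absurd rfl hl
  | cons f l ih =>
    cases l with
    | nil => exact h f List.mem_cons_self
    | cons g l =>
      exact .add (h f List.mem_cons_self)
        (ih (by simp) fun k hk => h k (List.mem_cons_of_mem _ hk))

theorem IsBALG.eta {q : CQ I V C R} (T : TBox C R) (ch : q.Choice) (E : Concept C R)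
    (t : Term I V) : (CQ.eta T ch E t).IsBALG t.vars := by
  refine IsBALG.maxList ?_ ?_
  · have : E ∈ (subsumees I T E).toList := by simp [subsumees, Entails.refl]
    intro h
    rw [List.map_eq_nil_iff] at h
    simp [h] at this
  · intro f hf
    obtain ⟨D, -, rfl⟩ := List.mem_map.1 hf
    exact IsBALG.zeta ch D t

theorem exists_replace_balg {q : CQ I V C R} (T : TBox C R) (ch : q.Choice) (z : Finset V)
    {α : Atom I V C R} (hα : ¬ α.IsEq) :
    ∃ f, CQ.replace T ch z α = some f ∧ f.IsBALG ((keptTerms z α).biUnion Term.vars) := by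
  cases α with
  | concept A t => exact ⟨_, rfl, by simpa [keptTerms] using IsBALG.eta T ch (.atom A) t⟩
  | role P t₁ t₂ =>
    rw [CQ.replace, keptTerms]
    split_ifs
    · refine ⟨_, rfl, ?_⟩
      rw [Finset.singleton_biUnion]
      exact .diff (IsBALG.eta ..) (IsBALG.zeta ..)
    · refine ⟨_, rfl, ?_⟩
      rw [Finset.singleton_biUnion]
      exact .diff (IsBALG.eta ..) (IsBALG.zeta ..)
    · refine ⟨_, rfl, ?_⟩
      rw [Finset.biUnion_insert, Finset.singleton_biUnion]
      exact .role ..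
  | eq v t => exact absurd trivial hα

theorem exists_balg_conj {q : CQ I V C R} (T : TBox C R) (ch : q.Choice) (z : Finset V)
    {l : List (Atom I V C R)} (hl : l ≠ []) (h : ∀ α ∈ l, ¬ α.IsEq) :
    ∃ f : Query I V C R, f.IsBALG ((l.toFinset.biUnion (keptTerms z)).biUnion Term.vars) ∧
      ∀ (J : BagInterp I C R) (β : V → J.Dom),
        f.eval J β = (l.map (replMult J T z β)).prod := by
  induction l with
  | nil => exact absurd rfl hl
  | cons α l ih =>
    obtain ⟨f, hf, hb⟩ := exists_replace_balg T ch z (h α List.mem_cons_self)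
    rcases eq_or_ne l [] with rfl | hl'
    · refine ⟨f, by simpa using hb, fun J β => ?_⟩
      simp [eval_of_replace hf]
    · obtain ⟨g, hg, he⟩ := ih hl' fun α hα => h α (List.mem_cons_of_mem _ hα)
      refine ⟨.and f g, ?_, fun J β => ?_⟩
      · rw [List.toFinset_cons, Finset.biUnion_insert, Finset.union_biUnion]
        exact .and hb hg
      · rw [Query.eval, he, eval_of_replace hf, List.map_cons, List.prod_cons]

/-- A selection `u = v` with `u` already an answer variable makes `v` an answer variable too. If the
equalities of `l` force `u = v` anyway, nothing is lost under assignments that satisfy them. -/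
theorem exists_balg_addVars {f : Query I V C R} {s : Finset V} (hf : f.IsBALG s)
    (l : List (Atom I V C R)) (S : Finset V)
    (h : ∀ v ∈ S, ∃ u ∈ s, ∀ (J : BagInterp I C R) (β : V → J.Dom),
      SatEqs J l β → β u = β v) :
    ∃ g : Query I V C R, g.IsBALG (s ∪ S) ∧ ∀ (J : BagInterp I C R) (β : V → J.Dom),
      SatEqs J l β → g.eval J β = f.eval J β := by
  induction S using Finset.induction_on with
  | empty => exact ⟨f, by simpa using hf, fun _ _ _ => rfl⟩
  | insert v S hv ih =>
    obtain ⟨g, hg, he⟩ := ih fun v hv => h v (Finset.mem_insert_of_mem hv)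
    obtain ⟨u, hu, huv⟩ := h v (Finset.mem_insert_self _ _)
    refine ⟨.andEq g u (.var v), ?_, fun J β hβ => ?_⟩
    · have := Query.IsBALG.andEq (.var v) hg (Finset.mem_union_left S hu)
      rwa [Term.vars, Finset.union_assoc, Finset.union_comm S, ← Finset.insert_eq] at this
    · rw [Query.eval, if_pos (show β u = J.val β (.var v) from huv J β hβ), he J β hβ]

theorem exists_balg_addEqs {f : Query I V C R} {S : Finset V} (hf : f.IsBALG S)
    (l : List (Atom I V C R)) (h : ∀ v t, Atom.eq v t ∈ l → v ∈ S ∧ t.vars ⊆ S) :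
    (f.addEqs l).IsBALG S := by
  induction l with
  | nil => exact hf
  | cons α l ih =>
    have ih' := ih fun v t ht => h v t (List.mem_cons_of_mem _ ht)
    cases α with
    | concept A t => exact ih'
    | role P t₁ t₂ => exact ih'
    | eq v t =>
      obtain ⟨hv, ht⟩ := h v t List.mem_cons_self
      have := Query.IsBALG.andEq t ih' hv
      rwa [Finset.union_eq_left.2 ht] at this

/-! ### Abstraction of individuals by fresh variables -/

theorem exists_fresh_vars [Infinite V] (F : Finset I) (X : Finset V) :
    ∃ w : I → V, (∀ c, w c ∉ X) ∧ Set.InjOn w F := by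
  have : Infinite {v // v ∉ X} := by
    have := (Finset.finite_toSet X).infinite_compl
    exact this.to_subtype
  let e : F ↪ {v // v ∉ X} :=
    (Finite.equivFin F).toEmbedding.trans (Fin.valEmbedding.trans (Infinite.natEmbedding _))
  obtain ⟨v₀⟩ : Nonempty {v // v ∉ X} := inferInstance
  refine ⟨fun c => if h : c ∈ F then (e ⟨c, h⟩).1 else v₀.1, fun c => ?_, fun c hc d hd h => ?_⟩
  · dsimp only
    split_ifs with h
    · exact (e _).2
    · exact v₀.2
  · simp only [Finset.mem_coe] at hc hd
    simp only [hc, hd, dif_pos] at h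
    exact congrArg Subtype.val (e.injective (Subtype.ext h))

/-- Replacement of the individuals in a term by variables. -/
def Term.abstr (w : I → V) : Term I V → Term I V
  | .var v => .var v
  | .ind c => .var (w c)

/-- Replacement of the individuals in an atom by variables. -/
def Atom.abstr (w : I → V) : Atom I V C R → Atom I V C R
  | .concept A t => .concept A (t.abstr w)
  | .role P t₁ t₂ => .role P (t₁.abstr w) (t₂.abstr w)
  | .eq v t => .eq v t

theorem Atom.isEq_abstr {w : I → V} {α : Atom I V C R} : (α.abstr w).IsEq ↔ α.IsEq := by
  cases α <;> rfl

theorem Term.varIn_abstr {w : I → V} {z : Finset V} (hw : ∀ c, w c ∉ z) {t : Term I V} :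
    (t.abstr w).VarIn z ↔ t.VarIn z := by
  cases t with
  | var v => rfl
  | ind c =>
    constructor
    · rintro ⟨v, hv, h⟩
      cases h
      exact absurd hv (hw c)
    · rintro ⟨v, hv, h⟩
      cases h

theorem keptTerms_abstr {w : I → V} {z : Finset V} (hw : ∀ c, w c ∉ z) {α : Atom I V C R} :
    keptTerms z (α.abstr w) = (keptTerms z α).image (Term.abstr w) := by
  cases α with
  | concept A t => simp [keptTerms, Atom.abstr]
  | role P t₁ t₂ =>
    simp only [keptTerms, Atom.abstr, Term.varIn_abstr hw]
    split_ifs <;> simp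
  | eq v t => simp [keptTerms, Atom.abstr]

theorem replMult_congr {J : BagInterp I C R} {T : TBox C R} {z : Finset V} {β γ : V → J.Dom}
    {α : Atom I V C R} (h : ∀ t ∈ keptTerms z α, J.val β t = J.val γ t) :
    replMult J T z β α = replMult J T z γ α := by
  cases α with
  | concept A t => rw [replMult, replMult, h t (by simp [keptTerms])]
  | role P t₁ t₂ =>
    rw [replMult, replMult]
    rw [keptTerms] at h
    split_ifs at h ⊢
    · rw [h t₁ (by simp)]
    · rw [h t₂ (by simp)]
    · rw [h t₁ (by simp), h t₂ (by simp)]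
  | eq v t => rfl

theorem replMult_abstr {J : BagInterp I C R} {T : TBox C R} {z : Finset V} {β : V → J.Dom}
    {w : I → V} (hw : ∀ c, w c ∉ z) {α : Atom I V C R}
    (h : ∀ t ∈ keptTerms z α, J.val β (t.abstr w) = J.val β t) :
    replMult J T z β (α.abstr w) = replMult J T z β α := by
  cases α with
  | concept A t => rw [Atom.abstr, replMult, replMult, h t (by simp [keptTerms])]
  | role P t₁ t₂ =>
    rw [Atom.abstr, replMult, replMult]
    rw [keptTerms] at h
    simp only [Term.varIn_abstr hw]
    split_ifs at h ⊢
    · rw [h t₁ (by simp)]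
    · rw [h t₂ (by simp)]
    · rw [h t₁ (by simp), h t₂ (by simp)]
  | eq v t => rfl

theorem satEqs_append {J : BagInterp I C R} {l l' : List (Atom I V C R)} {β : V → J.Dom} :
    SatEqs J (l ++ l') β ↔ SatEqs J l β ∧ SatEqs J l' β := by
  simp only [SatEqs, List.mem_append]
  exact ⟨fun h => ⟨fun v t ht => h v t (.inl ht), fun v t ht => h v t (.inr ht)⟩,
    fun h v t ht => ht.elim (h.1 v t) (h.2 v t)⟩

theorem satEqs_congr {J : BagInterp I C R} {l : List (Atom I V C R)} {β γ : V → J.Dom}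
    (h : ∀ v t, Atom.eq v t ∈ l → β v = γ v ∧ J.val β t = J.val γ t) :
    SatEqs J l β ↔ SatEqs J l γ := by
  refine forall_congr' fun v => forall_congr' fun t => forall_congr' fun ht => ?_
  rw [(h v t ht).1, (h v t ht).2]

theorem prod_map_filter_not_isEq (l : List (Atom I V C R)) (g : Atom I V C R → ℕ∞)
    (hg : ∀ α, α.IsEq → g α = 1) :
    ((l.filter fun α => ¬ α.IsEq).map g).prod = (l.map g).prod := by
  induction l with
  | nil => rfl
  | cons α l ih =>
    by_cases h : α.IsEq
    · rw [List.filter_cons_of_neg (by simpa using h), ih, List.map_cons, List.prod_cons, hg α h,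
        one_mul]
    · rw [List.filter_cons_of_pos (by simpa using h), List.map_cons, List.map_cons,
        List.prod_cons, List.prod_cons, ih]

theorem replMult_of_isEq {J : BagInterp I C R} {T : TBox C R} {z : Finset V} {β : V → J.Dom}
    {α : Atom I V C R} (h : α.IsEq) : replMult J T z β α = 1 := by
  cases α with
  | eq v t => rfl
  | concept A t => exact absurd h id
  | role P t₁ t₂ => exact absurd h id

/-- A variable that is equated only with an individual `c`, as in `A(c) ∧ v = c`, cannot be
introduced by a selection, since no answer variable is available to start from. Writing `A(w) ∧ w =
v ∧ w = c` and projecting `w` out avoids this. The hypotheses say that the variables of the replaced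
atoms and of the equalities lie in `S`, and that the equalities tie each variable of `S` to a term
that survives the replacement. -/
theorem exists_balg_body [Infinite V] {q : CQ I V C R} (T : TBox C R) (ch : q.Choice)
    (z S : Finset V) (l : List (Atom I V C R)) (h0 : ∃ α ∈ l, ¬ α.IsEq)
    (h1 : ∀ α ∈ l, ∀ v, Term.var v ∈ keptTerms z α → v ∈ S)
    (h2 : ∀ v t, Atom.eq v t ∈ l → v ∈ S ∧ t.vars ⊆ S)
    (h3 : ∀ v ∈ S, ∃ α ∈ l, ∃ t ∈ keptTerms z α, ∀ (J : BagInterp I C R) (β : V → J.Dom),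
      SatEqs J l β → β v = J.val β t) :
    ∃ Q : Query I V C R, Q.IsBALG S ∧ ∀ (J : BagInterp I C R) (β : V → J.Dom),
      Q.eval J β = if SatEqs J l β then (l.map (replMult J T z β)).prod else 0 := by
  set K : Finset (Term I V) := l.toFinset.biUnion (keptTerms z) with hK
  have memK : ∀ {t}, t ∈ K ↔ ∃ α ∈ l, t ∈ keptTerms z α := by simp [hK]
  have hfin : {c : I | Term.ind c ∈ K}.Finite :=
    Set.Finite.preimage (fun a _ b _ h => by cases h; rfl) (Finset.finite_toSet K)
  set F : Finset I := hfin.toFinset with hF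
  have memF : ∀ {c}, c ∈ F ↔ Term.ind c ∈ K := by simp [hF]
  -- Avoiding `S` keeps the later projection from binding an answer variable; avoiding `z` ensures
  -- that an abstracted atom is replaced in the same way as the original one.
  obtain ⟨w, hw, hinj⟩ := exists_fresh_vars F (S ∪ z)
  have hwS : ∀ c, w c ∉ S := fun c h => hw c (Finset.mem_union_left _ h)
  have hwz : ∀ c, w c ∉ z := fun c h => hw c (Finset.mem_union_right _ h)
  set W : Finset V := F.image w with hW
  have hdisj : Disjoint S W := by
    rw [Finset.disjoint_right]
    intro v hv
    obtain ⟨c, -, rfl⟩ := Finset.mem_image.1 hv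
    exact hwS c
  set l₁ := (l.filter fun α => ¬ α.IsEq).map (Atom.abstr w) with hl₁
  have mem_l₁ : ∀ {α}, α ∈ l₁ ↔ ∃ α' ∈ l, ¬ α'.IsEq ∧ α'.abstr w = α := by
    simp [hl₁, and_assoc]
  -- The additional equalities pin each fresh variable to the individual that it stands for.
  set l₂ : List (Atom I V C R) := l ++ F.toList.map fun c => .eq (w c) (.ind c) with hl₂
  have sat₂ : ∀ (J : BagInterp I C R) (β : V → J.Dom), SatEqs J l₂ β ↔
      SatEqs J l β ∧ ∀ c ∈ F, β (w c) = J.ind c := by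
    intro J β
    rw [hl₂, satEqs_append]
    refine and_congr Iff.rfl ⟨fun h c hc => h (w c) (.ind c) ?_, fun h v t ht => ?_⟩
    · exact List.mem_map.2 ⟨c, Finset.mem_toList.2 hc, rfl⟩
    · obtain ⟨c, hc, hct⟩ := List.mem_map.1 ht
      cases hct
      exact h c (Finset.mem_toList.1 hc)
  obtain ⟨f, hf, hfe⟩ := exists_balg_conj T ch z (l := l₁)
    (by
      obtain ⟨α, hα, hne⟩ := h0
      exact List.ne_nil_of_mem (mem_l₁.2 ⟨α, hα, hne, rfl⟩))
    (by
      intro α hα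
      obtain ⟨α', -, hne, rfl⟩ := mem_l₁.1 hα
      rwa [Atom.isEq_abstr])
  set s := (l₁.toFinset.biUnion (keptTerms z)).biUnion Term.vars with hs
  have mem_s : ∀ {v}, v ∈ s ↔ ∃ t ∈ K, t.abstr w = .var v := by
    intro v
    simp only [hs, Finset.mem_biUnion, List.mem_toFinset, Term.mem_vars]
    constructor
    · rintro ⟨t, ⟨α, hα, ht⟩, rfl⟩
      obtain ⟨α', hα', -, rfl⟩ := mem_l₁.1 hα
      rw [keptTerms_abstr hwz] at ht
      obtain ⟨t', ht', h⟩ := Finset.mem_image.1 ht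
      exact ⟨t', memK.2 ⟨α', hα', ht'⟩, h⟩
    · rintro ⟨t, ht, h⟩
      obtain ⟨α, hα, htα⟩ := memK.1 ht
      refine ⟨_, ⟨α.abstr w, mem_l₁.2 ⟨α, hα, ?_, rfl⟩, ?_⟩, h⟩
      · intro he
        cases α with
        | eq v t => simp [keptTerms] at htα
        | concept A t => exact he
        | role P t₁ t₂ => exact he
      · rw [keptTerms_abstr hwz]
        exact Finset.mem_image_of_mem _ htα
  have hsub : s ⊆ S ∪ W := by
    intro v hv
    obtain ⟨t, ht, h⟩ := mem_s.1 hv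
    cases t with
    | var u =>
      cases h
      obtain ⟨α, hα, hu⟩ := memK.1 ht
      exact Finset.mem_union_left _ (h1 α hα v hu)
    | ind c =>
      cases h
      exact Finset.mem_union_right _ (Finset.mem_image_of_mem _ (memF.2 ht))
  -- Every variable has an anchor among the variables of the abstracted atoms: the surviving term
  -- that it equals, or the fresh variable for that term if the term is an individual.
  obtain ⟨g, hg, hge⟩ := exists_balg_addVars hf l₂ (S ∪ W) (by
    intro v hv
    rcases Finset.mem_union.1 hv with hv | hv
    · obtain ⟨α, hα, t, ht, hvt⟩ := h3 v hv
      have htK : t ∈ K := memK.2 ⟨α, hα, ht⟩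
      cases t with
      | var u =>
        exact ⟨u, mem_s.2 ⟨_, htK, rfl⟩, fun J β hβ => (hvt J β ((sat₂ J β).1 hβ).1).symm⟩
      | ind c =>
        refine ⟨w c, mem_s.2 ⟨_, htK, rfl⟩, fun J β hβ => ?_⟩
        obtain ⟨h4, h5⟩ := (sat₂ J β).1 hβ
        rw [hvt J β h4, h5 c (memF.2 htK)]
        rfl
    · obtain ⟨c, hc, rfl⟩ := Finset.mem_image.1 hv
      exact ⟨w c, mem_s.2 ⟨_, memF.1 hc, rfl⟩, fun _ _ _ => rfl⟩)
  rw [Finset.union_eq_right.2 hsub] at hg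
  have hQ := exists_balg_addEqs hg l₂ (by
    intro v t ht
    rcases List.mem_append.1 ht with ht | ht
    · exact ⟨Finset.mem_union_left _ (h2 v t ht).1,
        (h2 v t ht).2.trans Finset.subset_union_left⟩
    · obtain ⟨c, hc, hct⟩ := List.mem_map.1 ht
      cases hct
      exact ⟨Finset.mem_union_right _ (Finset.mem_image_of_mem _ (Finset.mem_toList.1 hc)),
        by simp [Term.vars]⟩)
  refine ⟨.ex W (g.addEqs l₂), .ex hQ hdisj, fun J β => ?_⟩
  have hev : ∀ γ : V → J.Dom, (g.addEqs l₂).eval J γ =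
      if SatEqs J l₂ γ then (l.map (replMult J T z γ)).prod else 0 := by
    intro γ
    rw [eval_addEqs]
    refine if_ctx_congr Iff.rfl (fun hγ => ?_) fun _ => rfl
    rw [hge J γ hγ, hfe, hl₁, List.map_map,
      ← prod_map_filter_not_isEq l _ fun α h => replMult_of_isEq h]
    congr 1
    refine List.map_congr_left fun α hα => ?_
    refine replMult_abstr hwz fun t ht => ?_
    cases t with
    | var v => rfl
    | ind c =>
      exact ((sat₂ J γ).1 hγ).2 c (memF.2 (memK.2 ⟨α, (List.mem_filter.1 hα).1, ht⟩))
  -- The only values of the fresh variables compatible with `l₂`, so the projection sums a single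
  -- non-trivial term. The preimage picked by `choose` is the right one because `w` is injective on
  -- `F`.
  let μ₀ : W → J.Dom := fun v => J.ind (Finset.mem_image.1 v.2).choose
  have hμ₀ : ∀ c (hc : c ∈ F), μ₀ ⟨w c, Finset.mem_image_of_mem w hc⟩ = J.ind c := by
    intro c hc
    have hs := (Finset.mem_image.1 (Finset.mem_image_of_mem w hc)).choose_spec
    exact congrArg J.ind (hinj hs.1 hc hs.2)
  rw [Query.eval, tsum_eq_single μ₀]
  · rw [hev]
    have hoff : ∀ v ∈ S, override W μ₀ β v = β v := fun v hv =>
      override_of_notMem fun h => Finset.disjoint_left.1 hdisj hv h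
    have hoff' : ∀ t : Term I V, t.vars ⊆ S → J.val (override W μ₀ β) t = J.val β t := by
      intro t ht
      cases t with
      | var v => exact hoff v (ht (by simp [Term.vars]))
      | ind c => rfl
    have hiff : SatEqs J l₂ (override W μ₀ β) ↔ SatEqs J l β := by
      rw [sat₂, satEqs_congr fun v t ht => ⟨hoff v (h2 v t ht).1, hoff' t (h2 v t ht).2⟩]
      refine and_iff_left fun c hc => ?_
      rw [override_of_mem (Finset.mem_image_of_mem w hc), hμ₀ c hc]
    refine if_congr hiff ?_ rfl
    congr 1
    refine List.map_congr_left fun α hα => replMult_congr fun t ht => hoff' t fun v hv => ?_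
    rw [Term.mem_vars] at hv
    exact h1 α hα v (hv ▸ ht)
  · intro μ hμ
    rw [hev, if_neg]
    intro hsat
    refine hμ (funext fun v => ?_)
    obtain ⟨v, hv⟩ := v
    obtain ⟨c, hc, rfl⟩ := Finset.mem_image.1 hv
    rw [hμ₀ c hc, ← ((sat₂ J _).1 hsat).2 c hc, override_of_mem hv]

/-! ### Connected sets of variables -/

theorem Term.varIn_var {v : V} {z : Finset V} : (Term.var v : Term I V).VarIn z ↔ v ∈ z := by
  constructor
  · rintro ⟨u, hu, h⟩
    cases h
    exact hu
  · exact fun h => ⟨v, h, rfl⟩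

theorem Term.VarIn.mono {t : Term I V} {z z' : Finset V} (h : t.VarIn z) (hz : z ⊆ z') :
    t.VarIn z' := by
  obtain ⟨v, hv, rfl⟩ := h
  exact ⟨v, hz hv, rfl⟩

theorem Term.not_varIn_ind {c : I} {z : Finset V} : ¬ (Term.ind c : Term I V).VarIn z := by
  rintro ⟨v, -, h⟩
  cases h

theorem CQ.EqConsistent.varIn_iff {q : CQ I V C R} {z : Finset V} (h : q.EqConsistent z)
    {s t : Term I V} (hst : (eqv q.body).r s t) : s.VarIn z ↔ t.VarIn z := by
  induction hst with
  | rel s t hr =>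
    obtain ⟨v, rfl, hv⟩ := hr
    rw [Term.varIn_var]
    exact h v t hv
  | refl => rfl
  | symm s t _ ih => exact ih.symm
  | trans s t u _ _ ih ih' => exact ih.trans ih'

theorem eqv_of_mem {l : List (Atom I V C R)} {v : V} {t : Term I V} (h : Atom.eq v t ∈ l) :
    (eqv l).r (.var v) t := .rel _ _ ⟨v, rfl, h⟩

theorem gaifman_adj_of_mem {l : List (Atom I V C R)} {α : Atom I V C R} (hα : α ∈ l)
    {s t : Term I V} (hs : s ∈ α.terms) (ht : t ∈ α.terms)
    (hne : (Quotient.mk (eqv l) s) ≠ Quotient.mk (eqv l) t) :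
    (gaifman l).Adj (Quotient.mk _ s) (Quotient.mk _ t) :=
  ⟨hne, .inl ⟨α, hα, s, hs, t, ht, rfl, rfl⟩⟩

theorem exists_mem_of_gaifman_adj {l : List (Atom I V C R)} {m n : Quotient (eqv l)}
    (h : (gaifman l).Adj m n) : ∃ α ∈ l, ∃ s ∈ α.terms, ∃ t ∈ α.terms,
      m = Quotient.mk _ s ∧ n = Quotient.mk _ t := by
  obtain ⟨-, ⟨α, hα, s, hs, t, ht, hm, hn⟩ | ⟨α, hα, s, hs, t, ht, hn, hm⟩⟩ := h
  · exact ⟨α, hα, s, hs, t, ht, hm, hn⟩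
  · exact ⟨α, hα, t, ht, s, hs, hm, hn⟩

namespace CQ

variable {q : CQ I V C R} {z z' : Finset V}

theorem MaConnected.closed (h : q.MaConnected z z') {s t : Term I V}
    (hst : (eqv q.body).r s t) (hs : s.VarIn z') : t.VarIn z' := by
  obtain ⟨v, hv, rfl⟩ := hs
  exact h.2.2.1 v hv t hst

theorem MaConnected.mk_mem_classes (h : q.MaConnected z z') {t : Term I V} :
    Quotient.mk _ t ∈ classes q.body z' ↔ t.VarIn z' := by
  constructor
  · rintro ⟨v, hv, hvt⟩
    exact h.2.2.1 v hv t ((eqv q.body).symm (Quotient.exact hvt))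
  · rintro ⟨v, hv, rfl⟩
    exact ⟨v, hv, rfl⟩

/-- Otherwise adjoining the class of `t` would give a larger connected set of classes of `z`. -/
theorem MaConnected.maximal_of_atom (h : q.MaConnected z z') {α : Atom I V C R}
    (hα : α ∈ q.body) {s t : Term I V} (hs : s ∈ α.terms) (ht : t ∈ α.terms)
    (hsz : s.VarIn z') (htz : t.VarIn z) : t.VarIn z' := by
  by_contra hn
  have hs' := h.mk_mem_classes.2 hsz
  have ht' : Quotient.mk _ t ∉ classes q.body z' := fun h' => hn (h.mk_mem_classes.1 h')
  have hadj := gaifman_adj_of_mem hα hs ht fun he => ht' (he ▸ hs')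
  have hconn := SimpleGraph.connected_induce_union h.2.2.2.1.2.preconnected
    (t := {Quotient.mk _ t})
    (@SimpleGraph.Preconnected.of_subsingleton _ _ (Set.subsingleton_coe _ |>.2 Set.subsingleton_singleton))
    hs' (Set.mem_singleton _) hadj
  refine ht' (h.2.2.2.2 ⟨?_, hconn⟩ Set.subset_union_left (Set.mem_union_right _ rfl))
  refine Set.union_subset h.2.2.2.1.1 ?_
  rintro _ rfl
  obtain ⟨v, hv, rfl⟩ := htz
  exact ⟨v, hv, rfl⟩

/-- Induction over the atoms that connect the variables of a connected set. -/
theorem MaConnected.induction (h : q.MaConnected z z') (p : V → Prop) {v₀ : V} (hv₀ : v₀ ∈ z')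
    (hp : p v₀) (step : ∀ α ∈ q.body, ∀ v ∈ z', ∀ w ∈ z', Term.var v ∈ α.terms →
      Term.var w ∈ α.terms → p v → p w) : ∀ v ∈ z', p v := by
  -- Within one class the property travels along the equality atoms that generate the equivalence.
  -- All terms met on the way are variables of `z'`, because `z'` is a union of classes.
  have key : ∀ s t : Term I V, (eqv q.body).r s t → s.VarIn z' →
      ((∀ v, s = .var v → p v) ↔ ∀ v, t = .var v → p v) := by
    intro s t hst
    induction hst with
    | rel s t hr =>
      obtain ⟨v, rfl, hv⟩ := hr
      intro hvz
      obtain ⟨w, hw, rfl⟩ := h.closed (eqv_of_mem hv) hvz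
      rw [Term.varIn_var] at hvz
      constructor
      · rintro h1 _ ⟨⟩
        exact step _ hv v hvz w hw (by simp [Atom.terms]) (by simp [Atom.terms]) (h1 v rfl)
      · rintro h1 _ ⟨⟩
        exact step _ hv w hw v hvz (by simp [Atom.terms]) (by simp [Atom.terms]) (h1 w rfl)
    | refl => exact fun _ => Iff.rfl
    | symm s t hst ih => exact fun hs => (ih (h.closed (.symm _ _ hst) hs)).symm
    | trans s t u hst _ ih ih' => exact fun hs => (ih hs).trans (ih' (h.closed hst hs))
  have key' : ∀ v w, v ∈ z' → (eqv q.body).r (.var v) (.var w) → p v → p w := by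
    intro v w hv hvw hpv
    refine (key _ _ hvw (Term.varIn_var.2 hv)).1 ?_ w rfl
    rintro _ ⟨⟩
    exact hpv
  intro v hv
  have hr := h.2.2.2.1.2.preconnected ⟨Quotient.mk _ (.var v₀), v₀, hv₀, rfl⟩
    ⟨Quotient.mk _ (.var v), v, hv, rfl⟩
  rw [SimpleGraph.reachable_iff_reflTransGen] at hr
  suffices ∀ n : classes q.body z', Relation.ReflTransGen
      ((gaifman q.body).induce (classes q.body z')).Adj
      ⟨Quotient.mk _ (.var v₀), v₀, hv₀, rfl⟩ n →
      ∀ w ∈ z', n.1 = Quotient.mk _ (.var w) → p w from this _ hr v hv rfl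
  intro n hn
  induction hn with
  | refl => exact fun w hw hwv => key' v₀ w hv₀ (Quotient.exact hwv) hp
  | @tail m n _ hadj ih =>
    intro w hw hnw
    obtain ⟨α, hα, s, hs, t, ht, hms, hnt⟩ :=
      exists_mem_of_gaifman_adj (show (gaifman q.body).Adj m.1 n.1 from hadj)
    obtain ⟨v', hv', rfl⟩ := h.mk_mem_classes.1 (hms ▸ m.2)
    obtain ⟨w', hw', rfl⟩ := h.mk_mem_classes.1 (hnt ▸ n.2)
    exact key' w' w hw' (Quotient.exact (hnt.symm.trans hnw))
      (step α hα v' hv' w' hw' hs ht (ih v' hv' hms))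

theorem finite_classes (l : List (Atom I V C R)) (z : Finset V) : (classes l z).Finite := by
  refine ((Finset.finite_toSet z).image fun v => Quotient.mk (eqv l) (.var v)).subset ?_
  rintro _ ⟨v, hv, rfl⟩
  exact ⟨v, hv, rfl⟩

/-- There are finitely many classes, so the singleton of the class of `v` extends to a maximal
connected set. Equality-consistency makes the variables in it a union of full classes. -/
theorem EqConsistent.exists_maConnected (h : q.EqConsistent z) {v : V} (hv : v ∈ z) :
    ∃ z', q.MaConnected z z' ∧ v ∈ z' := by
  have hfin : {N : Set (Quotient (eqv q.body)) | N ⊆ classes q.body z ∧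
      ((gaifman q.body).induce N).Connected}.Finite :=
    ((finite_classes q.body z).finite_subsets).subset fun N hN => hN.1
  obtain ⟨N, hN, hmax⟩ := hfin.exists_le_maximal (a := {Quotient.mk _ (.var v)})
    ⟨by
      rintro _ rfl
      exact ⟨v, hv, rfl⟩,
     ⟨@SimpleGraph.Preconnected.of_subsingleton _ _
        (Set.subsingleton_coe _ |>.2 Set.subsingleton_singleton)⟩⟩
  have hvN : Quotient.mk _ (.var v) ∈ N := hN rfl
  have hcl : classes q.body (z.filter fun u => Quotient.mk _ (.var u) ∈ N) = N := by
    ext n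
    constructor
    · rintro ⟨u, hu, rfl⟩
      exact (Finset.mem_filter.1 hu).2
    · intro hn
      obtain ⟨u, hu, rfl⟩ := hmax.1.1 hn
      exact ⟨u, Finset.mem_filter.2 ⟨hu, hn⟩, rfl⟩
  refine ⟨z.filter fun u => Quotient.mk _ (.var u) ∈ N,
    ⟨⟨v, Finset.mem_filter.2 ⟨hv, hvN⟩⟩, Finset.filter_subset _ _, ?_, ?_⟩,
    Finset.mem_filter.2 ⟨hv, hvN⟩⟩
  · intro u hu t hut
    rw [Finset.mem_filter] at hu
    obtain ⟨w, hw, rfl⟩ := (h.varIn_iff hut).1 (Term.varIn_var.2 hu.1)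
    refine ⟨w, Finset.mem_filter.2 ⟨hw, ?_⟩, rfl⟩
    rw [← show Quotient.mk (eqv q.body) (.var u) = Quotient.mk _ (.var w) from Quotient.sound hut]
    exact hu.2
  · rw [hcl]
    exact hmax

/-- The union of two overlapping connected sets is connected, so maximality identifies them. Hence
the ma-connected subsets partition `z`. -/
theorem MaConnected.eq_of_mem {z₁ z₂ : Finset V} (h₁ : q.MaConnected z z₁)
    (h₂ : q.MaConnected z z₂) {v : V} (hv₁ : v ∈ z₁) (hv₂ : v ∈ z₂) : z₁ = z₂ := by
  have hconn := SimpleGraph.induce_union_connected h₁.2.2.2.1.2.preconnected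
    h₂.2.2.2.1.2.preconnected ⟨Quotient.mk _ (.var v), ⟨v, hv₁, rfl⟩, ⟨v, hv₂, rfl⟩⟩
  have hsub := Set.union_subset h₁.2.2.2.1.1 h₂.2.2.2.1.1
  have h12 := h₁.2.2.2.2 ⟨hsub, hconn⟩ Set.subset_union_left
  have h21 := h₂.2.2.2.2 ⟨hsub, hconn⟩ Set.subset_union_right
  ext u
  constructor
  · intro hu
    exact Term.varIn_var.1 (h₂.mk_mem_classes.1 (h21 (Set.mem_union_left _ ⟨u, hu, rfl⟩)))
  · intro hu
    exact Term.varIn_var.1 (h₁.mk_mem_classes.1 (h12 (Set.mem_union_right _ ⟨u, hu, rfl⟩)))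

theorem mem_maSets : z' ∈ q.maSets z ↔ q.MaConnected z z' := by
  rw [maSets, Finset.mem_filter, Finset.mem_powerset]
  exact ⟨fun h => h.2, fun h => ⟨h.2.1, h⟩⟩

theorem mem_sub {α : Atom I V C R} : α ∈ q.sub z' ↔ α ∈ q.body ∧ α.Mentions z' := by
  simp [sub]

theorem IsLink.mem_terms {t : Term I V} {α : Atom I V C R} (h : q.IsLink z z' t α) :
    t ∈ α.terms := by
  obtain ⟨-, -, P, v, -, rfl | rfl⟩ := h <;> simp [Atom.terms]

theorem mem_linkTerms {t : Term I V} : t ∈ q.linkTerms z z' ↔ ∃ α, q.IsLink z z' t α := by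
  simp only [linkTerms, Finset.mem_filter, Finset.mem_biUnion, List.mem_toFinset]
  exact ⟨fun h => h.2, fun ⟨α, h⟩ => ⟨⟨α, h.1, h.mem_terms⟩, α, h⟩⟩

theorem mem_linkVars {v : V} : v ∈ q.linkVars z z' ↔ Term.var v ∈ q.linkTerms z z' := by
  simp only [linkVars, Finset.mem_biUnion, Term.mem_vars]
  exact ⟨fun ⟨t, ht, h⟩ => h ▸ ht, fun h => ⟨_, h, rfl⟩⟩

/-- The terms of an atom that mentions a connected set are variables of the set or the atom is a
link. -/
theorem MaConnected.varIn_or_isLink (hz : q.EqConsistent z) (h : q.MaConnected z z')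
    {α : Atom I V C R} (hα : α ∈ q.body) (hm : α.Mentions z') {t : Term I V}
    (ht : t ∈ α.terms) : t.VarIn z' ∨ q.IsLink z z' t α := by
  by_cases htz : t.VarIn z
  · obtain ⟨s, hs, hsz⟩ := hm
    exact .inl (h.maximal_of_atom hα hs ht hsz htz)
  · by_cases htz' : t.VarIn z'
    · exact .inl htz'
    refine .inr ⟨mem_sub.2 ⟨hα, hm⟩, htz, ?_⟩
    obtain ⟨s, hs, v, hv, rfl⟩ := hm
    have hst : t ≠ .var v := by
      rintro rfl
      exact htz' (Term.varIn_var.2 hv)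
    cases α with
    | concept A u =>
      simp only [Atom.terms, Finset.mem_singleton] at hs ht
      exact absurd (ht.trans hs.symm) hst
    | role P t₁ t₂ =>
      simp only [Atom.terms, Finset.mem_insert, Finset.mem_singleton] at hs ht
      refine ⟨P, v, hv, ?_⟩
      rcases hs with rfl | rfl <;> rcases ht with rfl | rfl
      · exact absurd rfl hst
      · exact .inr rfl
      · exact .inl rfl
      · exact absurd rfl hst
    | eq u s =>
      have h1 := hz u s hα
      simp only [Atom.terms, Finset.mem_insert, Finset.mem_singleton] at hs ht
      have hvz : (Term.var v : Term I V).VarIn z := Term.varIn_var.2 (h.2.1 hv)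
      rw [← Term.varIn_var (I := I)] at h1
      rcases hs with hs | hs <;> rcases ht with rfl | rfl
      · exact absurd hs.symm hst
      · rw [hs] at hvz
        exact absurd (h1.1 hvz) htz
      · rw [hs] at hvz
        exact absurd (h1.2 hvz) htz
      · exact absurd hs.symm hst

/-- Without a link atom, `z'` would be closed under adjacency in the Gaifman graph. A path from `z'`
to an answer variable or an individual exists since `q` is rooted, and its end would then lie in
`z'`, which contains only variables of `y`. -/
theorem exists_isLink (hq : q.Rooted) (hzy : z ⊆ q.y) (hz : q.EqConsistent z)
    (h : q.MaConnected z z') : ∃ t α, q.IsLink z z' t α := by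
  by_contra hn
  push Not at hn
  obtain ⟨v, hv⟩ := h.1
  obtain ⟨t, hvt, α, hα, -, ht⟩ := q.safe v (Finset.mem_union_right _ (hzy (h.2.1 hv)))
  obtain ⟨s, hs, hreach⟩ := hq α hα t ht
  have htz : t.VarIn z' := h.closed hvt (Term.varIn_var.2 hv)
  have hsz : Quotient.mk _ s ∈ classes q.body z' := by
    rw [SimpleGraph.reachable_iff_reflTransGen] at hreach
    generalize Quotient.mk (eqv q.body) s = n at hreach
    induction hreach with
    | refl => exact h.mk_mem_classes.2 htz
    | @tail m n _ hadj ih =>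
      obtain ⟨α, hα, s, hs, t, ht, rfl, rfl⟩ := exists_mem_of_gaifman_adj hadj
      have hsz := h.mk_mem_classes.1 ih
      exact h.mk_mem_classes.2 ((h.varIn_or_isLink hz hα ⟨s, hs, hsz⟩ ht).resolve_right (hn _ _))
  rw [h.mk_mem_classes] at hsz
  obtain ⟨u, hu, rfl⟩ := hsz
  rcases hs with hs | ⟨a, ha⟩
  · exact Finset.disjoint_left.1 q.disjoint (Term.varIn_var.1 hs) (hzy (h.2.1 hu))
  · cases ha

/-! ### The atoms and variables of `φ_z` -/

theorem EqConsistent.mentions_iff (hz : q.EqConsistent z) {α : Atom I V C R} :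
    α.Mentions z ↔ ∃ z' ∈ q.maSets z, α.Mentions z' := by
  constructor
  · rintro ⟨t, ht, v, hv, rfl⟩
    obtain ⟨z', h, hv'⟩ := hz.exists_maConnected hv
    exact ⟨z', mem_maSets.2 h, _, ht, v, hv', rfl⟩
  · rintro ⟨z', h, t, ht, htz⟩
    exact ⟨t, ht, htz.mono (mem_maSets.1 h).2.1⟩

variable {ch : q.Choice}

theorem EqConsistent.mem_bodyZ (hz : q.EqConsistent z) {α : Atom I V C R} :
    α ∈ q.bodyZ ch z ↔ (α ∈ q.body ∧ ¬ α.Mentions z) ∨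
      ∃ z', q.MaConnected z z' ∧ (α = ch.link z z' ∨ α ∈ q.linkEqs z z') := by
  simp only [bodyZ, List.mem_append, List.mem_filter, List.mem_flatMap, Finset.mem_toList,
    List.mem_cons, decide_eq_true_eq, hz.mentions_iff, mem_maSets, not_exists, not_and]

theorem mem_linkEqs {α : Atom I V C R} : α ∈ q.linkEqs z z' ↔
    ∃ v t, Term.var v ∈ q.linkTerms z z' ∧ t ∈ q.linkTerms z z' ∧ α = .eq v t := by
  simp only [linkEqs, List.mem_flatMap, Finset.mem_toList, List.mem_map, mem_linkVars]
  constructor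
  · rintro ⟨v, hv, t, ht, rfl⟩
    exact ⟨v, t, hv, ht, rfl⟩
  · rintro ⟨v, t, hv, ht, rfl⟩
    exact ⟨v, hv, t, ht, rfl⟩

theorem link_spec' (hq : q.Rooted) (hzy : z ⊆ q.y) (hz : q.EqConsistent z)
    (h : q.MaConnected z z') : ∃ t, q.IsLink z z' t (ch.link z z') :=
  ch.link_spec z z' (exists_isLink hq hzy hz h)

theorem mem_vars_of_mem_linkTerms {v : V} (h : Term.var v ∈ q.linkTerms z z') :
    v ∈ q.x ∪ q.y ∧ v ∉ z := by
  obtain ⟨α, hα⟩ := mem_linkTerms.1 h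
  exact ⟨q.scope α (mem_sub.1 hα.1).1 v hα.mem_terms, fun hv => hα.2.1 (Term.varIn_var.2 hv)⟩

/-- Every variable outside `z` remains in the body of `q_z`. -/
theorem EqConsistent.exists_mem_bodyZ (hz : q.EqConsistent z) {v : V}
    (hv : v ∈ q.x ∪ q.y) (hvz : v ∉ z) : ∃ α ∈ q.bodyZ ch z, Term.var v ∈ α.terms := by
  have key : ∃ α ∈ q.body, Term.var v ∈ α.terms := by
    obtain ⟨t, hvt, α, hα, -, ht⟩ := q.safe v hv
    by_contra hn
    push Not at hn
    -- If no atom mentioned `v`, its class would be a singleton, and safety would put `v` itself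
    -- into an atom.
    have : ∀ s t : Term I V, (eqv q.body).r s t → (s = .var v ↔ t = .var v) := by
      intro s t hst
      induction hst with
      | rel s t hr =>
        obtain ⟨u, rfl, hu⟩ := hr
        have h1 := hn _ hu
        simp only [Atom.terms, Finset.mem_insert, Finset.mem_singleton, not_or] at h1
        exact ⟨fun h => absurd h.symm h1.1, fun h => absurd h.symm h1.2⟩
      | refl => rfl
      | symm s t _ ih => exact ih.symm
      | trans s t u _ _ ih ih' => exact ih.trans ih'
    exact hn α hα (((this _ _ hvt).1 rfl) ▸ ht)
  obtain ⟨α, hα, ht⟩ := key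
  by_cases hm : α.Mentions z
  · obtain ⟨z', hz', hm'⟩ := hz.mentions_iff.1 hm
    have h := mem_maSets.1 hz'
    rcases h.varIn_or_isLink hz hα hm' ht with h1 | h1
    · exact absurd (h.2.1 (Term.varIn_var.1 h1)) hvz
    · have h2 := mem_linkTerms.2 ⟨α, h1⟩
      -- The link equalities contain the trivial `v = v`, so a link variable survives even if its
      -- own link atom is not the chosen one.
      exact ⟨.eq v (.var v), hz.mem_bodyZ.2 (.inr ⟨z', h, .inr (mem_linkEqs.2 ⟨v, _, h2, h2, rfl⟩)⟩),
        by simp [Atom.terms]⟩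
  · exact ⟨α, hz.mem_bodyZ.2 (.inl ⟨hα, hm⟩), ht⟩

theorem EqConsistent.yZ_eq (hz : q.EqConsistent z) : q.yZ ch z = q.y \ z := by
  rw [yZ, Finset.filter_eq_self]
  intro v hv
  rw [Finset.mem_sdiff] at hv
  exact hz.exists_mem_bodyZ (Finset.mem_union_right _ hv.1) hv.2

theorem EqConsistent.x_union_yZ (hz : q.EqConsistent z) (hzy : z ⊆ q.y) {v : V} :
    v ∈ q.x ∪ q.yZ ch z ↔ v ∈ q.x ∪ q.y ∧ v ∉ z := by
  rw [hz.yZ_eq]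
  simp only [Finset.mem_union, Finset.mem_sdiff]
  constructor
  · rintro (h | h)
    · exact ⟨.inl h, fun hv => Finset.disjoint_left.1 q.disjoint h (hzy hv)⟩
    · exact ⟨.inr h.1, h.2⟩
  · rintro ⟨h | h, h'⟩
    · exact .inl h
    · exact .inr ⟨h, h'⟩

theorem exists_not_isEq (q : CQ I V C R) : ∃ α ∈ q.body, ¬ α.IsEq := by
  obtain ⟨α, hα⟩ := List.exists_mem_of_ne_nil _ q.body_ne
  cases α with
  | concept A t => exact ⟨_, hα, id⟩
  | role P t₁ t₂ => exact ⟨_, hα, id⟩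
  | eq v t =>
    obtain ⟨s, -, β, hβ, hne, -⟩ := q.safe v (q.scope _ hα v (by simp [Atom.terms]))
    exact ⟨β, hβ, hne⟩

theorem IsLink.not_isEq {t : Term I V} {α : Atom I V C R} (h : q.IsLink z z' t α) :
    ¬ α.IsEq := by
  obtain ⟨-, -, P, v, -, rfl | rfl⟩ := h <;> exact id

theorem IsLink.keptTerms {t : Term I V} {α : Atom I V C R} (h : q.IsLink z z' t α)
    (hz' : z' ⊆ z) : keptTerms z α = {t} := by
  obtain ⟨-, ht, P, v, hv, rfl | rfl⟩ := h
  · exact if_pos (Term.varIn_var.2 (hz' hv))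
  · exact (if_neg ht).trans (if_pos (Term.varIn_var.2 (hz' hv)))

theorem keptTerms_of_not_mentions {α : Atom I V C R} (h : ¬ α.Mentions z) (hα : ¬ α.IsEq) :
    keptTerms z α = α.terms := by
  cases α with
  | concept A t => rfl
  | role P t₁ t₂ =>
    rw [BagDL.keptTerms, if_neg fun h' => h ⟨t₂, by simp [Atom.terms], h'⟩,
      if_neg fun h' => h ⟨t₁, by simp [Atom.terms], h'⟩]
    rfl
  | eq v t => exact absurd trivial hα

theorem keptTerms_subset (α : Atom I V C R) : BagDL.keptTerms z α ⊆ α.terms := by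
  cases α with
  | concept A t => exact Finset.Subset.rfl
  | role P t₁ t₂ =>
    rw [BagDL.keptTerms]
    split_ifs <;> simp [Atom.terms]
  | eq v t => exact Finset.empty_subset _

/-- Equal terms outside `z` have the same value. -/
theorem val_eq_of_eqv (hz : q.EqConsistent z) {J : BagInterp I C R} {β : V → J.Dom}
    (hβ : ∀ v t, Atom.eq v t ∈ q.body → v ∉ z → β v = J.val β t) {s t : Term I V}
    (hst : (eqv q.body).r s t) (hs : ¬ s.VarIn z) : J.val β s = J.val β t := by
  induction hst with
  | rel s t hr =>
    obtain ⟨v, rfl, hv⟩ := hr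
    exact hβ v t hv fun h => hs (Term.varIn_var.2 h)
  | refl => rfl
  | symm s t hst ih => exact (ih fun h => hs ((hz.varIn_iff hst).1 h)).symm
  | trans s t u hst _ ih ih' =>
    exact (ih hs).trans (ih' fun h => hs ((hz.varIn_iff hst).2 h))

/-- All terms linked to a connected set have the same value in a model of the equalities. -/
theorem linkTerms_val_eq (hz : q.EqConsistent z) (h : q.MaConnected z z')
    (hc : ∀ c d, Term.ind c ∈ q.linkTerms z z' → Term.ind d ∈ q.linkTerms z z' → c = d)
    {J : BagInterp I C R} {β : V → J.Dom} (hβ : SatEqs J (q.bodyZ ch z) β) {s t : Term I V}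
    (hs : s ∈ q.linkTerms z z') (ht : t ∈ q.linkTerms z z') : J.val β s = J.val β t := by
  have key : ∀ v u, Term.var v ∈ q.linkTerms z z' → u ∈ q.linkTerms z z' → β v = J.val β u :=
    fun v u hv hu => hβ v u (hz.mem_bodyZ.2 (.inr ⟨z', h, .inr (mem_linkEqs.2 ⟨v, u, hv, hu, rfl⟩)⟩))
  cases s with
  | var v => exact key v t hs ht
  | ind c =>
    cases t with
    | var v => exact (key v _ ht hs).symm
    | ind d => rw [hc c d hs ht]

/-- By safety a variable outside `z` is equivalent to a term of a non-equality atom. If that atom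
was absorbed by a component, the term is a link term, and the link equalities tie it to the term
kept in the chosen link. -/
theorem exists_balg_psi [Infinite V] (hq : q.Rooted) (T : TBox C R) (hzy : z ⊆ q.y)
    (hz : q.EqConsistent z)
    (hc : ∀ z', q.MaConnected z z' → ∀ c d, Term.ind c ∈ q.linkTerms z z' →
      Term.ind d ∈ q.linkTerms z z' → c = d) :
    ∃ Q : Query I V C R, Q.IsBALG (q.x ∪ q.yZ ch z) ∧
      ∀ (J : BagInterp I C R) (β : V → J.Dom), Q.eval J β = (q.psi T ch z).eval J β := by
  simp only [eval_psi]
  have hlink : ∀ z', q.MaConnected z z' → ch.link z z' ∈ q.bodyZ ch z :=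
    fun z' h => hz.mem_bodyZ.2 (.inr ⟨z', h, .inl rfl⟩)
  apply exists_balg_body T ch z _ (q.bodyZ ch z)
  · obtain ⟨α, hα, hne⟩ := exists_not_isEq q
    by_cases hm : α.Mentions z
    · obtain ⟨z', hz', -⟩ := hz.mentions_iff.1 hm
      obtain ⟨t, ht⟩ := link_spec' (ch := ch) hq hzy hz (mem_maSets.1 hz')
      exact ⟨_, hlink z' (mem_maSets.1 hz'), ht.not_isEq⟩
    · exact ⟨α, hz.mem_bodyZ.2 (.inl ⟨hα, hm⟩), hne⟩
  · intro α hα v hv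
    rw [hz.x_union_yZ hzy]
    rcases hz.mem_bodyZ.1 hα with ⟨hα, hm⟩ | ⟨z', h, rfl | hα⟩
    · have hv' := keptTerms_subset α hv
      exact ⟨q.scope α hα v hv', fun h => hm ⟨_, hv', Term.varIn_var.2 h⟩⟩
    · obtain ⟨t, ht⟩ := link_spec' (ch := ch) hq hzy hz h
      rw [ht.keptTerms h.2.1, Finset.mem_singleton] at hv
      exact mem_vars_of_mem_linkTerms (mem_linkTerms.2 ⟨_, hv ▸ ht⟩)
    · obtain ⟨u, t, -, -, rfl⟩ := mem_linkEqs.1 hα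
      simp [BagDL.keptTerms] at hv
  · intro v t hα
    have : (v ∈ q.x ∪ q.yZ ch z) ∧ ∀ u, t = .var u → u ∈ q.x ∪ q.yZ ch z := by
      simp only [hz.x_union_yZ hzy]
      rcases hz.mem_bodyZ.1 hα with ⟨hα, hm⟩ | ⟨z', h, hα | hα⟩
      · refine ⟨⟨q.scope _ hα v (by simp [Atom.terms]), fun h => hm ⟨.var v, by simp [Atom.terms],
          Term.varIn_var.2 h⟩⟩, ?_⟩
        rintro u rfl
        exact ⟨q.scope _ hα u (by simp [Atom.terms]), fun h => hm ⟨.var u, by simp [Atom.terms],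
          Term.varIn_var.2 h⟩⟩
      · obtain ⟨t, ht⟩ := link_spec' (ch := ch) hq hzy hz h
        exact absurd (show (ch.link z z').IsEq from hα ▸ trivial) ht.not_isEq
      · obtain ⟨v', t', hv', ht', he⟩ := mem_linkEqs.1 hα
        cases he
        refine ⟨mem_vars_of_mem_linkTerms hv', ?_⟩
        rintro u rfl
        exact mem_vars_of_mem_linkTerms ht'
    exact ⟨this.1, fun u hu => this.2 u (Term.mem_vars.1 hu)⟩
  · intro v hv
    rw [hz.x_union_yZ hzy] at hv
    obtain ⟨t, hvt, α, hα, hne, ht⟩ := q.safe v hv.1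
    have hvz : ¬ (Term.var v : Term I V).VarIn z := fun h => hv.2 (Term.varIn_var.1 h)
    have htz : ¬ t.VarIn z := fun h => hvz ((hz.varIn_iff hvt).2 h)
    have hval : ∀ (J : BagInterp I C R) (β : V → J.Dom), SatEqs J (q.bodyZ ch z) β →
        β v = J.val β t := by
      intro J β hβ
      refine val_eq_of_eqv hz (fun u s hu huz => hβ u s (hz.mem_bodyZ.2 (.inl ⟨hu, ?_⟩))) hvt hvz
      rintro ⟨r, hr, hrz⟩
      simp only [Atom.terms, Finset.mem_insert, Finset.mem_singleton] at hr
      rcases hr with rfl | rfl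
      · exact huz (Term.varIn_var.1 hrz)
      · exact huz ((hz u r hu).2 hrz)
    by_cases hm : α.Mentions z
    · obtain ⟨z', hz', hm'⟩ := hz.mentions_iff.1 hm
      have h := mem_maSets.1 hz'
      rcases h.varIn_or_isLink hz hα hm' ht with h1 | h1
      · exact absurd (h1.mono h.2.1) htz
      · obtain ⟨t', ht'⟩ := link_spec' (ch := ch) hq hzy hz h
        refine ⟨_, hlink z' h, t', by rw [ht'.keptTerms h.2.1, Finset.mem_singleton],
          fun J β hβ => ?_⟩
        rw [hval J β hβ]
        exact linkTerms_val_eq hz h (hc z' h) hβ (mem_linkTerms.2 ⟨_, h1⟩)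
          (mem_linkTerms.2 ⟨_, ht'⟩)
    · exact ⟨α, hz.mem_bodyZ.2 (.inl ⟨hα, hm⟩), t,
        by rwa [keptTerms_of_not_mentions hm hne], hval⟩

end CQ

/-! ### Matches -/

theorem matchSum_ne_zero {J : BagInterp I C R} {s : Finset V} {φ : List (Atom I V C R)}
    {cond : (V → J.Dom) → Prop} (h : 1 ≤ matchSum J s φ cond) :
    ∃ β : V → J.Dom, cond β ∧ SatEqs J φ β ∧ ∀ α ∈ φ, J.mult β α ≠ 0 := by
  by_contra hn
  push Not at hn
  have h0 : matchSum J s φ cond = 0 := by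
    refine (tsum_congr fun μ => ?_).trans tsum_zero
    obtain ⟨α, hα, h0⟩ := hn (J.extend s μ.1) μ.2.1 μ.2.2
    exact List.prod_eq_zero (List.mem_map.2 ⟨α, hα, h0⟩)
  rw [h0] at h
  exact absurd h (by simp)

theorem one_le_matchSum {J : BagInterp I C R} {s : Finset V} {φ : List (Atom I V C R)}
    {cond : (V → J.Dom) → Prop} (μ : s → J.Dom) (h1 : cond (J.extend s μ))
    (h2 : SatEqs J φ (J.extend s μ)) (h3 : ∀ α ∈ φ, J.mult (J.extend s μ) α ≠ 0) :
    1 ≤ matchSum J s φ cond := by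
  refine le_trans ?_ ((enat_summable _).le_tsum ⟨μ, h1, h2⟩ fun _ _ => zero_le)
  rw [Order.one_le_iff_ne_zero]
  intro h
  rw [List.prod_eq_zero_iff] at h
  obtain ⟨α, hα, h0⟩ := List.mem_map.1 h
  exact h3 α hα h0

namespace CQ

variable [Nonempty I] {q : CQ I V C R} {T : TBox C R} {ch : q.Choice} {z z' : Finset V}

/-- A match of the test query sends every link term to `a`, and individuals are interpreted
injectively. -/
theorem RealisableMa.ind_eq (h : q.RealisableMa T ch z z') {c : I}
    (hc : Term.ind c ∈ q.linkTerms z z') : c = ch.a z z' := by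
  obtain ⟨β, ⟨hβ, -⟩, -⟩ := matchSum_ne_zero h
  exact (canonical T _).ind_injective (hβ _ hc)

/-- The rewriting is equivalent to a `BALG¹_ε`-query. -/
theorem exists_balg_rewriting [Infinite V] (hq : q.Rooted) (T : TBox C R) (ch : q.Choice) :
    ∃ Q : Query I V C R, Q.IsBALG q.x ∧ ∀ (J : BagInterp I C R) (β : V → J.Dom),
      Q.eval J β = (q.rewriting T ch).eval J β := by
  have key : ∀ z ∈ q.y.powerset.filter fun z => q.Realisable T ch z, ∃ Q : Query I V C R,
      Q.IsBALG (q.x ∪ q.yZ ch z) ∧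
      ∀ (J : BagInterp I C R) (β : V → J.Dom), Q.eval J β = (q.psi T ch z).eval J β := by
    intro z hz
    rw [Finset.mem_filter, Finset.mem_powerset] at hz
    refine exists_balg_psi hq T hz.1 hz.2.1 fun z' h c d hc hd => ?_
    exact ((hz.2.2 z' h).ind_eq hc).trans ((hz.2.2 z' h).ind_eq hd).symm
  have : Nonempty (Query I V C R) := ⟨.top⟩
  choose! f hf using key
  refine ⟨Query.addList ((q.y.powerset.filter fun z => q.Realisable T ch z).toList.map fun z =>
    .ex (q.yZ ch z) (f z)), IsBALG.addList ?_ ?_, fun J β => ?_⟩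
  -- The empty set is always realisable, so the arithmetic union is not the forbidden constant
  -- `bot`.
  · have h0 : q.Realisable T ch ∅ := by
      refine ⟨fun v t _ => ⟨fun h => absurd h (Finset.notMem_empty v), ?_⟩, fun z' h => ?_⟩
      · rintro ⟨v, hv, -⟩
        exact absurd hv (Finset.notMem_empty v)
      · obtain ⟨v, hv⟩ := h.1
        exact absurd (h.2.1 hv) (Finset.notMem_empty v)
    refine List.ne_nil_of_mem (List.mem_map.2 ⟨∅, ?_, rfl⟩)
    simp [h0]
  · intro g hg
    obtain ⟨z, hz, rfl⟩ := List.mem_map.1 hg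
    have hz' := Finset.mem_toList.1 hz
    refine .ex (hf z hz').1 ?_
    exact q.disjoint.mono_right fun v hv => (Finset.mem_sdiff.1 (Finset.mem_filter.1 hv).1).1
  · rw [eval_rewriting, eval_addList, List.map_map, Finset.sum_map_toList]
    refine Finset.sum_congr rfl fun z hz => ?_
    exact tsum_congr fun μ => (hf z hz).2 J _

/-- The choices in the construction of the rewriting can be made. -/
theorem nonempty_choice [Infinite I] [Infinite V] (q : CQ I V C R) : Nonempty q.Choice := by
  obtain ⟨α₀, -⟩ := List.exists_mem_of_ne_nil _ q.body_ne
  have hfin : {c : I | ∃ α ∈ q.body, Term.ind c ∈ α.terms}.Finite := by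
    have h1 : ({t | t ∈ q.body.toFinset.biUnion Atom.terms} : Set (Term I V)).Finite :=
      Finset.finite_toSet _
    refine (h1.preimage (f := Term.ind) fun a _ b _ h => by cases h; rfl).subset ?_
    rintro c ⟨α, hα, hc⟩
    exact Finset.mem_biUnion.2 ⟨α, List.mem_toFinset.2 hα, hc⟩
  have fresh : ∀ c : I, ∃ d, q.FreshInd d ∧ d ≠ c := by
    intro c
    obtain ⟨d, hd⟩ := (hfin.insert c).infinite_compl.nonempty
    simp only [Set.mem_compl_iff, Set.mem_insert_iff, not_or] at hd
    exact ⟨d, fun α hα h => hd.2 ⟨α, hα, h⟩, hd.1⟩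
  have hlink : ∀ z z', ∃ α, (∃ t α, q.IsLink z z' t α) → ∃ t, q.IsLink z z' t α := by
    intro z z'
    by_cases h : ∃ t α, q.IsLink z z' t α
    · obtain ⟨t, α, h⟩ := h
      exact ⟨α, fun _ => ⟨t, h⟩⟩
    · exact ⟨α₀, fun h' => absurd h' h⟩
  have ha : ∀ z z', ∃ a : I,
      ((∃ c : I, Term.ind c ∈ q.linkTerms z z') → Term.ind a ∈ q.linkTerms z z') ∧
      ((¬ ∃ c : I, Term.ind c ∈ q.linkTerms z z') → q.FreshInd a) := by
    intro z z'
    by_cases h : ∃ c : I, Term.ind c ∈ q.linkTerms z z'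
    · obtain ⟨c, hc⟩ := h
      exact ⟨c, fun _ => hc, fun h' => absurd ⟨c, hc⟩ h'⟩
    · obtain ⟨d, hd, -⟩ := fresh (Classical.arbitrary I)
      exact ⟨d, fun h' => absurd h' h, fun _ => hd⟩
  choose link hlink using hlink
  choose a ha using ha
  choose b hb using fun z z' => fresh (a z z')
  have hbound : ∀ t : Term I V, ∃ w : V, ∀ v, t = .var v → w ≠ v := by
    intro t
    cases t with
    | var v =>
      obtain ⟨w, hw⟩ := exists_ne v
      exact ⟨w, fun u hu => by cases hu; exact hw⟩
    | ind a => exact ⟨Classical.arbitrary V, fun v h => by cases h⟩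
  choose bound hbound using hbound
  exact ⟨⟨link, hlink, a, fun z z' => (ha z z').1, fun z z' => (ha z z').2, b,
    fun z z' => (hb z z').1, fun z z' => (hb z z').2, bound, fun v => hbound _ v rfl⟩⟩

end CQ

/-! ### Structure of the anonymous part -/

/-- The individual from which an element is generated. -/
def Elem.root : Elem I R → I
  | .ind a => a
  | .anon _ u _ => u.root

/-- The first anonymous element on the way from the root to an element. -/
def Elem.top : Elem I R → Elem I R
  | .ind a => .ind a
  | .anon j (.ind a) S => .anon j (.ind a) S
  | .anon _ (.anon k u S) _ => (Elem.anon k u S).top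

/-- The number of an anonymous element among its siblings. -/
def Elem.index : Elem I R → ℕ
  | .ind _ => 0
  | .anon j _ _ => j

theorem Elem.eq_ind_of_depth {u : Elem I R} (h : ¬ 0 < u.depth) : u = .ind u.root := by
  cases u with
  | ind a => rfl
  | anon j u S => exact absurd (Nat.succ_pos _) h

theorem Elem.top_anon {j : ℕ} {u : Elem I R} {S : Role R} (h : 0 < u.depth) :
    (Elem.anon j u S).top = u.top := by
  cases u with
  | ind a => exact absurd h (lt_irrefl 0)
  | anon k u S' => rfl

theorem fullRole_ne_zero_iff {A : ABox I C R} {S : Role R} {u v : Elem I R}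
    (h : 0 < u.depth ∨ 0 < v.depth) : fullRole A S u v ≠ 0 ↔
      (∃ j, v = .anon j u S) ∨ ∃ j, u = .anon j v S.inverse := by
  rw [fullRole_of_not_ind h]
  split_ifs with h' <;> simp [h']

/-- An edge between anonymous elements joins a parent and a child, which lie below the same first
anonymous element. -/
theorem top_eq_of_fullRole {A : ABox I C R} {S : Role R} {u v : Elem I R} (hu : 0 < u.depth)
    (hv : 0 < v.depth) (h : fullRole A S u v ≠ 0) : u.top = v.top := by
  rcases (fullRole_ne_zero_iff (.inl hu)).1 h with ⟨j, rfl⟩ | ⟨j, rfl⟩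
  · exact (Elem.top_anon hu).symm
  · exact Elem.top_anon hv

theorem eq_anon_of_fullRole {A : ABox I C R} {S : Role R} {c : I} {v : Elem I R}
    (hv : 0 < v.depth) (h : fullRole A S (.ind c) v ≠ 0) : v = .anon v.index (.ind c) S := by
  rcases (fullRole_ne_zero_iff (.inr hv)).1 h with ⟨j, rfl⟩ | ⟨j, h⟩
  · rfl
  · cases h

/-- An anonymous element has at most one neighbour in each role. -/
theorem eq_of_fullRole {T : TBox C R} {A : ABox I C R} {S : Role R} {u v v' : Elem I R}
    (hu : 0 < u.depth) (hv : Good T A v) (hv' : Good T A v') (h : fullRole A S u v ≠ 0)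
    (h' : fullRole A S u v' ≠ 0) : v = v' := by
  -- At an anonymous element `delta` is at most 1, so 1 is the only possible index of a child.
  have child : ∀ {j} (_ : Good T A (.anon j u S)), j = 1 := by
    intro j hj
    cases u with
    | ind a => exact absurd hu (lt_irrefl 0)
    | anon k p S' =>
      have h1 := hj.2.2.trans (delta_anon_le T A k p S' S)
      exact le_antisymm (by exact_mod_cast h1) hj.2.1
  -- If `S` leads back to the parent, then `∃ S` is already satisfied and no `S`-child is created.
  have parent : ∀ {j k w} (_ : Good T A (.anon j u S)), u ≠ .anon k w S.inverse := by
    rintro j k w hj rfl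
    have h1 := hj.2.2
    have h2 := delta_anon_inverse T A k w S.inverse
    rw [Role.inverse_inverse] at h2
    rw [h2] at h1
    have h3 : j = 0 := Nat.cast_eq_zero.1 (le_zero_iff.1 h1)
    have := hj.2.1
    omega
  rcases (fullRole_ne_zero_iff (.inl hu)).1 h with ⟨j, rfl⟩ | ⟨j, h1⟩ <;>
    rcases (fullRole_ne_zero_iff (.inl hu)).1 h' with ⟨k, rfl⟩ | ⟨k, h2⟩
  · rw [child hv, child hv']
  · exact absurd h2 (parent hv)
  · exact absurd h1 (parent hv')
  · rw [h1] at h2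
    cases h2
    rfl

/-! ### Comparison with the canonical model of a single role assertion -/

/-- The ABox that consists of a single assertion for a role. -/
def ABox.edge : Role R → I → I → ABox I C R
  | .atom P, a, b => Finsupp.single (.role P a b) 1
  | .inv P, a, b => Finsupp.single (.role P b a) 1

theorem ABox.edge_concept (S : Role R) (a b c : I) (B : C) :
    (ABox.edge S a b : ABox I C R) (.concept B c) = 0 := by
  cases S <;> simp [ABox.edge]

theorem ABox.edge_roleMult (S S' : Role R) (a b c d : I) :
    (ABox.edge S a b : ABox I C R).roleMult S' c d =
      if (S' = S ∧ c = a ∧ d = b) ∨ (S' = S.inverse ∧ c = b ∧ d = a) then 1 else 0 := by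
  cases S <;> cases S' <;>
    simp only [ABox.edge, ABox.roleMult, Finsupp.single_apply, Assertion.role.injEq,
      Role.atom.injEq, Role.inv.injEq, Role.inverse, reduceCtorEq, false_and, or_false, false_or,
      Nat.cast_ite, Nat.cast_one, Nat.cast_zero] <;>
    refine if_congr ?_ rfl rfl <;> constructor <;> (rintro ⟨rfl, rfl, rfl⟩; exact ⟨rfl, rfl, rfl⟩)

theorem base_edge_source {S : Role R} {a b : I} (hab : b ≠ a) (D : Concept C R) :
    base (ABox.edge S a b : ABox I C R) (.ind a) D = if D = .ex S then 1 else 0 := by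
  cases D with
  | atom B => simp [base, ABox.edge_concept]
  | ex S' =>
    simp only [base, ABox.edge_roleMult, hab.symm, false_and, and_false, or_false,
      true_and, Concept.ex.injEq]
    rw [tsum_eq_single b fun d hd => if_neg fun h => hd h.2]
    simp

theorem base_edge_target {S : Role R} {a b : I} (hab : b ≠ a) (D : Concept C R) :
    base (ABox.edge S a b : ABox I C R) (.ind b) D = if D = .ex S.inverse then 1 else 0 := by
  cases D with
  | atom B => simp [base, ABox.edge_concept]
  | ex S' =>
    simp only [base, ABox.edge_roleMult, hab, false_and, and_false, false_or,
      true_and, Concept.ex.injEq]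
    rw [tsum_eq_single a fun d hd => if_neg fun h => hd h.2]
    simp

/-- The map that sends the elements generated from `b` to those generated from the `j`-th
`S`-successor of `c`, and all other elements to elements generated from `c`. -/
def graft (b : I) (j : ℕ) (c : I) (S : Role R) : Elem I R → Elem I R
  | .ind e => if e = b then .anon j (.ind c) S else .ind c
  | .anon k u S' => .anon k (graft b j c S u) S'

theorem graft_self (b : I) (j : ℕ) (c : I) (S : Role R) :
    graft b j c S (.ind b) = .anon j (.ind c) S := if_pos rfl

theorem graft_other {a b : I} (hab : b ≠ a) (j : ℕ) (c : I) (S : Role R) :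
    graft b j c S (.ind a) = .ind c := if_neg hab.symm

theorem graft_depth {b : I} {j : ℕ} {c : I} {S : Role R} {e : Elem I R} (h : e.root = b) :
    0 < (graft b j c S e).depth := by
  cases e with
  | ind x =>
    obtain rfl : x = b := h
    rw [graft_self]
    exact Nat.succ_pos _
  | anon k u S' => exact Nat.succ_pos _

theorem graft_ne_ind {b : I} {j : ℕ} {c : I} {S : Role R} {e : Elem I R} (h : e.root = b)
    (x : I) : graft b j c S e ≠ .ind x := fun he => by
  have := graft_depth (j := j) (c := c) (S := S) h
  rw [he] at this
  exact absurd this (lt_irrefl 0)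

/-- Retracing the branch down to its first anonymous element and putting `b` in the place of that
element gives a preimage. -/
theorem exists_graft {b : I} {j : ℕ} {c : I} {S : Role R} {e : Elem I R}
    (h : e.top = .anon j (.ind c) S) : ∃ e', e'.root = b ∧ graft b j c S e' = e := by
  induction e with
  | ind x => cases h
  | anon k u S' ih =>
    cases u with
    | ind x => exact ⟨.ind b, rfl, (graft_self ..).trans h.symm⟩
    | anon l v S'' =>
      obtain ⟨e', h1, h2⟩ := ih h
      exact ⟨.anon k e' S', h1, by rw [graft, h2]⟩

theorem graft_injective_of_root {b : I} {j : ℕ} {c : I} {S : Role R} {e e' : Elem I R}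
    (h : e.root = b) (h' : e'.root = b) (he : graft b j c S e = graft b j c S e') : e = e' := by
  induction e generalizing e' with
  | ind x =>
    obtain rfl : x = b := h
    cases e' with
    | ind y =>
      obtain rfl : y = x := h'
      rfl
    | anon k u S' =>
      rw [graft_self, graft] at he
      injection he with h1 h2 h3
      exact absurd h2.symm (graft_ne_ind (e := u) h' _)
  | anon k u S' ih =>
    cases e' with
    | ind y =>
      obtain rfl : y = b := h'
      rw [graft_self, graft] at he
      injection he with h1 h2 h3
      exact absurd h2 (graft_ne_ind (e := u) h _)
    | anon l v S'' =>
      rw [graft, graft] at he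
      injection he with h1 h2 h3
      have hv : v.root = b := h'
      obtain rfl : u = v := ih h hv h2
      rw [h1, h3]

theorem graft_injective {a b : I} (hab : b ≠ a) {j : ℕ} {c : I} {S : Role R} {e e' : Elem I R}
    (h : e.root = b ∨ e = .ind a) (h' : e'.root = b ∨ e' = .ind a)
    (he : graft b j c S e = graft b j c S e') : e = e' := by
  rcases h with h | rfl
  · rcases h' with h' | rfl
    · exact graft_injective_of_root h h' he
    · rw [graft_other hab] at he
      exact absurd he (graft_ne_ind h _)
  · rcases h' with h' | rfl
    · rw [graft_other hab] at he
      exact absurd he.symm (graft_ne_ind h' _)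
    · rfl

/-- At its creation an anonymous element knows only the role that leads to it. The individual `b` of
the assertion `S(a, b)` has the same initial extensions as an `S`-successor, namely a single `∃ S⁻`.
Hence closures, numbers of children and the generated trees agree as well. -/
theorem graft_base {a b : I} (hab : b ≠ a) {A : ABox I C R} {j : ℕ} {c : I} {S : Role R}
    {e : Elem I R} (h : e.root = b) (D : Concept C R) :
    base A (graft b j c S e) D = base (ABox.edge S a b) e D := by
  cases e with
  | ind x =>
    obtain rfl : x = b := h
    rw [graft_self, base_edge_target hab, base]
  | anon k u S' => rfl

theorem graft_cl {a b : I} (hab : b ≠ a) {T : TBox C R} {A : ABox I C R} {j : ℕ} {c : I}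
    {S : Role R} {e : Elem I R} (h : e.root = b) (D : Concept C R) :
    cl T A (graft b j c S e) D = cl T (ABox.edge S a b) e D := by
  simp only [cl, graft_base hab h]

theorem graft_delta {a b : I} (hab : b ≠ a) {T : TBox C R} {A : ABox I C R} {j : ℕ} {c : I}
    {S : Role R} {e : Elem I R} (h : e.root = b) (S' : Role R) :
    delta T A (graft b j c S e) S' = delta T (ABox.edge S a b) e S' := by
  simp only [delta, graft_base hab h, graft_cl hab h]

theorem graft_good {a b : I} (hab : b ≠ a) {T : TBox C R} {A : ABox I C R} {j : ℕ} {c : I}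
    {S : Role R} (hj : Good T A (.anon j (.ind c) S)) {e : Elem I R} (h : e.root = b) :
    Good T A (graft b j c S e) ↔ Good T (ABox.edge S a b) e := by
  induction e with
  | ind x =>
    obtain rfl : x = b := h
    rw [graft_self]
    exact iff_of_true hj trivial
  | anon k u S' ih =>
    rw [graft, Good, Good, ih h, graft_delta hab (e := u) h]

/-- Where an anonymous element is involved, `graft` preserves the parent-child relation and, being
injective, reflects it. Otherwise only the assertion between `a` and `b` matters, and it becomes the
edge from `c` to its successor. The pair `(a, a)` must be excluded: its image `(c, c)` may have any
multiplicity in `A`. -/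
theorem graft_fullRole {a b : I} (hab : b ≠ a) {A : ABox I C R} {j : ℕ} {c : I} {S : Role R}
    {e e' : Elem I R} (h : e.root = b ∨ e = .ind a) (h' : e'.root = b ∨ e' = .ind a)
    (hr : e.root = b ∨ e'.root = b) (S' : Role R) :
    fullRole A S' (graft b j c S e) (graft b j c S e') =
      fullRole (ABox.edge S a b : ABox I C R) S' e e' := by
  have hp : 0 < (graft b j c S e).depth ∨ 0 < (graft b j c S e').depth :=
    hr.imp graft_depth graft_depth
  rw [fullRole_of_not_ind hp]
  by_cases hd : 0 < e.depth ∨ 0 < e'.depth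
  · rw [fullRole_of_not_ind hd]
    have key : ∀ {e e' : Elem I R} {S' : Role R}, (e.root = b ∨ e = .ind a) →
        (e'.root = b ∨ e' = .ind a) → 0 < e.depth ∨ 0 < e'.depth →
        ((∃ k, graft b j c S e' = .anon k (graft b j c S e) S') ↔ ∃ k, e' = .anon k e S') := by
      intro e e' S' h h' hd
      constructor
      · rintro ⟨k, hk⟩
        cases e' with
        | ind y =>
          exfalso
          rcases h' with h' | h'
          · obtain rfl : y = b := h'
            rw [graft_self] at hk
            injection hk with h1 h2 h3
            cases e with
            | ind x => rcases hd with hd | hd <;> exact absurd hd (lt_irrefl 0)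
            | anon l v S'' => cases h2
          · rw [h', graft_other hab] at hk
            cases hk
        | anon l v S'' =>
          rw [graft] at hk
          injection hk with h1 h2 h3
          have hv : v.root = b := h'.resolve_right (by simp)
          exact ⟨l, by rw [graft_injective hab (.inl hv) h h2, h3]⟩
      · rintro ⟨k, rfl⟩
        exact ⟨k, rfl⟩
    rw [key h h' hd, key h' h hd.symm]
  · rw [not_or] at hd
    obtain ⟨x, rfl⟩ : ∃ x, e = .ind x := ⟨_, Elem.eq_ind_of_depth hd.1⟩
    obtain ⟨y, rfl⟩ : ∃ y, e' = .ind y := ⟨_, Elem.eq_ind_of_depth hd.2⟩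
    rw [fullRole_ind, ABox.edge_roleMult]
    simp only [Elem.root, Elem.ind.injEq] at h h' hr
    refine if_congr ?_ rfl rfl
    rcases h with rfl | rfl
    · rcases h' with rfl | rfl
      · simp [graft_self, hab]
      · simp only [graft_self, graft_other hab]
        simp only [hab, Elem.anon.injEq, reduceCtorEq, exists_false, false_or, true_and,
          false_and, and_false, and_true, exists_eq_left']
        rw [eq_comm, Role.inverse_eq_iff]
    · obtain rfl : y = b := hr.resolve_left hab.symm
      simp only [graft_self, graft_other hab]
      simp [hab.symm, eq_comm]

/-- The part generated from `b` is attached to the rest of the test model only through `a`, so a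
connected match that avoids `a` cannot leave it. -/
theorem root_of_fullRole_edge {a b : I} (hab : b ≠ a) {S S' : Role R} {e e' : Elem I R}
    (h : fullRole (ABox.edge S a b : ABox I C R) S' e e' ≠ 0) (he : e.root = b)
    (he' : e' ≠ .ind a) : e'.root = b := by
  by_cases hd : 0 < e.depth ∨ 0 < e'.depth
  · rcases (fullRole_ne_zero_iff hd).1 h with ⟨j, rfl⟩ | ⟨j, rfl⟩
    · exact he
    · exact he
  · rw [not_or] at hd
    rw [Elem.eq_ind_of_depth hd.1, Elem.eq_ind_of_depth hd.2, fullRole_ind, ABox.edge_roleMult, he]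
      at h
    have h1 : e'.root = a := by
      by_contra hn
      simp [hn, hab] at h
    exact absurd ((Elem.eq_ind_of_depth hd.2).trans (by rw [h1])) he'

/-- The assertion already gives `a` the multiplicity 1 in `∃ S`, and no subsumed concept has a
larger one. So `a` has no anonymous `S`-successor. -/
theorem eq_of_fullRole_edge {a b : I} (hab : b ≠ a) {T : TBox C R} {S : Role R} {e : Elem I R}
    (h : fullRole (ABox.edge S a b : ABox I C R) S (.ind a) e ≠ 0)
    (hg : Good T (ABox.edge S a b) e) (he : e ≠ .ind a) : e = .ind b := by
  by_cases hd : 0 < e.depth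
  · rw [eq_anon_of_fullRole hd h] at hg
    have h1 : delta T (ABox.edge S a b) (.ind a) S = 0 := by
      refine tsub_eq_zero_of_le (cl_le fun D _ => ?_)
      rw [base_edge_source hab, base_edge_source hab, if_pos rfl]
      split_ifs <;> simp
    have h2 := hg.2.2
    rw [h1] at h2
    have h3 : e.index = 0 := Nat.cast_eq_zero.1 (le_zero_iff.1 h2)
    have := hg.2.1
    omega
  · have h1 := Elem.eq_ind_of_depth hd
    rw [h1, fullRole_ind, ABox.edge_roleMult] at h
    rw [h1] at he ⊢
    by_contra hn
    have h2 : e.root ≠ a := fun h => he (by rw [h])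
    have h3 : e.root ≠ b := fun h => hn (by rw [h])
    simp [h2, h3] at h

/-! ### Atoms over elements -/

/-- The value of a term under an assignment of elements. -/
def termVal (β : V → Elem I R) : Term I V → Elem I R
  | .var v => β v
  | .ind a => .ind a

/-- The multiplicity of an atom in the canonical model. -/
def rawMult (T : TBox C R) (A : ABox I C R) (β : V → Elem I R) : Atom I V C R → ℕ∞
  | .concept B t => cl T A (termVal β t) (.atom B)
  | .role P t₁ t₂ => fullRole A (.atom P) (termVal β t₁) (termVal β t₂)
  | .eq _ _ => 1

/-- An atom holds in the canonical model. -/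
def HoldsAt (T : TBox C R) (A : ABox I C R) (β : V → Elem I R) : Atom I V C R → Prop
  | .concept B t => cl T A (termVal β t) (.atom B) ≠ 0
  | .role P t₁ t₂ => fullRole A (.atom P) (termVal β t₁) (termVal β t₂) ≠ 0
  | .eq v t => β v = termVal β t

theorem termVal_congr {β γ : V → Elem I R} {t : Term I V} (h : ∀ v, t = .var v → β v = γ v) :
    termVal β t = termVal γ t := by
  cases t with
  | var v => exact h v rfl
  | ind a => rfl

theorem rawMult_congr {T : TBox C R} {A : ABox I C R} {β γ : V → Elem I R} {α : Atom I V C R}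
    (h : ∀ t ∈ α.terms, termVal β t = termVal γ t) : rawMult T A β α = rawMult T A γ α := by
  cases α with
  | concept B t => rw [rawMult, rawMult, h t (by simp [Atom.terms])]
  | role P t₁ t₂ => rw [rawMult, rawMult, h t₁ (by simp [Atom.terms]), h t₂ (by simp [Atom.terms])]
  | eq v t => rfl

theorem holdsAt_congr {T : TBox C R} {A : ABox I C R} {β γ : V → Elem I R} {α : Atom I V C R}
    (h : ∀ t ∈ α.terms, termVal β t = termVal γ t) : HoldsAt T A β α ↔ HoldsAt T A γ α := by
  cases α with
  | concept B t => rw [HoldsAt, HoldsAt, h t (by simp [Atom.terms])]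
  | role P t₁ t₂ => rw [HoldsAt, HoldsAt, h t₁ (by simp [Atom.terms]), h t₂ (by simp [Atom.terms])]
  | eq v t =>
    rw [HoldsAt, HoldsAt, h t (by simp [Atom.terms]),
      show β v = γ v from h (.var v) (by simp [Atom.terms])]

theorem HoldsAt.rawMult_ne_zero {T : TBox C R} {A : ABox I C R} {β : V → Elem I R}
    {α : Atom I V C R} (h : HoldsAt T A β α) : rawMult T A β α ≠ 0 := by
  cases α with
  | concept B t => exact h
  | role P t₁ t₂ => exact h
  | eq v t => exact one_ne_zero

/-- The role atom `S(s, t)`. -/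
def Atom.ofRole : Role R → Term I V → Term I V → Atom I V C R
  | .atom P, s, t => .role P s t
  | .inv P, s, t => .role P t s

theorem holdsAt_ofRole {T : TBox C R} {A : ABox I C R} {β : V → Elem I R} {S : Role R}
    {s t : Term I V} : HoldsAt T A β (.ofRole S s t : Atom I V C R) ↔
      fullRole A S (termVal β s) (termVal β t) ≠ 0 := by
  cases S with
  | atom P => rfl
  | inv P => exact not_congr (by rw [← fullRole_swap]; rfl)

/-- Atoms hold in the canonical model of a role assertion iff they hold after grafting. -/
theorem holdsAt_graft {a b : I} (hab : b ≠ a) {T : TBox C R} {A : ABox I C R} {j : ℕ} {c : I}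
    {S : Role R} {β β' : V → Elem I R} {α : Atom I V C R}
    (h1 : ∀ t ∈ α.terms, (termVal β' t).root = b ∨ termVal β' t = .ind a)
    (h2 : ∀ t ∈ α.terms, termVal β t = graft b j c S (termVal β' t))
    (h3 : ∃ t ∈ α.terms, (termVal β' t).root = b) :
    HoldsAt T A β α ↔ HoldsAt T (ABox.edge S a b) β' α := by
  cases α with
  | concept B t =>
    obtain ⟨s, hs, h3⟩ := h3
    obtain rfl := Finset.mem_singleton.1 hs
    rw [HoldsAt, HoldsAt, h2 s hs, graft_cl hab h3]
  | role P t₁ t₂ =>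
    rw [HoldsAt, HoldsAt, h2 t₁ (by simp [Atom.terms]), h2 t₂ (by simp [Atom.terms]),
      graft_fullRole hab (h1 t₁ (by simp [Atom.terms])) (h1 t₂ (by simp [Atom.terms]))]
    obtain ⟨s, hs, h3⟩ := h3
    simp only [Atom.terms, Finset.mem_insert, Finset.mem_singleton] at hs
    rcases hs with rfl | rfl
    · exact .inl h3
    · exact .inr h3
  | eq v t =>
    have hv : Term.var v ∈ (Atom.eq v t : Atom I V C R).terms := by simp [Atom.terms]
    have ht : t ∈ (Atom.eq v t : Atom I V C R).terms := by simp [Atom.terms]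
    have h4 := h2 _ hv
    rw [HoldsAt, HoldsAt, h2 t ht, show β v = _ from h4]
    exact ⟨fun h => graft_injective hab (h1 _ hv) (h1 _ ht) h,
      fun h => congrArg _ h⟩

/-! ### Matches of connected sets in the anonymous part -/

theorem canonical_val [Nonempty I] {T : TBox C R} {A : ABox I C R}
    (β : V → (canonical T A).Dom) (t : Term I V) :
    ((canonical T A).val β t).1 = termVal (fun v => (β v).1) t := by
  cases t <;> rfl

theorem canonical_mult [Nonempty I] {T : TBox C R} {A : ABox I C R}
    (β : V → (canonical T A).Dom) (α : Atom I V C R) :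
    (canonical T A).mult β α = rawMult T A (fun v => (β v).1) α := by
  cases α with
  | concept B t => rw [BagInterp.mult, canonical_concept, canonical_val, rawMult]
  | role P t₁ t₂ => rw [BagInterp.mult, canonical_role, canonical_val, canonical_val, rawMult]
  | eq v t => rfl

/-- Passes from valuations in the canonical model to assignments of bare elements, on which `graft`
acts, and lets equalities and other atoms be treated alike. -/
theorem satEqs_and_mult_iff [Nonempty I] {T : TBox C R} {A : ABox I C R}
    (β : V → (canonical T A).Dom) (l : List (Atom I V C R)) :
    (SatEqs (canonical T A) l β ∧ ∀ α ∈ l, (canonical T A).mult β α ≠ 0) ↔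
      ∀ α ∈ l, HoldsAt T A (fun v => (β v).1) α := by
  simp only [canonical_mult]
  constructor
  · rintro ⟨h1, h2⟩ α hα
    have h3 := h2 α hα
    cases α with
    | concept B t => exact h3
    | role P t₁ t₂ => exact h3
    | eq v t =>
      rw [HoldsAt, h1 v t hα, canonical_val]
  · intro h
    refine ⟨fun v t ht => Subtype.ext ?_, fun α hα => (h α hα).rawMult_ne_zero⟩
    rw [canonical_val]
    exact h _ ht

/-- Supplies the cases in the inductions over a connected set. Reading role atoms through
`Atom.ofRole` makes their orientation irrelevant. -/
theorem atom_cases {α : Atom I V C R} {v w : V} (hv : Term.var v ∈ α.terms)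
    (hw : Term.var w ∈ α.terms) : v = w ∨ (∃ S, α = .ofRole S (.var v) (.var w)) ∨
      α = .eq v (.var w) ∨ α = .eq w (.var v) := by
  cases α with
  | concept B t =>
    simp only [Atom.terms, Finset.mem_singleton] at hv hw
    rw [← hv] at hw
    cases hw
    exact .inl rfl
  | role P t₁ t₂ =>
    simp only [Atom.terms, Finset.mem_insert, Finset.mem_singleton] at hv hw
    rcases hv with rfl | rfl <;> rcases hw with hw | hw
    · cases hw
      exact .inl rfl
    · exact .inr (.inl ⟨.atom P, by rw [Atom.ofRole, hw]⟩)
    · exact .inr (.inl ⟨.inv P, by rw [Atom.ofRole, hw]⟩)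
    · cases hw
      exact .inl rfl
  | eq u t =>
    simp only [Atom.terms, Finset.mem_insert, Finset.mem_singleton] at hv hw
    rcases hv with hv | rfl <;> rcases hw with hw | hw
    · cases hv
      cases hw
      exact .inl rfl
    · cases hv
      exact .inr (.inr (.inl (by rw [hw])))
    · cases hw
      exact .inr (.inr (.inr rfl))
    · cases hw
      exact .inl rfl

namespace CQ

variable {q : CQ I V C R} {ch : q.Choice} {z z' : Finset V}

theorem IsLink.exists_ofRole {t : Term I V} {α : Atom I V C R} (h : q.IsLink z z' t α) :
    ∃ S, ∃ v ∈ z', α = .ofRole S t (.var v) := by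
  obtain ⟨-, -, P, v, hv, rfl | rfl⟩ := h
  · exact ⟨.atom P, v, hv, rfl⟩
  · exact ⟨.inv P, v, hv, rfl⟩

/-- The chosen link of `z'` is the atom `S(t, v)`. -/
structure LinkAt (q : CQ I V C R) (ch : q.Choice) (z z' : Finset V) (S : Role R)
    (t : Term I V) (v : V) : Prop where
  mem : v ∈ z'
  isLink : q.IsLink z z' t (ch.link z z')
  eq : ch.link z z' = .ofRole S t (.var v)

theorem exists_linkAt (hq : q.Rooted) (hzy : z ⊆ q.y) (hz : q.EqConsistent z)
    (h : q.MaConnected z z') : ∃ S t v, q.LinkAt ch z z' S t v := by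
  obtain ⟨t, ht⟩ := link_spec' (ch := ch) hq hzy hz h
  obtain ⟨S, v, hv, he⟩ := ht.exists_ofRole
  exact ⟨S, t, v, hv, ht, he⟩

variable {S : Role R} {t₀ : Term I V} {v₀ : V}

theorem LinkAt.testABox (L : q.LinkAt ch z z' S t₀ v₀) (h : q.MaConnected z z') :
    q.testABox ch z z' = ABox.edge S (ch.a z z') (ch.b z z') := by
  rw [CQ.testABox, L.eq]
  cases S with
  | atom P => exact if_pos (Term.varIn_var.2 L.mem)
  | inv P => exact if_neg fun h' => L.isLink.2.1 (h'.mono h.2.1)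

theorem LinkAt.mem_linkTerms (L : q.LinkAt ch z z' S t₀ v₀) : t₀ ∈ q.linkTerms z z' :=
  CQ.mem_linkTerms.2 ⟨_, L.isLink⟩

variable {T : TBox C R} {A : ABox I C R}

theorem MaConnected.mem_sub_of_mem {α : Atom I V C R} (hα : α ∈ q.body) {v : V} (hv : v ∈ z')
    (h : Term.var v ∈ α.terms) : α ∈ q.sub z' :=
  mem_sub.2 ⟨hα, _, h, Term.varIn_var.2 hv⟩

/-- A connected set of variables is mapped to the elements generated from one anonymous
successor of an individual. -/
theorem LinkAt.branch (L : q.LinkAt ch z z' S t₀ v₀) (h : q.MaConnected z z')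
    {β : V → Elem I R} (hanon : ∀ v ∈ z', 0 < (β v).depth)
    (hind : ∀ t ∈ q.linkTerms z z', ¬ 0 < (termVal β t).depth)
    (hold : ∀ α ∈ q.sub z', HoldsAt T A β α) :
    (∀ v ∈ z', (β v).top = β v₀) ∧
    β v₀ = .anon (β v₀).index (termVal β t₀) S ∧
    ∀ t ∈ q.linkTerms z z', termVal β t = termVal β t₀ := by
  -- A link term denotes an individual, and a role edge from an individual to an anonymous element
  -- leads to one of its children.
  have hlink : ∀ {S t v}, t ∈ q.linkTerms z z' → v ∈ z' →
      (Atom.ofRole S t (.var v) : Atom I V C R) ∈ q.sub z' →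
      β v = .anon (β v).index (termVal β t) S := by
    intro S t v ht hv hα
    have h1 := holdsAt_ofRole.1 (hold _ hα)
    have h2 := Elem.eq_ind_of_depth (hind t ht)
    rw [h2] at h1 ⊢
    exact eq_anon_of_fullRole (hanon v hv) h1
  have h0 := hlink L.mem_linkTerms L.mem (L.eq ▸ L.isLink.1)
  have htop : ∀ {v t S}, t ∈ q.linkTerms z z' → β v = .anon (β v).index (termVal β t) S →
      (β v).top = β v := by
    intro v t S ht hv
    rw [Elem.eq_ind_of_depth (hind t ht)] at hv
    rw [hv]
    rfl
  -- Role edges between anonymous elements and equalities both preserve the first anonymous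
  -- ancestor, so it is constant on the connected set.
  have h1 : ∀ v ∈ z', (β v).top = β v₀ := by
    refine h.induction _ L.mem (htop L.mem_linkTerms h0) fun α hα v hv w hw hvα hwα hp => ?_
    have hsub := MaConnected.mem_sub_of_mem hα hv hvα
    have hh := hold α hsub
    rcases atom_cases hvα hwα with rfl | ⟨S', rfl⟩ | rfl | rfl
    · exact hp
    · rw [← hp]
      exact (top_eq_of_fullRole (hanon v hv) (hanon w hw) (holdsAt_ofRole.1 hh)).symm
    · rwa [show β w = β v from Eq.symm hh]
    · rwa [show β w = β v from hh]
  refine ⟨h1, h0, fun t ht => ?_⟩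
  obtain ⟨α, hα⟩ := CQ.mem_linkTerms.1 ht
  obtain ⟨S', v, hv, rfl⟩ := hα.exists_ofRole
  have h2 := hlink ht hv hα.1
  have h3 := h1 v hv
  -- Linked variables are their own tops, and all tops coincide; so the two link terms are parents
  -- of the same element.
  rw [htop ht h2, h2, h0] at h3
  injection h3

/-- A match of a connected set is determined by the value of the linked variable. -/
theorem LinkAt.match_unique (L : q.LinkAt ch z z' S t₀ v₀) (h : q.MaConnected z z')
    {β β' : V → Elem I R} (hanon : ∀ v ∈ z', 0 < (β v).depth)
    (hgood : ∀ v ∈ z', Good T A (β v)) (hgood' : ∀ v ∈ z', Good T A (β' v))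
    (hold : ∀ α ∈ q.sub z', HoldsAt T A β α) (hold' : ∀ α ∈ q.sub z', HoldsAt T A β' α)
    (h0 : β v₀ = β' v₀) : ∀ v ∈ z', β v = β' v := by
  refine h.induction _ L.mem h0 fun α hα v hv w hw hvα hwα hp => ?_
  have hsub := MaConnected.mem_sub_of_mem hα hv hvα
  have hh := hold α hsub
  have hh' := hold' α hsub
  rcases atom_cases hvα hwα with rfl | ⟨S', rfl⟩ | rfl | rfl
  · exact hp
  · have h1 := holdsAt_ofRole.1 hh
    have h2 := holdsAt_ofRole.1 hh'
    rw [show termVal β' (.var v) = termVal β (.var v) from hp.symm] at h2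
    exact eq_of_fullRole (hanon v hv) (hgood w hw) (hgood' w hw) h1 h2
  · rw [← show β v = β w from hh, hp]
    exact hh'
  · rw [show β w = β v from hh, hp]
    exact Eq.symm hh'

theorem MaConnected.terms_sub (hz : q.EqConsistent z) (h : q.MaConnected z z')
    {α : Atom I V C R} (hα : α ∈ q.sub z') {t : Term I V} (ht : t ∈ α.terms) :
    t.VarIn z' ∨ t ∈ q.linkTerms z z' := by
  rw [mem_sub] at hα
  exact (h.varIn_or_isLink hz hα.1 hα.2 ht).imp_right fun h => CQ.mem_linkTerms.2 ⟨α, h⟩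

/-- Connected sets of variables with a match in the anonymous part are realisable. -/
theorem LinkAt.realisableMa [Nonempty I] (L : q.LinkAt ch z z' S t₀ v₀)
    (hz : q.EqConsistent z) (h : q.MaConnected z z')
    {β : V → Elem I R} (hanon : ∀ v ∈ z', 0 < (β v).depth)
    (hgood : ∀ v ∈ z', Good T A (β v))
    (hind : ∀ t ∈ q.linkTerms z z', ¬ 0 < (termVal β t).depth)
    (hold : ∀ α ∈ q.sub z', HoldsAt T A β α) : q.RealisableMa T ch z z' := by
  obtain ⟨h1, h2, h3⟩ := L.branch h hanon hind hold
  obtain ⟨c, hc⟩ : ∃ c, termVal β t₀ = .ind c := ⟨_, Elem.eq_ind_of_depth (hind _ L.mem_linkTerms)⟩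
  rw [hc] at h2 h3
  set j := (β v₀).index
  have hb := ch.b_ne z z'
  rw [RealisableMa, L.testABox h]
  set a := ch.a z z'
  set b := ch.b z z'
  -- The whole component lies below the value of `v₀`, so its match can be pulled back along `graft`
  -- to the tree of `b`.
  have hex : ∀ v, ∃ e : Elem I R, v ∈ z' → e.root = b ∧ graft b j c S e = β v := by
    intro v
    by_cases hv : v ∈ z'
    · obtain ⟨e, he⟩ := exists_graft (b := b) ((h1 v hv).trans h2)
      exact ⟨e, fun _ => he⟩
    · exact ⟨.ind b, fun h => absurd h hv⟩
  choose e he using hex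
  let β' : V → Elem I R := fun v => if v ∈ z' then e v else .ind a
  have hβ' : ∀ v ∈ z', β' v = e v := fun v hv => if_pos hv
  have hgood' : ∀ v, Good T (ABox.edge S a b) (β' v) := by
    intro v
    by_cases hv : v ∈ z'
    · rw [hβ' v hv, ← graft_good hb (h2 ▸ hgood v₀ L.mem) (he v hv).1, (he v hv).2]
      exact hgood v hv
    · rw [show β' v = .ind a from if_neg hv]
      trivial
  have hlink : ∀ t ∈ q.linkTerms z z', termVal β' t = .ind a := by
    intro t ht
    cases t with
    | var v => exact if_neg fun hv => (mem_vars_of_mem_linkTerms ht).2 (h.2.1 hv)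
    | ind d =>
      have h4 := h3 _ ht
      -- As soon as some individual is a link term, `a` was chosen among the link terms; all of them
      -- denote `c`, so `d` and `a` coincide.
      have h5 := h3 _ (ch.a_mem z z' ⟨d, ht⟩)
      exact h4.trans h5.symm
  have hold' : ∀ α ∈ q.sub z', HoldsAt T (ABox.edge S a b) β' α := by
    intro α hα
    have hvar : ∀ t : Term I V, t.VarIn z' → (termVal β' t).root = b ∧
        termVal β t = graft b j c S (termVal β' t) := by
      rintro _ ⟨v, hv, rfl⟩
      simp only [termVal, hβ' v hv]
      exact ⟨(he v hv).1, (he v hv).2.symm⟩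
    refine (holdsAt_graft (j := j) (c := c) hb (fun t ht => ?_) (fun t ht => ?_) ?_).1 (hold α hα)
    · exact (h.terms_sub hz hα ht).imp (fun h => (hvar t h).1) (hlink t)
    · rcases h.terms_sub hz hα ht with h4 | h4
      · exact (hvar t h4).2
      · rw [h3 t h4, hlink t h4, graft_other hb]
    · obtain ⟨t, ht, htz⟩ := (mem_sub.1 hα).2
      exact ⟨t, ht, (hvar t htz).1⟩
  let μ : (q.linkVars z z' ∪ z' : Finset V) → (canonical T (ABox.edge S a b)).Dom :=
    fun v => ⟨β' v, (exists_mem_stage_iff _ _ _).2 (hgood' v)⟩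
  have hμ : ∀ v ∈ q.linkVars z z' ∪ z',
      ((canonical T (ABox.edge S a b)).extend (q.linkVars z z' ∪ z') μ v).1 = β' v := by
    intro v hv
    rw [BagInterp.extend, override_of_mem hv]
  have hold'' : ∀ α ∈ q.sub z', HoldsAt T (ABox.edge S a b) (fun v =>
      ((canonical T (ABox.edge S a b)).extend (q.linkVars z z' ∪ z') μ v).1) α := by
    intro α hα
    refine (holdsAt_congr fun t ht => termVal_congr ?_).2 (hold' α hα)
    rintro v rfl
    refine hμ v (Finset.mem_union.2 ?_)
    rcases h.terms_sub hz hα ht with h4 | h4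
    · exact .inr (Term.varIn_var.1 h4)
    · exact .inl (mem_linkVars.2 h4)
  rw [← satEqs_and_mult_iff] at hold''
  refine one_le_matchSum μ ⟨fun t ht => Subtype.ext ?_, fun v hv heq => ?_⟩ hold''.1 hold''.2
  · rw [canonical_val, termVal_congr (γ := β'), hlink t ht]
    · rfl
    · rintro v rfl
      exact hμ v (Finset.mem_union_left _ (mem_linkVars.2 ht))
  · have h4 := congrArg Subtype.val heq
    rw [hμ v (Finset.mem_union_right _ hv), hβ' v hv] at h4
    have h5 := (he v hv).1
    rw [h4] at h5
    exact hb h5.symm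

/-- Realisable connected sets of variables have a match below each anonymous successor of the
right kind. -/
theorem LinkAt.exists_match [Nonempty I] (L : q.LinkAt ch z z' S t₀ v₀)
    (hz : q.EqConsistent z) (h : q.MaConnected z z') (hr : q.RealisableMa T ch z z')
    {j : ℕ} {c : I} (hj : Good T A (.anon j (.ind c) S)) {γ : V → Elem I R}
    (hγ : ∀ t ∈ q.linkTerms z z', termVal γ t = .ind c) :
    ∃ β : V → Elem I R, β v₀ = .anon j (.ind c) S ∧
      (∀ v ∈ z', Good T A (β v) ∧ 0 < (β v).depth) ∧ (∀ v ∉ z', β v = γ v) ∧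
      ∀ α ∈ q.sub z', HoldsAt T A β α := by
  have hb := ch.b_ne z z'
  rw [RealisableMa, L.testABox h] at hr
  set a := ch.a z z'
  set b := ch.b z z'
  obtain ⟨β', ⟨hlink, hne⟩, hsat, hmult⟩ := matchSum_ne_zero hr
  have hold := (satEqs_and_mult_iff β' (q.sub z')).1 ⟨hsat, hmult⟩
  have hgood' : ∀ v, Good T (ABox.edge S a b) (β' v).1 :=
    fun v => (exists_mem_stage_iff _ _ _).1 (β' v).2
  have hlink' : ∀ t ∈ q.linkTerms z z', termVal (fun v => (β' v).1) t = .ind a := by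
    intro t ht
    rw [← canonical_val, hlink t ht]
    rfl
  have hne' : ∀ v ∈ z', (β' v).1 ≠ .ind a := fun v hv h => hne v hv (Subtype.ext h)
  set δ : V → Elem I R := fun v => (β' v).1 with hδ
  -- The linked variable is an `S`-neighbour of `a` other than `a` itself, and `b` is the only one.
  have hv₀ : δ v₀ = .ind b := by
    have h1 := holdsAt_ofRole.1 (hold _ (L.eq ▸ L.isLink.1))
    rw [hlink' _ L.mem_linkTerms] at h1
    exact eq_of_fullRole_edge hb h1 (hgood' v₀) (hne' v₀ L.mem)
  -- The conditions `v ≠ a` of the test query keep the match inside the part generated from `b`.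
  have hroot : ∀ v ∈ z', (δ v).root = b := by
    refine h.induction _ L.mem (by rw [hv₀]; rfl) fun α hα v hv w hw hvα hwα hp => ?_
    have hh := hold α (MaConnected.mem_sub_of_mem hα hv hvα)
    rcases atom_cases hvα hwα with rfl | ⟨S', rfl⟩ | rfl | rfl
    · exact hp
    · exact root_of_fullRole_edge hb (holdsAt_ofRole.1 hh) hp (hne' w hw)
    · rwa [show δ w = δ v from Eq.symm hh]
    · rwa [show δ w = δ v from hh]
  -- The match is transported below the given successor; outside `z'` the prescribed values are
  -- kept.
  let β : V → Elem I R := fun v => if v ∈ z' then graft b j c S (δ v) else γ v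
  have hβ : ∀ v ∈ z', β v = graft b j c S (δ v) := fun v hv => if_pos hv
  have hβγ : ∀ v ∉ z', β v = γ v := fun v hv => if_neg hv
  refine ⟨β, ?_, fun v hv => ?_, hβγ, fun α hα => ?_⟩
  · rw [hβ v₀ L.mem, hv₀, graft_self]
  · rw [hβ v hv]
    exact ⟨(graft_good hb hj (hroot v hv)).2 (hgood' v), graft_depth (hroot v hv)⟩
  · have hvar : ∀ t : Term I V, t.VarIn z' → (termVal δ t).root = b ∧
        termVal β t = graft b j c S (termVal δ t) := by
      rintro _ ⟨v, hv, rfl⟩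
      exact ⟨hroot v hv, hβ v hv⟩
    refine (holdsAt_graft (j := j) (c := c) hb (fun t ht => ?_) (fun t ht => ?_) ?_).2 (hold α hα)
    · exact (h.terms_sub hz hα ht).imp (fun h => (hvar t h).1) (hlink' t)
    · rcases h.terms_sub hz hα ht with h4 | h4
      · exact (hvar t h4).2
      · rw [hlink' t h4, graft_other hb, ← hγ t h4]
        refine termVal_congr ?_
        rintro v rfl
        exact hβγ v fun hv => (mem_vars_of_mem_linkTerms h4).2 (h.2.1 hv)
    · obtain ⟨t, ht, htz⟩ := (mem_sub.1 hα).2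
      exact ⟨t, ht, (hvar t htz).1⟩

end CQ

theorem enat_card_pi {ι : Type} [Fintype ι] (X : ι → Type) :
    ENat.card (∀ i, X i) = ∏ i, ENat.card (X i) := by
  simp only [ENat.card, Cardinal.mk_pi, Cardinal.prod_eq_of_fintype]
  rw [Cardinal.lift_id, map_prod]

namespace CQ

variable {q : CQ I V C R} {ch : q.Choice} {z z' : Finset V} {T : TBox C R} {A : ABox I C R}

/-! ### The number of matches of a realisable set of variables -/

/-- The matches of the atoms that mention `z` that map the variables in `z` to anonymous elements
and the other variables according to `γ`. -/
def Solution (q : CQ I V C R) (T : TBox C R) (A : ABox I C R) (z : Finset V)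
    (γ : V → Elem I R) : Type :=
  {θ : z → Elem I R // (∀ v, Good T A (θ v) ∧ 0 < (θ v).depth) ∧
    ∀ α ∈ q.body, α.Mentions z → HoldsAt T A (override z θ γ) α}

/-- All terms linked to a connected subset of `z` have the same value. -/
def LinkTermsAgree (q : CQ I V C R) (z : Finset V) (γ : V → Elem I R) : Prop :=
  ∀ z', q.MaConnected z z' → ∀ s ∈ q.linkTerms z z', ∀ t ∈ q.linkTerms z z',
    termVal γ s = termVal γ t

theorem termVal_override {θ : z → Elem I R} {γ : V → Elem I R} {t : Term I V}
    (ht : ¬ t.VarIn z) : termVal (override z θ γ) t = termVal γ t := by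
  refine termVal_congr ?_
  rintro v rfl
  exact override_of_notMem fun h => ht (Term.varIn_var.2 h)

theorem not_varIn_of_mem_linkTerms {t : Term I V} (ht : t ∈ q.linkTerms z z') : ¬ t.VarIn z := by
  obtain ⟨α, hα⟩ := CQ.mem_linkTerms.1 ht
  exact hα.2.1

theorem depth_linkTerm {γ : V → Elem I R}
    (hγ : ∀ v ∈ q.x ∪ q.y, v ∉ z → ¬ 0 < (γ v).depth) {t : Term I V}
    (ht : t ∈ q.linkTerms z z') : ¬ 0 < (termVal γ t).depth := by
  cases t with
  | var v => exact hγ v (mem_vars_of_mem_linkTerms ht).1 (mem_vars_of_mem_linkTerms ht).2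
  | ind c => exact lt_irrefl 0

theorem Solution.holds_sub {γ : V → Elem I R} (θ : q.Solution T A z γ) (h : q.MaConnected z z') :
    ∀ α ∈ q.sub z', HoldsAt T A (override z θ.1 γ) α := by
  intro α hα
  obtain ⟨hα, t, ht, htz⟩ := mem_sub.1 hα
  exact θ.2.2 α hα ⟨t, ht, htz.mono h.2.1⟩

theorem Solution.good {γ : V → Elem I R} (θ : q.Solution T A z γ) {v : V} (hv : v ∈ z) :
    Good T A (override z θ.1 γ v) := by
  rw [override_of_mem hv]
  exact (θ.2.1 _).1

theorem Solution.anon {γ : V → Elem I R} (θ : q.Solution T A z γ) {v : V} (hv : v ∈ z) :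
    0 < (override z θ.1 γ v).depth := by
  rw [override_of_mem hv]
  exact (θ.2.1 _).2

theorem Solution.branch {γ : V → Elem I R} (θ : q.Solution T A z γ)
    (hγ : ∀ v ∈ q.x ∪ q.y, v ∉ z → ¬ 0 < (γ v).depth) (h : q.MaConnected z z')
    {S : Role R} {t₀ : Term I V} {v₀ : V} (L : q.LinkAt ch z z' S t₀ v₀) :
    override z θ.1 γ v₀ = .anon (override z θ.1 γ v₀).index (termVal γ t₀) S ∧
    ∀ t ∈ q.linkTerms z z', termVal γ t = termVal γ t₀ := by
  have key := L.branch h (fun v hv => θ.anon (h.2.1 hv)) (fun t ht => by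
    rw [termVal_override (not_varIn_of_mem_linkTerms ht)]
    exact depth_linkTerm hγ ht) (θ.holds_sub h)
  have h0 : termVal (override z θ.1 γ) t₀ = termVal γ t₀ :=
    termVal_override (not_varIn_of_mem_linkTerms L.mem_linkTerms)
  rw [h0] at key
  refine ⟨key.2.1, fun t ht => ?_⟩
  rw [← key.2.2 t ht, termVal_override (not_varIn_of_mem_linkTerms ht)]

/-- A solution amounts to an independent choice, for each component, of the child under which it is
placed. The child determines the placement by `LinkAt.match_unique`, and every child is possible by
realisability and `LinkAt.exists_match`. If the terms linked to some component disagree,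
`Solution.branch` rules out all solutions. -/
theorem card_solution [Nonempty I] (hr : q.Realisable T ch z)
    {γ : V → Elem I R} (hγ : ∀ v ∈ q.x ∪ q.y, v ∉ z → ¬ 0 < (γ v).depth)
    {S : ∀ z', q.MaConnected z z' → Role R} {t₀ : ∀ z', q.MaConnected z z' → Term I V}
    {v₀ : ∀ z', q.MaConnected z z' → V}
    (L : ∀ z' h, q.LinkAt ch z z' (S z' h) (t₀ z' h) (v₀ z' h)) :
    ENat.card (q.Solution T A z γ) = if q.LinkTermsAgree z γ then
      ∏ i : q.maSets z, delta T A (termVal γ (t₀ i.1 (mem_maSets.1 i.2)))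
        (S i.1 (mem_maSets.1 i.2)) else 0 := by
  split_ifs with hagree
  -- A solution is recorded by the index of the child reached by each chosen link; the parent and
  -- the role of that child are already fixed.
  · let F : q.Solution T A z γ → ∀ i : q.maSets z,
        {j : ℕ // 1 ≤ j ∧ (j : ℕ∞) ≤ delta T A (termVal γ (t₀ i.1 (mem_maSets.1 i.2)))
          (S i.1 (mem_maSets.1 i.2))} :=
      fun θ i => ⟨(override z θ.1 γ (v₀ i.1 (mem_maSets.1 i.2))).index, by
        have hi := mem_maSets.1 i.2
        have h1 := θ.good (hi.2.1 (L _ hi).mem)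
        rw [(θ.branch hγ hi (L _ hi)).1] at h1
        exact h1.2⟩
    have hF : Function.Bijective F := by
      constructor
      · intro θ θ' hFF
        refine Subtype.ext (funext fun u => ?_)
        obtain ⟨z', h, hu⟩ := hr.1.exists_maConnected u.2
        have h1 : (override z θ.1 γ (v₀ z' h)).index = (override z θ'.1 γ (v₀ z' h)).index :=
          congrArg Subtype.val (congrFun hFF ⟨z', mem_maSets.2 h⟩)
        have h2 : override z θ.1 γ (v₀ z' h) = override z θ'.1 γ (v₀ z' h) := by
          rw [(θ.branch hγ h (L _ h)).1, (θ'.branch hγ h (L _ h)).1, h1]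
        have h3 := (L _ h).match_unique h (fun v hv => θ.anon (h.2.1 hv))
          (fun v hv => θ.good (h.2.1 hv)) (fun v hv => θ'.good (h.2.1 hv))
          (θ.holds_sub h) (θ'.holds_sub h) h2 u.1 hu
        rwa [override_of_mem u.2, override_of_mem u.2] at h3
      · intro j
        have hex : ∀ i : q.maSets z, ∃ β : V → Elem I R,
            β (v₀ i.1 (mem_maSets.1 i.2)) = .anon (j i).1 (termVal γ (t₀ i.1 (mem_maSets.1 i.2)))
              (S i.1 (mem_maSets.1 i.2)) ∧
            (∀ v ∈ i.1, Good T A (β v) ∧ 0 < (β v).depth) ∧ (∀ v ∉ i.1, β v = γ v) ∧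
            ∀ α ∈ q.sub i.1, HoldsAt T A β α := by
          intro i
          have hi := mem_maSets.1 i.2
          obtain ⟨c, hc⟩ : ∃ c, termVal γ (t₀ i.1 hi) = .ind c :=
            ⟨_, Elem.eq_ind_of_depth (depth_linkTerm hγ (L _ hi).mem_linkTerms)⟩
          generalize j i = k
          obtain ⟨k, hk⟩ := k
          dsimp only
          rw [hc] at hk ⊢
          have key : ∀ t ∈ q.linkTerms z i.1, termVal γ t = .ind c := fun t ht => by
            rw [← hc]
            exact hagree _ hi _ ht _ (L _ hi).mem_linkTerms
          obtain ⟨β, h1, h2⟩ := (L _ hi).exists_match hr.1 hi (hr.2 _ hi)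
            (A := A) (j := k) ⟨trivial, hk⟩ key
          exact ⟨β, h1, h2⟩
        choose β hβ₀ hβ hβγ hβh using hex
        -- The matches of the components are glued, each variable being placed by its own component.
        -- They do not interfere, because an atom that mentions a component contains only variables
        -- of it and link terms.
        choose comp hcomp hmem using fun u : z => hr.1.exists_maConnected u.2
        let θ : z → Elem I R := fun u => β ⟨comp u, mem_maSets.2 (hcomp u)⟩ u.1
        have hθ : ∀ (i : q.maSets z) (u : V), u ∈ i.1 → override z θ γ u = β i u := by
          intro i u hu
          have hi := mem_maSets.1 i.2
          have huz := hi.2.1 hu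
          rw [override_of_mem huz]
          have : (⟨comp ⟨u, huz⟩, mem_maSets.2 (hcomp ⟨u, huz⟩)⟩ : q.maSets z) = i :=
            Subtype.ext ((hcomp ⟨u, huz⟩).eq_of_mem hi (hmem ⟨u, huz⟩) hu)
          change β ⟨comp ⟨u, huz⟩, _⟩ u = _
          rw [this]
        refine ⟨⟨θ, fun u => hβ _ u.1 (hmem u), fun α hα hm => ?_⟩, funext fun i => Subtype.ext ?_⟩
        · obtain ⟨z', hz', hm'⟩ := hr.1.mentions_iff.1 hm
          have hsub : α ∈ q.sub z' := mem_sub.2 ⟨hα, hm'⟩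
          have h := mem_maSets.1 hz'
          refine (holdsAt_congr fun t ht => ?_).2 (hβh ⟨z', hz'⟩ α hsub)
          rcases h.terms_sub hr.1 hsub ht with ⟨v, hv, rfl⟩ | htl
          · exact hθ ⟨z', hz'⟩ v hv
          · have hn := not_varIn_of_mem_linkTerms htl
            rw [termVal_override hn]
            refine termVal_congr ?_
            rintro v rfl
            exact (hβγ ⟨z', hz'⟩ v fun hv => hn (Term.varIn_var.2 (h.2.1 hv))).symm
        · have hi := mem_maSets.1 i.2
          change (override z θ γ (v₀ i.1 (mem_maSets.1 i.2))).index = _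
          rw [hθ i _ (L _ hi).mem, hβ₀]
          rfl
    rw [ENat.card_congr (Equiv.ofBijective F hF), enat_card_pi]
    simp only [enat_card_Icc]
  · rw [ENat.card_eq_zero_iff_empty]
    refine ⟨fun θ => hagree fun z' h s hs t ht => ?_⟩
    have h1 := (θ.branch hγ h (L _ h)).2
    rw [h1 s hs, h1 t ht]

/-- Every multiplicity that involves an anonymous element is 0 or 1, so these atoms restrict the
valuations without weighting them. -/
theorem rawMult_of_mentions {β : V → Elem I R} (hβ : ∀ v ∈ z, 0 < (β v).depth)
    {α : Atom I V C R} (hm : α.Mentions z) (h : HoldsAt T A β α) : rawMult T A β α = 1 := by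
  refine le_antisymm ?_ (Order.one_le_iff_ne_zero.2 h.rawMult_ne_zero)
  obtain ⟨t, ht, v, hv, rfl⟩ := hm
  have hd := hβ v hv
  cases α with
  | concept B t =>
    obtain rfl := Finset.mem_singleton.1 ht
    rw [rawMult, termVal]
    cases hc : β v with
    | ind a =>
      rw [hc] at hd
      exact absurd hd (lt_irrefl 0)
    | anon j u S => exact cl_anon_le ..
  | role P t₁ t₂ =>
    simp only [Atom.terms, Finset.mem_insert, Finset.mem_singleton] at ht
    rcases ht with rfl | rfl
    · exact fullRole_le_one (.inl hd)
    · exact fullRole_le_one (.inr hd)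
  | eq v t => exact le_rfl

end CQ

/-! ### The rewriting over the ABox -/

section Empty

variable [Nonempty I] {A : ABox I C R}

theorem canonical_roleExt (T : TBox C R) (S : Role R) (u v : (canonical T A).Dom) :
    (canonical T A).roleExt S u v = fullRole A S u.1 v.1 := by
  cases S with
  | atom P => exact canonical_role ..
  | inv P => exact (canonical_role ..).trans (fullRole_swap A (.atom P) _ _).symm

theorem canonical_empty_eq_ind (u : (canonical (∅ : TBox C R) A).Dom) :
    ∃ a, u.1 = .ind a := good_empty ((exists_mem_stage_iff ∅ A u.1).1 u.2)

/-- Over the empty TBox the domain consists of the individuals only, so the sum over all neighbours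
is the sum over the ABox assertions. -/
theorem canonical_empty_ext (D : Concept C R) (u : (canonical (∅ : TBox C R) A).Dom) :
    (canonical (∅ : TBox C R) A).ext D u = base A u.1 D := by
  cases D with
  | atom B => exact (canonical_concept ..).trans (cl_empty ..)
  | ex S =>
    obtain ⟨a, ha⟩ := canonical_empty_eq_ind u
    have he : Function.Bijective (canonical (∅ : TBox C R) A).ind := by
      refine ⟨(canonical (∅ : TBox C R) A).ind_injective, fun v => ?_⟩
      obtain ⟨b, hb⟩ := canonical_empty_eq_ind v
      exact ⟨b, Subtype.ext hb.symm⟩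
    rw [ha, BagInterp.ext, ← (Equiv.ofBijective _ he).tsum_eq]
    refine tsum_congr fun b => ?_
    rw [canonical_roleExt, ha]
    rfl

theorem canonical_empty_maxExt (T : TBox C R) (E : Concept C R)
    (u : (canonical (∅ : TBox C R) A).Dom) :
    (canonical (∅ : TBox C R) A).maxExt T E u = cl T A u.1 E := by
  simp only [BagInterp.maxExt, canonical_empty_ext, cl]

theorem replMult_canonical_of_not_mentions {T : TBox C R} {z : Finset V}
    (γ : V → (canonical (∅ : TBox C R) A).Dom) {α : Atom I V C R} (h : ¬ α.Mentions z) :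
    replMult (canonical ∅ A) T z γ α = rawMult T A (fun v => (γ v).1) α := by
  cases α with
  | concept B t => rw [replMult, canonical_empty_maxExt, canonical_val, rawMult]
  | role P t₁ t₂ =>
    rw [replMult, if_neg fun h' => h ⟨t₂, by simp [Atom.terms], h'⟩,
      if_neg fun h' => h ⟨t₁, by simp [Atom.terms], h'⟩, canonical_role, canonical_val,
      canonical_val, rawMult]
  | eq v t => rfl

/-- Over the ABox the max union evaluates to `cl` with respect to `T`, and the subtracted formula to
`base`. The difference is the number of anonymous successors in the canonical model over `T`. -/
theorem replMult_canonical_ofRole {T : TBox C R} {z : Finset V}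
    (γ : V → (canonical (∅ : TBox C R) A).Dom) {S : Role R} {t : Term I V} {v : V}
    (ht : ¬ t.VarIn z) (hv : v ∈ z) :
    replMult (canonical ∅ A) T z γ (.ofRole S t (.var v) : Atom I V C R) =
      delta T A (termVal (fun v => (γ v).1) t) S := by
  have hv' := Term.varIn_var (I := I).2 hv
  cases S <;>
    simp only [Atom.ofRole, replMult, if_pos hv', if_neg ht, canonical_empty_maxExt,
      canonical_empty_ext, canonical_val, delta]

end Empty

theorem prod_map_flatMap {ι κ : Type*} (l : List ι) (f : ι → List κ) (g : κ → ℕ∞) :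
    ((l.flatMap f).map g).prod = (l.map fun i => ((f i).map g).prod).prod := by
  induction l with
  | nil => rfl
  | cons i l ih => simp [ih]

theorem prod_map_filter_mul {ι : Type*} (l : List ι) (p : ι → Prop) (g : ι → ℕ∞) :
    ((l.filter fun i => ¬ p i).map g).prod * ((l.filter fun i => p i).map g).prod =
      (l.map g).prod := by
  induction l with
  | nil => rfl
  | cons i l ih =>
    by_cases h : p i
    · simp only [List.filter_cons, h, not_true_eq_false, decide_true, decide_false, if_true,
        List.map_cons, List.prod_cons, ← ih, Bool.false_eq_true, if_false]
      ring
    · simp only [List.filter_cons, h, not_false_eq_true, decide_true, decide_false, if_true,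
        List.map_cons, List.prod_cons, ← ih, Bool.false_eq_true, if_false]
      ring

namespace CQ

variable [Nonempty I] {q : CQ I V C R} {ch : q.Choice} {z z' : Finset V} {T : TBox C R}
  {A : ABox I C R}

/-- The equalities between terms outside `z` hold. -/
def EqsOutside (q : CQ I V C R) (z : Finset V) (γ : V → Elem I R) : Prop :=
  ∀ v t, Atom.eq v t ∈ q.body → v ∉ z → γ v = termVal γ t

/-- By equality-consistency an equality of `φ` has both sides in `z` or both outside. Link
equalities start from a variable and so never compare two individuals; realisability supplies this
missing case. -/
theorem satEqs_bodyZ_iff (hq : q.Rooted) (hzy : z ⊆ q.y) (hr : q.Realisable T ch z)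
    {T' : TBox C R} (γ : V → (canonical T' A).Dom) :
    SatEqs (canonical T' A) (q.bodyZ ch z) γ ↔
      q.EqsOutside z (fun v => (γ v).1) ∧ q.LinkTermsAgree z (fun v => (γ v).1) := by
  constructor
  · refine fun h => ⟨fun v t hvt hv => ?_, fun z' hz' s hs t ht => ?_⟩
    · rw [← canonical_val]
      refine congrArg Subtype.val (h v t (hr.1.mem_bodyZ.2 (.inl ⟨hvt, ?_⟩)))
      rintro ⟨s, hs, hsz⟩
      simp only [Atom.terms, Finset.mem_insert, Finset.mem_singleton] at hs
      rcases hs with rfl | rfl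
      · exact hv (Term.varIn_var.1 hsz)
      · exact hv ((hr.1 v s hvt).2 hsz)
    · rw [← canonical_val, ← canonical_val]
      exact congrArg Subtype.val (linkTerms_val_eq hr.1 hz' (fun c d hc hd =>
        ((hr.2 z' hz').ind_eq hc).trans ((hr.2 z' hz').ind_eq hd).symm) h hs ht)
  · rintro ⟨h1, h2⟩ v t hvt
    refine Subtype.ext ?_
    rw [canonical_val]
    rcases hr.1.mem_bodyZ.1 hvt with ⟨hvt, hm⟩ | ⟨z', hz', he | he⟩
    · exact h1 v t hvt fun hv => hm ⟨_, by simp [Atom.terms], Term.varIn_var.2 hv⟩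
    · obtain ⟨s, hs⟩ := link_spec' (ch := ch) hq hzy hr.1 hz'
      exact absurd (show (ch.link z z').IsEq from he ▸ trivial) hs.not_isEq
    · obtain ⟨v', t', hv', ht', h⟩ := mem_linkEqs.1 he
      cases h
      exact h2 z' hz' _ hv' _ ht'

/-- The multiplicity of `ψ_z` over the ABox. -/
theorem eval_psi_canonical (hq : q.Rooted) (hzy : z ⊆ q.y) (hr : q.Realisable T ch z)
    {S : ∀ z', q.MaConnected z z' → Role R} {t₀ : ∀ z', q.MaConnected z z' → Term I V}
    {v₀ : ∀ z', q.MaConnected z z' → V}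
    (L : ∀ z' h, q.LinkAt ch z z' (S z' h) (t₀ z' h) (v₀ z' h))
    (γ : V → (canonical (∅ : TBox C R) A).Dom) :
    (q.psi T ch z).eval (canonical ∅ A) γ =
      if q.EqsOutside z (fun v => (γ v).1) ∧ q.LinkTermsAgree z (fun v => (γ v).1) then
        ((q.body.filter fun α => ¬ α.Mentions z).map (rawMult T A fun v => (γ v).1)).prod *
          ∏ i : q.maSets z, delta T A (termVal (fun v => (γ v).1) (t₀ i.1 (mem_maSets.1 i.2)))
            (S i.1 (mem_maSets.1 i.2))
      else 0 := by
  rw [eval_psi]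
  refine if_congr (satEqs_bodyZ_iff hq hzy hr γ) ?_ rfl
  rw [bodyZ, List.map_append, List.prod_append, prod_map_flatMap, Finset.prod_map_toList]
  congr 1
  · have : (q.body.filter fun α => ∀ z' ∈ q.maSets z, ¬ α.Mentions z') =
        q.body.filter fun α => ¬ α.Mentions z := by
      refine List.filter_congr fun α _ => ?_
      simp only [hr.1.mentions_iff, not_exists, not_and]
    rw [this]
    congr 1
    refine List.map_congr_left fun α hα => replMult_canonical_of_not_mentions γ ?_
    simpa using (List.mem_filter.1 hα).2
  · rw [← Finset.prod_coe_sort]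
    refine Finset.prod_congr rfl fun ⟨z', hz'⟩ _ => ?_
    have h := mem_maSets.1 hz'
    have h1 : ((q.linkEqs z z').map (replMult (canonical ∅ A) T z γ)).prod = 1 := by
      refine List.prod_eq_one fun n hn => ?_
      obtain ⟨α, hα, rfl⟩ := List.mem_map.1 hn
      obtain ⟨v, t, -, -, rfl⟩ := mem_linkEqs.1 hα
      rfl
    rw [List.map_cons, List.prod_cons, h1, mul_one, (L _ h).eq,
      replMult_canonical_ofRole γ (L _ h).isLink.2.1 (h.2.1 (L _ h).mem)]

/-! ### Summation over the valuations -/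

/-- The valuations that contribute to the answer `a`. -/
abbrev Valuation (q : CQ I V C R) (T : TBox C R) (A : ABox I C R) (a : q.x → I) : Type :=
  {μ : (q.x ∪ q.y : Finset V) → (canonical T A).Dom //
    (∀ v : q.x, (canonical T A).extend (q.x ∪ q.y) μ v = (canonical T A).ind (a v)) ∧
    ∀ v t, Atom.eq v t ∈ q.body → (canonical T A).extend (q.x ∪ q.y) μ v =
      (canonical T A).val ((canonical T A).extend (q.x ∪ q.y) μ) t}

variable {a : q.x → I}

/-- The assignment of elements given by a valuation. -/
def Valuation.raw (i : q.Valuation T A a) : V → Elem I R :=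
  fun v => ((canonical T A).extend (q.x ∪ q.y) i.1 v).1

/-- The contribution of a valuation. -/
def Valuation.weight (i : q.Valuation T A a) : ℕ∞ := (q.body.map (rawMult T A i.raw)).prod

/-- The existential variables that are mapped to anonymous elements. -/
def Valuation.anon (i : q.Valuation T A a) : Finset V := q.y.filter fun v => 0 < (i.raw v).depth

theorem answers_eq_tsum_weight :
    q.answers (canonical T A) a = ∑' i : q.Valuation T A a, i.weight := by
  refine tsum_congr fun i => ?_
  rw [Valuation.weight, List.map_congr_left fun α _ => canonical_mult _ α]
  rfl

theorem Valuation.raw_x (i : q.Valuation T A a) {v : V} (hv : v ∈ q.x) :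
    i.raw v = .ind (a ⟨v, hv⟩) := congrArg Subtype.val (i.2.1 ⟨v, hv⟩)

theorem Valuation.raw_eq (i : q.Valuation T A a) {v : V} {t : Term I V}
    (h : Atom.eq v t ∈ q.body) : i.raw v = termVal i.raw t := by
  have := congrArg Subtype.val (i.2.2 v t h)
  rwa [canonical_val] at this

theorem Valuation.good (i : q.Valuation T A a) (v : V) : Good T A (i.raw v) :=
  (exists_mem_stage_iff T A _).1 ((canonical T A).extend (q.x ∪ q.y) i.1 v).2

theorem Valuation.not_anon (i : q.Valuation T A a) {v : V} (hv : v ∈ q.x ∪ q.y)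
    (h : v ∉ i.anon) : ¬ 0 < (i.raw v).depth := by
  rcases Finset.mem_union.1 hv with hv | hv
  · rw [i.raw_x hv]
    exact lt_irrefl 0
  · exact fun hd => h (Finset.mem_filter.2 ⟨hv, hd⟩)

theorem Valuation.holds (i : q.Valuation T A a) (hi : i.weight ≠ 0) {α : Atom I V C R}
    (hα : α ∈ q.body) : HoldsAt T A i.raw α := by
  have h : rawMult T A i.raw α ≠ 0 := fun h0 =>
    hi (List.prod_eq_zero (List.mem_map.2 ⟨α, hα, h0⟩))
  cases α with
  | concept B t => exact h
  | role P t₁ t₂ => exact h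
  | eq v t => exact i.raw_eq hα

/-- Equated terms have the same value, and neither answer variables nor individuals take anonymous
values. -/
theorem Valuation.eqConsistent (i : q.Valuation T A a) : q.EqConsistent i.anon := by
  intro v t hvt
  have he := i.raw_eq hvt
  have key : ∀ u, u ∈ q.x ∪ q.y → (u ∈ i.anon ↔ 0 < (i.raw u).depth) := fun u hu =>
    ⟨fun h => (Finset.mem_filter.1 h).2, fun h => by_contra fun hn => i.not_anon hu hn h⟩
  rw [key v (q.scope _ hvt v (by simp [Atom.terms])), he]
  cases t with
  | var u =>
    rw [Term.varIn_var, key u (q.scope _ hvt u (by simp [Atom.terms])), termVal]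
  | ind c => exact iff_of_false (lt_irrefl 0) Term.not_varIn_ind

/-- Valuations with a non-zero contribution map a realisable set of variables to anonymous
elements. -/
theorem Valuation.realisable (hq : q.Rooted) (i : q.Valuation T A a) (hi : i.weight ≠ 0) :
    q.Realisable T ch i.anon := by
  refine ⟨i.eqConsistent, fun z' h => ?_⟩
  obtain ⟨S, t, v, L⟩ := exists_linkAt (ch := ch) hq (Finset.filter_subset _ _) i.eqConsistent h
  refine L.realisableMa (A := A) (β := i.raw) i.eqConsistent h
    (fun v hv => (Finset.mem_filter.1 (h.2.1 hv)).2) (fun v _ => i.good v)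
    (fun t ht => depth_linkTerm (fun v hv hn => i.not_anon hv hn) ht)
    fun α hα => i.holds hi (mem_sub.1 hα).1

/-- The valuation given by a match of the atoms that mention `z`. -/
theorem exists_valuation (hz : q.EqConsistent z) (hzy : z ⊆ q.y) {γ : V → Elem I R}
    (hx : ∀ v (hv : v ∈ q.x), γ v = .ind (a ⟨v, hv⟩)) (hγ : ∀ v, ∃ c, γ v = .ind c)
    (hE : q.EqsOutside z γ) (θ : q.Solution T A z γ) :
    ∃ i : q.Valuation T A a, i.anon = z ∧
      ∀ v ∈ q.x ∪ q.y, i.raw v = override z θ.1 γ v := by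
  have hgood : ∀ v, Good T A (override z θ.1 γ v) := by
    intro v
    by_cases hv : v ∈ z
    · exact θ.good hv
    · rw [override_of_notMem hv]
      obtain ⟨c, hc⟩ := hγ v
      rw [hc]
      trivial
  let μ : (q.x ∪ q.y : Finset V) → (canonical T A).Dom := fun v =>
    ⟨override z θ.1 γ v, (exists_mem_stage_iff T A _).2 (hgood v)⟩
  have hμ : ∀ v ∈ q.x ∪ q.y,
      ((canonical T A).extend (q.x ∪ q.y) μ v).1 = override z θ.1 γ v := by
    intro v hv
    rw [BagInterp.extend, override_of_mem hv]
  refine ⟨⟨μ, fun v => Subtype.ext ?_, fun v t hvt => Subtype.ext ?_⟩, ?_, hμ⟩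
  · rw [hμ v (Finset.mem_union_left _ v.2), override_of_notMem, hx v v.2]
    · rfl
    · exact fun hv => Finset.disjoint_left.1 q.disjoint v.2 (hzy hv)
  · have ht : ∀ u, t = .var u → ((canonical T A).extend (q.x ∪ q.y) μ u).1 =
        override z θ.1 γ u := by
      rintro u rfl
      exact hμ u (q.scope _ hvt u (by simp [Atom.terms]))
    rw [canonical_val, hμ v (q.scope _ hvt v (by simp [Atom.terms])), termVal_congr ht]
    by_cases hv : v ∈ z
    · exact θ.2.2 _ hvt ⟨_, by simp [Atom.terms], Term.varIn_var.2 hv⟩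
    · rw [override_of_notMem hv, termVal_override fun h => hv ((hz v t hvt).2 h)]
      exact hE v t hvt hv
  · ext v
    simp only [Valuation.anon, Finset.mem_filter]
    constructor
    · rintro ⟨hv, hd⟩
      by_contra hn
      have hd' : 0 < ((canonical T A).extend (q.x ∪ q.y) μ v).1.depth := hd
      rw [hμ v (Finset.mem_union_right _ hv), override_of_notMem hn] at hd'
      obtain ⟨c, hc⟩ := hγ v
      rw [hc] at hd'
      exact absurd hd' (lt_irrefl 0)
    · intro hv
      refine ⟨hzy hv, ?_⟩
      have hd := θ.anon hv
      rw [← hμ v (Finset.mem_union_right _ (hzy hv))] at hd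
      exact hd

/-- The contribution of the valuations with a given set `z` of variables mapped to anonymous
elements and given values of the other variables. -/
theorem tsum_weight_fiber (hz : q.EqConsistent z) (hzy : z ⊆ q.y) {γ : V → Elem I R}
    (hx : ∀ v (hv : v ∈ q.x), γ v = .ind (a ⟨v, hv⟩)) (hγ : ∀ v, ∃ c, γ v = .ind c) :
    ∑' i : {i : q.Valuation T A a // i.anon = z ∧
        ∀ v ∈ q.x ∪ q.y, v ∉ z → i.raw v = γ v}, i.1.weight =
      if q.EqsOutside z γ then
        ((q.body.filter fun α => ¬ α.Mentions z).map (rawMult T A γ)).prod *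
          ENat.card (q.Solution T A z γ)
      else 0 := by
  have hev : ∀ {β : V → Elem I R} {α : Atom I V C R}, α ∈ q.body → ∀ t ∈ α.terms,
      (∀ v ∈ q.x ∪ q.y, β v = γ v ∨ v ∈ z) → ¬ t.VarIn z → termVal β t = termVal γ t := by
    intro β α hα t ht hβ hn
    refine termVal_congr ?_
    rintro v rfl
    exact (hβ v (q.scope α hα v ht)).resolve_right fun h => hn (Term.varIn_var.2 h)
  split_ifs with hE
  -- Solutions embed into the fibre, and the image contains every valuation of non-zero weight; the
  -- sum thus becomes a sum over solutions.
  · choose G hG₁ hG₂ using exists_valuation (T := T) (A := A) (a := a) hz hzy hx hγ hE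
    let F : q.Solution T A z γ → {i : q.Valuation T A a // i.anon = z ∧
        ∀ v ∈ q.x ∪ q.y, v ∉ z → i.raw v = γ v} := fun θ =>
      ⟨G θ, hG₁ θ, fun v hv hn => by rw [hG₂ θ v hv, override_of_notMem hn]⟩
    have hinj : Function.Injective F := by
      intro θ θ' h
      have h' : G θ = G θ' := congrArg Subtype.val h
      refine Subtype.ext (funext fun v => ?_)
      have hv := Finset.mem_union_right q.x (hzy v.2)
      have h1 := hG₂ θ v hv
      rw [h', hG₂ θ' v hv, override_of_mem v.2, override_of_mem v.2] at h1
      exact h1.symm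
    have hsupp : Function.support (fun i : {i : q.Valuation T A a // i.anon = z ∧
        ∀ v ∈ q.x ∪ q.y, v ∉ z → i.raw v = γ v} => i.1.weight) ⊆ Set.range F := by
      rintro ⟨i, hi, hiγ⟩ hw
      have hraw : ∀ v ∈ q.x ∪ q.y, override z (fun v : z => i.raw v) γ v = i.raw v := by
        intro v hv
        by_cases hvz : v ∈ z
        · rw [override_of_mem hvz]
        · rw [override_of_notMem hvz, hiγ v hv hvz]
      have hsol : (∀ v : z, Good T A (i.raw v) ∧ 0 < (i.raw v).depth) ∧
          ∀ α ∈ q.body, α.Mentions z →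
            HoldsAt T A (override z (fun v : z => i.raw v) γ) α := by
        refine ⟨fun v => ⟨i.good v, (Finset.mem_filter.1 (hi ▸ v.2 : v.1 ∈ i.anon)).2⟩,
          fun α hα _ => (holdsAt_congr fun t ht => termVal_congr ?_).2 (i.holds hw hα)⟩
        rintro v rfl
        exact hraw v (q.scope α hα v ht)
      refine ⟨⟨_, hsol⟩, Subtype.ext (Subtype.ext (funext fun v => Subtype.ext ?_))⟩
      have h1 := (hG₂ ⟨_, hsol⟩ v v.2).trans (hraw v v.2)
      rw [Valuation.raw, Valuation.raw, BagInterp.extend, BagInterp.extend,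
        override_of_mem v.2, override_of_mem v.2] at h1
      exact h1
    rw [← hinj.tsum_eq hsupp, ← enat_tsum_one, ← enat_tsum_mul_left]
    refine tsum_congr fun θ => ?_
    rw [mul_one, Valuation.weight, ← prod_map_filter_mul _ fun α => α.Mentions z]
    have h1 : ∀ v ∈ z, 0 < ((G θ).raw v).depth := fun v hv => by
      rw [hG₂ θ v (Finset.mem_union_right _ (hzy hv))]
      exact θ.anon hv
    -- Atoms that mention `z` contribute the factor 1, so all solutions have the same weight and
    -- only their number counts.
    have h2 : ((q.body.filter fun α => α.Mentions z).map (rawMult T A (G θ).raw)).prod = 1 := by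
      refine List.prod_eq_one fun n hn => ?_
      obtain ⟨α, hα, rfl⟩ := List.mem_map.1 hn
      obtain ⟨hα, hm⟩ := List.mem_filter.1 hα
      have hm := of_decide_eq_true hm
      refine rawMult_of_mentions h1 hm ?_
      refine (holdsAt_congr fun t ht => termVal_congr ?_).2 (θ.2.2 α hα hm)
      rintro v rfl
      exact hG₂ θ v (q.scope α hα v ht)
    rw [h2, mul_one]
    congr 1
    refine List.map_congr_left fun α hα => rawMult_congr fun t ht => ?_
    obtain ⟨hα, hm⟩ := List.mem_filter.1 hα
    refine hev hα t ht (fun v hv => ?_) fun h => of_decide_eq_true hm ⟨t, ht, h⟩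
    by_cases hvz : v ∈ z
    · exact .inr hvz
    · exact .inl (by rw [hG₂ θ v hv, override_of_notMem hvz])
  -- An equality outside `z` that fails under `γ` fails for every valuation that agrees with `γ`
  -- there, so the fibre is empty.
  · have : IsEmpty {i : q.Valuation T A a // i.anon = z ∧
        ∀ v ∈ q.x ∪ q.y, v ∉ z → i.raw v = γ v} := by
      refine ⟨fun ⟨i, hi, hiγ⟩ => hE fun v t hvt hv => ?_⟩
      rw [← hiγ v (q.scope _ hvt v (by simp [Atom.terms])) hv, i.raw_eq hvt]
      refine hev hvt t (by simp [Atom.terms]) (fun v hv => ?_) fun h => hv ((hz v t hvt).2 h)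
      by_cases hvz : v ∈ z
      · exact .inr hvz
      · exact .inl (hiγ v hv hvz)
    exact tsum_empty

/-- The contribution of the valuations with a given realisable set `z` of variables mapped to
anonymous elements. -/
theorem tsum_weight_anon (hq : q.Rooted) (hzy : z ⊆ q.y) (hr : q.Realisable T ch z) :
    ∑' i : {i : q.Valuation T A a // i.anon = z}, i.1.weight =
      ∑' μ : q.yZ ch z → (canonical (∅ : TBox C R) A).Dom,
        (q.psi T ch z).eval (canonical ∅ A) (override (q.yZ ch z) μ
          ((canonical ∅ A).extend q.x fun v => (canonical ∅ A).ind (a v))) := by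
  choose S t₀ v₀ L using fun z' (h : q.MaConnected z z') =>
    exists_linkAt (ch := ch) hq hzy hr.1 h
  -- The variables in `y_z` take individuals as values, so the roots recover these values as
  -- elements of the model of the ABox. Grouping by them matches the projection `∃ y_z`.
  rw [enat_tsum_fiberwise (fun i : {i : q.Valuation T A a // i.anon = z} => i.1.weight)
    fun i (v : q.yZ ch z) => (canonical (∅ : TBox C R) A).ind (i.1.raw v).root]
  refine tsum_congr fun ν => ?_
  set γ := override (q.yZ ch z) ν
    ((canonical (∅ : TBox C R) A).extend q.x fun v => (canonical ∅ A).ind (a v)) with hγ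
  have hind : ∀ v, ∃ c, (γ v).1 = .ind c := fun v => canonical_empty_eq_ind _
  have hγy : ∀ v (hv : v ∈ q.yZ ch z), γ v = ν ⟨v, hv⟩ := fun v hv => override_of_mem hv
  have hx : ∀ v (hv : v ∈ q.x), (γ v).1 = .ind (a ⟨v, hv⟩) := by
    intro v hv
    have hvy : v ∉ q.yZ ch z := fun h =>
      Finset.disjoint_left.1 q.disjoint hv (Finset.mem_sdiff.1 (Finset.mem_filter.1 h).1).1
    rw [hγ, override_of_notMem hvy, BagInterp.extend, override_of_mem hv]
    rfl
  have hcard := card_solution (A := A) hr (γ := fun v => (γ v).1) (fun v _ _ => by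
    obtain ⟨c, hc⟩ := hind v
    rw [hc]
    exact lt_irrefl 0) L
  have hsum := tsum_weight_fiber (T := T) (A := A) (a := a) hr.1 hzy hx hind
  rw [eval_psi_canonical hq hzy hr L, ite_and]
  rw [hcard, mul_ite, mul_zero] at hsum
  rw [← hsum]
  -- Prescribing the values on `y_z` prescribes them on all variables outside `z`, because the
  -- values on `x` are given by the answer `a`.
  let e : {i : {i : q.Valuation T A a // i.anon = z} //
      (fun v : q.yZ ch z => (canonical (∅ : TBox C R) A).ind (i.1.raw v).root) = ν} ≃
      {i : q.Valuation T A a // i.anon = z ∧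
        ∀ v ∈ q.x ∪ q.y, v ∉ z → i.raw v = (γ v).1} :=
    (Equiv.subtypeSubtypeEquivSubtypeInter (fun i : q.Valuation T A a => i.anon = z) fun i =>
      (fun v : q.yZ ch z => (canonical (∅ : TBox C R) A).ind (i.raw v).root) = ν).trans
    (Equiv.subtypeEquivRight fun i => and_congr_right fun hi => by
      constructor
      · rintro h v hv hvz
        rcases Finset.mem_union.1 (((hr.1.x_union_yZ (ch := ch) hzy).2 ⟨hv, hvz⟩)) with h1 | h1
        · rw [hx v h1, i.raw_x h1]
        · have h2 := congrArg Subtype.val (congrFun h ⟨v, h1⟩)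
          rw [hγy v h1, ← h2]
          exact Elem.eq_ind_of_depth (i.not_anon hv (hi ▸ hvz))
      · intro h
        funext ⟨v, hv⟩
        have h1 := (hr.1.x_union_yZ (ch := ch) hzy).1 (Finset.mem_union_right q.x hv)
        refine Subtype.ext ?_
        rw [← hγy v hv, ← h v h1.1 h1.2]
        exact (Elem.eq_ind_of_depth (i.not_anon h1.1 (hi ▸ h1.2))).symm)
  exact e.tsum_eq fun i => i.1.weight

/-- The valuations are split according to the variables that take anonymous values. By
`Valuation.realisable` a set that is not realisable contributes nothing, and the others are the
summands of the rewriting. -/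
theorem answers_eq_rewriting (hq : q.Rooted) (T : TBox C R) (ch : q.Choice) (A : ABox I C R) :
    q.answers (canonical T A) = (q.rewriting T ch).answers q.x (canonical ∅ A) := by
  funext a
  rw [answers_eq_tsum_weight, Query.answers, eval_rewriting,
    enat_tsum_fiberwise _ fun i : q.Valuation T A a => i.anon]
  rw [tsum_eq_sum (s := q.y.powerset.filter fun z => q.Realisable T ch z)]
  · refine Finset.sum_congr rfl fun z hz => ?_
    rw [Finset.mem_filter, Finset.mem_powerset] at hz
    exact tsum_weight_anon hq hz.1 hz.2
  · intro z hz
    refine (tsum_congr fun i => ?_).trans tsum_zero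
    obtain ⟨i, rfl⟩ := i
    by_contra hi
    exact hz (Finset.mem_filter.2
      ⟨Finset.mem_powerset.2 (Finset.filter_subset _ _), i.realisable hq hi⟩)

end CQ

end BagDL

end

/-! ### The main theorem -/

theorem theorem7 {I V C R : Type} [Infinite I] [Infinite V]
    (q : BagDL.CQ I V C R) (hq : q.Rooted) (T : BagDL.TBox C R) :
    Nonempty q.Choice ∧ ∀ ch : q.Choice,
      (∃ Q : BagDL.Query I V C R, Q.IsBALG q.x ∧
        ∀ (J : BagDL.BagInterp I C R) (β : V → J.Dom),
          Q.eval J β = (q.rewriting T ch).eval J β) ∧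
      ∀ A : BagDL.ABox I C R,
        q.answers (BagDL.canonical T A) =
          (q.rewriting T ch).answers q.x (BagDL.canonical ∅ A) :=
  ⟨BagDL.CQ.nonempty_choice q, fun ch =>
    ⟨BagDL.CQ.exists_balg_rewriting hq T ch, BagDL.CQ.answers_eq_rewriting hq T ch⟩⟩
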